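/- All algebras are unital and over $\mathbb C$. Let $G$ be the dense Hopf $*$-algebra of a compact quantum group (i.e. $G$ is spanned by the matrix coefficients of its finite-dimensional unitary corepresentations), let $M$ be a $*$-algebra, and let $\zeta$ be a quantum principal $G$-bundle over $M$: a $*$-algebra $B$ with a coaction $\Phi:B\to B\otimes G$ which is a $*$-homomorphism, whose algebra of invariants is $M$, and such that $x\otimes y\mapsto (x\otimes 1)\Phi(y)$ maps $B\otimes B$ onto $B\otimes G$. For a corepresentation $\alpha$ of $G$ on $V$ let $\Gamma_\alpha=\mathrm{Mor}^0(\alpha,\Phi)$ be the $M$-bimodule of linear maps $T:V\to B$ with $\Phi\circ T=(T\otimes\mathrm{id})\circ\alpha$. Assume that for each finite-dimensional irreducible $\alpha$ there are a basis $(e_i)$ of $V$, finitely many $T_k\in\Gamma_\alpha$ and a strictly positive matrix $Z$ such that, with $X=(x_{ki})$, $x_{ki}=T_k(e_i)$, one has $\sum_k x_{ki}^*x_{kj}=\delta_{ij}1$ and $(ZX)^{T}X^*=\mathrm{Id}$, where $X^*=(x_{ki}^*)$ is the entrywise adjoint. Let $\mathrm{Hor}$ be a graded $*$-algebra (so $(xy)^*=(-1)^{kl}y^*x^*$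 for $x,y$ of degrees $k,l$) with $\mathrm{Hor}^0=B$ and with a graded $*$-algebra coaction $\Phi_H$ of $G$ extending $\Phi$, whose algebra of invariants $\Omega(M)=\bigoplus_k\Omega^k(M)$, $\Omega^0(M)=M$, carries a differential $d$ making it a graded differential $*$-algebra generated by $M$. Let a regular quantum principal connection $\omega$ be given by its covariant derivative $D$: a linear map of degree $1$ on $\mathrm{Hor}$ with $\Phi_H D=(D\otimes\mathrm{id})\Phi_H$, $D(xy)=D(x)y+(-1)^{\deg x}xD(y)$, $D\circ *=*\circ D$ and $D|_{\Omega(M)}=d$. Then for every finite-dimensional corepresentation $\alpha$ of $G$: (1) $\Gamma_\alpha$ is finitely generated projective as a left and as a right $M$-module, and the maps $\Omega(M)\otimes_M\Gamma_\alpha\to\mathrm{Mor}^0(\alpha,\Phi_H)$, $\mu\otimes T\mapsto \mu T$, and $\Gamma_\alpha\otimes_M\Omega(M)\to\mathrm{Mor}^0(\alpha,\Phi_H)$, $T\otimes\mu\mapsto T\mu$, are bijective. Let $\Upsilon_\alpha$ and $\hat\Upsilon_\alpha$ be their inverses, $\sigma_\alpha=\hat\Upsilon_\alpha\circ\Upsilon_\alpha^{-1}$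 and $\nabla_\alpha(T)=\Upsilon_\alpha(D\circ T)$. Then $\mathrm{qAss}(\alpha)=(\Gamma_\alpha,\nabla_\alpha,\sigma_\alpha)$ is a quantum vector bundle over $M$ with a quantum linear connection: $\sigma_\alpha:\Omega(M)\otimes_M\Gamma_\alpha\to\Gamma_\alpha\otimes_M\Omega(M)$ is a grading-preserving $M$-bimodule isomorphism, $\nabla_\alpha$ takes values in $\Omega^1(M)\otimes_M\Gamma_\alpha$, and $\nabla_\alpha(pT)=p\nabla_\alpha(T)+dp\otimes T$, $\nabla_\alpha(Tp)=\nabla_\alpha(T)p+\sigma_\alpha^{-1}(T\otimes dp)$ for $p\in M$. (2) For all finite-dimensional corepresentations $\alpha_1,\alpha_2$ on $V_1,V_2$ there is an $M$-bimodule isomorphism $A_{\alpha_1,\alpha_2}:\Gamma_{\alpha_1\otimes\alpha_2}\to\Gamma_{\alpha_1}\otimes_M\Gamma_{\alpha_2}$ with $$A_{\alpha_1,\alpha_2}^{-1}(T^1\otimes T^2)(v_1\otimes v_2)=T^1(v_1)\,T^2(v_2),$$ $$(\mathrm{id}\otimes A_{\alpha_1,\alpha_2})\circ\nabla_{\alpha_1\otimes\alpha_2}=\nabla^{\otimes}\circ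 A_{\alpha_1,\alpha_2},\qquad (A_{\alpha_1,\alpha_2}\otimes\mathrm{id})\circ\sigma_{\alpha_1\otimes\alpha_2}=\sigma^{\otimes}\circ(\mathrm{id}\otimes A_{\alpha_1,\alpha_2}),$$ where $\sigma^\otimes=(\mathrm{id}\otimes\sigma_{\alpha_2})(\sigma_{\alpha_1}\otimes\mathrm{id})$ and $\nabla^\otimes(T^1\otimes T^2)=\nabla_{\alpha_1}T^1\otimes T^2+(\sigma_{\alpha_1}^{-1}\otimes\mathrm{id})(T^1\otimes\nabla_{\alpha_2}T^2)$. Thus $A_{\alpha_1,\alpha_2}$ is a parallel isomorphism of degree $0$ from $\mathrm{qAss}(\alpha_1\otimes\alpha_2)$ to $\mathrm{qAss}(\alpha_1)\otimes\mathrm{qAss}(\alpha_2)$. (3) The family $A$ is natural. Degree $0$: for linear corepresentation morphisms $f:\alpha\to\alpha'$, $g:\beta\to\beta'$ and $T\in\Gamma_{\alpha'\otimes\beta'}$, $A_{\alpha,\beta}(T\circ(f\otimes g))=(f^\sharp\otimes g^\sharp)A_{\alpha',\beta'}(T)$ with $f^\sharp(T)=T\circ f$ and $g^\sharp(S)=S\circ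 g$. Degree $1$: for antilinear corepresentation morphisms $f:\alpha\to\beta'$, $g:\beta\to\alpha'$ (antilinear maps $f$ with $\beta'\circ f=(f\otimes *)\circ\alpha$, and likewise for $g$), with $(f\otimes^T g)(v\otimes w)=g(w)\otimes f(v)$ and $T\in\Gamma_{\alpha'\otimes\beta'}$, the element $A_{\alpha,\beta}\big(*\circ T\circ(f\otimes^T g)\big)$ is the image of $A_{\alpha',\beta'}(T)$ under the antilinear map $\Gamma_{\alpha'}\otimes_M\Gamma_{\beta'}\to\Gamma_\alpha\otimes_M\Gamma_\beta$, $T^1\otimes T^2\mapsto (*\circ T^2\circ f)\otimes(*\circ T^1\circ g)$. -/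

import Mathlib

open scoped TensorProduct
open MulOpposite

noncomputable section

/-! ## Compact quantum groups and their representations -/

/-- `G` is the dense Hopf `*`-algebra of a compact quantum group: the comultiplication is
a `*`-map and `G` is the linear span of the matrix coefficients of its finite dimensional unitary
corepresentations. -/
class CQGAlgebra (G : Type*) [Ring G] [HopfAlgebra ℂ G] [StarRing G] [StarModule ℂ G] :
    Prop where
  comul_star : ∀ a : G, Coalgebra.comul (R := ℂ) (star a) = star (Coalgebra.comul (R := ℂ) a)
  span_coefficients : Submodule.span ℂ {g : G | ∃ (n : ℕ) (u : Matrix (Fin n) (Fin n) G),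
    (∀ i j, Coalgebra.comul (R := ℂ) (u i j) = ∑ k, u i k ⊗ₜ[ℂ] u k j) ∧
    (∀ i j, Coalgebra.counit (R := ℂ) (u i j) = if i = j then 1 else 0) ∧
    u * u.conjTranspose = 1 ∧ u.conjTranspose * u = 1 ∧ ∃ i j, g = u i j} = ⊤

/-- A (right) corepresentation of `G` on the vector space `V`, of any dimension. -/
structure Corep (G : Type*) [Ring G] [HopfAlgebra ℂ G]
    (V : Type*) [AddCommGroup V] [Module ℂ V] where
  coact : V →ₗ[ℂ] V ⊗[ℂ] G
  counit_coact : ∀ v, TensorProduct.rid ℂ V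
    (LinearMap.lTensor V (Coalgebra.counit (R := ℂ) (A := G)) (coact v)) = v
  coassoc : ∀ v, TensorProduct.assoc ℂ V G G (LinearMap.rTensor G coact (coact v)) =
    LinearMap.lTensor V (Coalgebra.comul (R := ℂ) (A := G)) (coact v)

namespace Corep

variable {G : Type*} [Ring G] [HopfAlgebra ℂ G]
variable {V W V' W' : Type*} [AddCommGroup V] [Module ℂ V] [AddCommGroup W] [Module ℂ W]
  [AddCommGroup V'] [Module ℂ V'] [AddCommGroup W'] [Module ℂ W']

/-- Corepresentation morphisms of degree `0`: linear maps commuting with the coactions. -/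
def Hom0 (α : Corep G V) (β : Corep G W) : Submodule ℂ (V →ₗ[ℂ] W) where
  carrier := {f | ∀ v, β.coact (f v) = LinearMap.rTensor G f (α.coact v)}
  add_mem' := by
    intro f g hf hg v
    simp only [Set.mem_ofPred_eq] at hf hg
    simp [LinearMap.rTensor_add, hf v, hg v]
  zero_mem' := by intro v; simp
  smul_mem' := by
    intro c f hf v
    simp only [Set.mem_ofPred_eq] at hf
    simp [LinearMap.rTensor_smul, hf v]

/-- Corepresentation morphisms of degree `1`: antilinear maps `f` with
`β ∘ f = (f ⊗ *) ∘ α`. -/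
def Hom1 [StarRing G] [StarModule ℂ G] (α : Corep G V) (β : Corep G W) :
    Set (V →ₛₗ[starRingEnd ℂ] W) :=
  {f | ∀ v, β.coact (f v) =
    TensorProduct.map f (starLinearEquiv ℂ (A := G)).toLinearMap (α.coact v)}

/-- A nonzero corepresentation without proper nonzero invariant subspaces. -/
def IsIrreducible (α : Corep G V) : Prop :=
  Nontrivial V ∧ ∀ U : Submodule ℂ V,
    (∀ v ∈ U, α.coact v ∈ LinearMap.range (LinearMap.rTensor G U.subtype)) → U = ⊥ ∨ U = ⊤

/-- The product `(v ⊗ a, w ⊗ b) ↦ (v ⊗ w) ⊗ a b`. -/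
def mulT (K V W : Type*) [Ring K] [Algebra ℂ K] [AddCommGroup V] [Module ℂ V] [AddCommGroup W]
    [Module ℂ W] : (V ⊗[ℂ] K) ⊗[ℂ] (W ⊗[ℂ] K) →ₗ[ℂ] (V ⊗[ℂ] W) ⊗[ℂ] K :=
  LinearMap.lTensor (V ⊗[ℂ] W) (LinearMap.mul' ℂ K) ∘ₗ
    (TensorProduct.tensorTensorTensorComm ℂ V K W K).toLinearMap

@[simp] theorem mulT_tmul (K V W : Type*) [Ring K] [Algebra ℂ K] [AddCommGroup V] [Module ℂ V]
    [AddCommGroup W] [Module ℂ W] (v : V) (w : W) (a b : K) :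
    mulT K V W ((v ⊗ₜ a) ⊗ₜ (w ⊗ₜ b)) = (v ⊗ₜ w) ⊗ₜ (a * b) := by
  simp [mulT]

theorem rid_counit_mulT (s : V ⊗[ℂ] G) (t : W ⊗[ℂ] G) :
    TensorProduct.rid ℂ (V ⊗[ℂ] W)
      (LinearMap.lTensor _ (Coalgebra.counit (R := ℂ) (A := G)) (mulT G V W (s ⊗ₜ t))) =
    TensorProduct.rid ℂ V (LinearMap.lTensor V (Coalgebra.counit (R := ℂ) (A := G)) s) ⊗ₜ
    TensorProduct.rid ℂ W (LinearMap.lTensor W (Coalgebra.counit (R := ℂ) (A := G)) t) := by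
  induction s with
  | zero => simp
  | add a b ha hb => simp only [TensorProduct.add_tmul, map_add, ha, hb]
  | tmul v g =>
    induction t with
    | zero => simp
    | add a b ha hb => simp only [TensorProduct.tmul_add, map_add, ha, hb]
    | tmul w h => simp [TensorProduct.smul_tmul', smul_smul, TensorProduct.tmul_smul, mul_comm]

theorem comul_mulT (s : V ⊗[ℂ] G) (t : W ⊗[ℂ] G) :
    LinearMap.lTensor _ (Coalgebra.comul (R := ℂ) (A := G)) (mulT G V W (s ⊗ₜ t)) =
    mulT (G ⊗[ℂ] G) V W (LinearMap.lTensor V (Coalgebra.comul (R := ℂ) (A := G)) s ⊗ₜ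
      LinearMap.lTensor W (Coalgebra.comul (R := ℂ) (A := G)) t) := by
  induction s with
  | zero => simp
  | add a b ha hb => simp only [TensorProduct.add_tmul, map_add, ha, hb]
  | tmul v g =>
    induction t with
    | zero => simp
    | add a b ha hb => simp only [TensorProduct.tmul_add, map_add, ha, hb]
    | tmul w h => simp

theorem assoc_mulT (x : V ⊗[ℂ] G) (y : W ⊗[ℂ] G) (g h : G) :
    TensorProduct.assoc ℂ (V ⊗[ℂ] W) G G (mulT G V W (x ⊗ₜ y) ⊗ₜ (g * h)) =
    mulT (G ⊗[ℂ] G) V W (TensorProduct.assoc ℂ V G G (x ⊗ₜ g) ⊗ₜ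
      TensorProduct.assoc ℂ W G G (y ⊗ₜ h)) := by
  induction x with
  | zero => simp
  | add a b ha hb => simp only [TensorProduct.add_tmul, map_add, ha, hb]
  | tmul v a =>
    induction y with
    | zero => simp
    | add a b ha hb => simp only [TensorProduct.add_tmul, TensorProduct.tmul_add, map_add, ha, hb]
    | tmul w b => simp

theorem rTensor_mulT (α : V →ₗ[ℂ] V ⊗[ℂ] G) (β : W →ₗ[ℂ] W ⊗[ℂ] G)
    (s : V ⊗[ℂ] G) (t : W ⊗[ℂ] G) :
    TensorProduct.assoc ℂ (V ⊗[ℂ] W) G G (LinearMap.rTensor G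
      (mulT G V W ∘ₗ TensorProduct.map α β) (mulT G V W (s ⊗ₜ t))) =
    mulT (G ⊗[ℂ] G) V W (TensorProduct.assoc ℂ V G G (LinearMap.rTensor G α s) ⊗ₜ
      TensorProduct.assoc ℂ W G G (LinearMap.rTensor G β t)) := by
  induction s with
  | zero => simp
  | add a b ha hb => simp only [TensorProduct.add_tmul, map_add, ha, hb]
  | tmul v g =>
    induction t with
    | zero => simp
    | add a b ha hb => simp only [TensorProduct.tmul_add, map_add, ha, hb]
    | tmul w h => simpa using assoc_mulT (α v) (β w) g h

/-- The tensor product of two corepresentations: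
`v ⊗ w ↦ v⁽⁰⁾ ⊗ w⁽⁰⁾ ⊗ v⁽¹⁾ w⁽¹⁾`. -/
def tensor (α : Corep G V) (β : Corep G W) : Corep G (V ⊗[ℂ] W) where
  coact := mulT G V W ∘ₗ TensorProduct.map α.coact β.coact
  counit_coact := by
    intro x
    induction x with
    | zero => simp
    | add a b ha hb => rw [map_add, map_add, map_add, ha, hb]
    | tmul v w =>
      simp only [LinearMap.comp_apply, TensorProduct.map_tmul]
      rw [rid_counit_mulT, α.counit_coact, β.counit_coact]
  coassoc := by
    intro x
    induction x with
    | zero => simp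
    | add a b ha hb => simp only [map_add, ha, hb]
    | tmul v w =>
      simp only [LinearMap.comp_apply, TensorProduct.map_tmul]
      rw [comul_mulT, rTensor_mulT, α.coassoc, β.coassoc]

@[simp] theorem tensor_coact_tmul (α : Corep G V) (β : Corep G W) (v : V) (w : W) :
    (α.tensor β).coact (v ⊗ₜ w) = mulT G V W (α.coact v ⊗ₜ β.coact w) := rfl

/-- The tensor product of degree `0` morphisms is a degree `0` morphism. -/
theorem map_mem_hom0 {α : Corep G V} {β : Corep G W} {α' : Corep G V'} {β' : Corep G W'}
    {f : V →ₗ[ℂ] V'} {g : W →ₗ[ℂ] W'} (hf : f ∈ Hom0 α α') (hg : g ∈ Hom0 β β') :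
    TensorProduct.map f g ∈ Hom0 (α.tensor β) (α'.tensor β') := by
  intro x
  induction x with
  | zero => simp
  | add a b ha hb => simp only [map_add, ha, hb]
  | tmul v w =>
    rw [TensorProduct.map_tmul, tensor_coact_tmul, tensor_coact_tmul, hf v, hg w]
    generalize α.coact v = s
    generalize β.coact w = t
    induction s with
    | zero => simp
    | add a b ha hb => simp only [TensorProduct.add_tmul, map_add, ha, hb]
    | tmul v g =>
      induction t with
      | zero => simp
      | add a b ha hb => simp only [TensorProduct.tmul_add, map_add, ha, hb]
      | tmul w h => simp

/-- The twisted tensor product `v ⊗ w ↦ g w ⊗ f v` of antilinear maps. -/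
def twist (f : V →ₛₗ[starRingEnd ℂ] W') (g : W →ₛₗ[starRingEnd ℂ] V') :
    V ⊗[ℂ] W →ₛₗ[starRingEnd ℂ] V' ⊗[ℂ] W' :=
  (TensorProduct.map g f).comp (TensorProduct.comm ℂ V W).toLinearMap

@[simp] theorem twist_tmul (f : V →ₛₗ[starRingEnd ℂ] W') (g : W →ₛₗ[starRingEnd ℂ] V')
    (v : V) (w : W) : twist f g (v ⊗ₜ w) = g w ⊗ₜ f v := by simp [twist]

/-- The twisted tensor product of degree `1` morphisms is a degree `1` morphism. -/
theorem twist_mem_hom1 [StarRing G] [StarModule ℂ G]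
    {α : Corep G V} {β : Corep G W} {α' : Corep G V'} {β' : Corep G W'}
    {f : V →ₛₗ[starRingEnd ℂ] W'} {g : W →ₛₗ[starRingEnd ℂ] V'}
    (hf : f ∈ Hom1 α β') (hg : g ∈ Hom1 β α') :
    twist f g ∈ Hom1 (α.tensor β) (α'.tensor β') := by
  intro x
  induction x with
  | zero => simp
  | add a b ha hb => simp only [map_add, ha, hb]
  | tmul v w =>
    rw [twist_tmul, tensor_coact_tmul, tensor_coact_tmul, hf v, hg w]
    generalize α.coact v = s
    generalize β.coact w = t
    induction s with
    | zero => simp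
    | add a b ha hb => simp only [TensorProduct.tmul_add, TensorProduct.add_tmul, map_add, ha, hb]
    | tmul v g =>
      induction t with
      | zero => simp
      | add a b ha hb => simp only [TensorProduct.tmul_add, TensorProduct.add_tmul, map_add, ha, hb]
      | tmul w h => simp

end Corep

/-- Finite dimensional corepresentations, the objects of the category of representations. -/
structure QRep.{v, u} (G : Type u) [Ring G] [HopfAlgebra ℂ G] where
  V : Type v
  [addCommGroup : AddCommGroup V]
  [module : Module ℂ V]
  [finite : FiniteDimensional ℂ V]
  rep : Corep G V

attribute [instance] QRep.addCommGroup QRep.module QRep.finite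

/-- The tensor product of two finite dimensional corepresentations. -/
def QRep.tensor.{v, u} {G : Type u} [Ring G] [HopfAlgebra ℂ G] (α β : QRep.{v} G) : QRep.{v} G where
  V := α.V ⊗[ℂ] β.V
  rep := α.rep.tensor β.rep

set_option linter.unusedSectionVars false
set_option linter.unusedSimpArgs false

/-! ## Tensor products over a noncommutative algebra -/

section BT

variable (M : Type*) [Ring M] [Algebra ℂ M]

/-- The relations `(a m) ⊗ b = a ⊗ (m b)`. -/
def BT.rel (A B : Type*) [AddCommGroup A] [Module ℂ A] [Module Mᵐᵒᵖ A]
    [AddCommGroup B] [Module ℂ B] [Module M B] : Submodule ℂ (A ⊗[ℂ] B) :=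
  Submodule.span ℂ {t | ∃ (a : A) (m : M) (b : B), t = (op m • a) ⊗ₜ[ℂ] b - a ⊗ₜ[ℂ] (m • b)}

/-- The tensor product `A ⊗_M B` of a right `M`-module `A` and a left `M`-module `B`. -/
def BT (A B : Type*) [AddCommGroup A] [Module ℂ A] [Module Mᵐᵒᵖ A]
    [AddCommGroup B] [Module ℂ B] [Module M B] : Type _ :=
  (A ⊗[ℂ] B) ⧸ BT.rel M A B

namespace BT

section basic

variable (A B : Type*) [AddCommGroup A] [Module ℂ A] [Module Mᵐᵒᵖ A]
    [AddCommGroup B] [Module ℂ B] [Module M B]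

instance : AddCommGroup (BT M A B) := inferInstanceAs (AddCommGroup ((A ⊗[ℂ] B) ⧸ BT.rel M A B))

instance : Module ℂ (BT M A B) := inferInstanceAs (Module ℂ ((A ⊗[ℂ] B) ⧸ BT.rel M A B))

/-- The quotient map `A ⊗_ℂ B → A ⊗_M B`. -/
def proj : A ⊗[ℂ] B →ₗ[ℂ] BT M A B := (BT.rel M A B).mkQ

variable {A B}

/-- The elementary tensor `a ⊗_M b`. -/
def tmul (a : A) (b : B) : BT M A B := proj M A B (a ⊗ₜ b)

variable {M}

theorem tmul_add (a : A) (b b' : B) : tmul M a (b + b') = tmul M a b + tmul M a b' := by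
  simp [tmul, TensorProduct.tmul_add]

theorem add_tmul (a a' : A) (b : B) : tmul M (a + a') b = tmul M a b + tmul M a' b := by
  simp [tmul, TensorProduct.add_tmul]

theorem tmul_smul (c : ℂ) (a : A) (b : B) : tmul M a (c • b) = c • tmul M a b := by
  simp [tmul]

theorem smul_tmul (c : ℂ) (a : A) (b : B) : tmul M (c • a) b = c • tmul M a b := by
  rw [tmul, tmul, ← map_smul]; rfl

theorem tmul_zero (a : A) : tmul M a (0 : B) = 0 := by simp [tmul]

theorem zero_tmul (b : B) : tmul M (0 : A) b = 0 := by simp [tmul]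

theorem balanced (m : M) (a : A) (b : B) : tmul M (op m • a) b = tmul M a (m • b) := by
  have h : (op m • a) ⊗ₜ[ℂ] b - a ⊗ₜ[ℂ] (m • b) ∈ BT.rel M A B :=
    Submodule.subset_span ⟨a, m, b, rfl⟩
  have := (Submodule.Quotient.mk_eq_zero (BT.rel M A B)).2 h
  exact sub_eq_zero.1 this

theorem induction {p : BT M A B → Prop} (h0 : p 0) (hadd : ∀ x y, p x → p y → p (x + y))
    (ht : ∀ a b, p (tmul M a b)) (t : BT M A B) : p t := by
  obtain ⟨s, rfl⟩ := Submodule.mkQ_surjective (BT.rel M A B) t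
  induction s with
  | zero => exact (map_zero (BT.rel M A B).mkQ).symm ▸ h0
  | add a b ha hb => rw [map_add]; exact hadd _ _ ha hb
  | tmul a b => exact ht a b

/-- Descent of a balanced map; the map may be semilinear over `ℂ`. -/
def lift {τ : ℂ →+* ℂ} {X : Type*} [AddCommGroup X] [Module ℂ X]
    (f : A →ₛₗ[τ] B →ₛₗ[τ] X) (hf : ∀ (m : M) a b, f (op m • a) b = f a (m • b)) :
    BT M A B →ₛₗ[τ] X :=
  (BT.rel M A B).liftQ (TensorProduct.lift f) (by
    rw [BT.rel, Submodule.span_le]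
    rintro _ ⟨a, m, b, rfl⟩
    simp [hf])

@[simp] theorem lift_tmul {τ : ℂ →+* ℂ} {X : Type*} [AddCommGroup X] [Module ℂ X]
    (f : A →ₛₗ[τ] B →ₛₗ[τ] X) (hf : ∀ (m : M) a b, f (op m • a) b = f a (m • b)) (a : A) (b : B) :
    lift f hf (tmul M a b) = f a b := by
  change (BT.rel M A B).liftQ _ _ ((BT.rel M A B).mkQ (a ⊗ₜ b)) = _
  simp

theorem hom_ext {τ : ℂ →+* ℂ} {X : Type*} [AddCommGroup X] [Module ℂ X]
    {f g : BT M A B →ₛₗ[τ] X}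
    (h : ∀ a b, f (tmul M a b) = g (tmul M a b)) : f = g := by
  ext t
  induction t using BT.induction with
  | h0 => simp
  | hadd x y hx hy => simp [hx, hy]
  | ht a b => exact h a b

variable (M A B) in
/-- The elementary tensor as a bilinear map. -/
def mk : A →ₗ[ℂ] B →ₗ[ℂ] BT M A B :=
  LinearMap.mk₂ ℂ (tmul M) add_tmul smul_tmul tmul_add tmul_smul

@[simp] theorem mk_apply (a : A) (b : B) : mk M A B a b = tmul M a b := rfl

end basic

section map

variable {M}
variable {A B A' B' : Type*} [AddCommGroup A] [Module ℂ A] [Module Mᵐᵒᵖ A]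
    [AddCommGroup B] [Module ℂ B] [Module M B]
    [AddCommGroup A'] [Module ℂ A'] [Module Mᵐᵒᵖ A']
    [AddCommGroup B'] [Module ℂ B'] [Module M B']

/-- `f ⊗_M g` for a right linear `f` and a left linear `g`. -/
def map (f : A →ₗ[ℂ] A') (g : B →ₗ[ℂ] B') (hf : ∀ (m : M) a, f (op m • a) = op m • f a)
    (hg : ∀ (m : M) b, g (m • b) = m • g b) : BT M A B →ₗ[ℂ] BT M A' B' :=
  lift ((mk M A' B').compl₁₂ f g) (by intro m a b; simp [hf, hg, balanced])

@[simp] theorem map_tmul (f : A →ₗ[ℂ] A') (g : B →ₗ[ℂ] B')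
    (hf : ∀ (m : M) a, f (op m • a) = op m • f a)
    (hg : ∀ (m : M) b, g (m • b) = m • g b) (a : A) (b : B) :
    map f g hf hg (tmul M a b) = tmul M (f a) (g b) := by simp [map]

/-- `f ⊗_M g` for a right linear equivalence `f` and a left linear equivalence `g`. -/
def congr (f : A ≃ₗ[ℂ] A') (g : B ≃ₗ[ℂ] B') (hf : ∀ (m : M) a, f (op m • a) = op m • f a)
    (hg : ∀ (m : M) b, g (m • b) = m • g b) : BT M A B ≃ₗ[ℂ] BT M A' B' :=
  LinearEquiv.ofLinearMap (map f.toLinearMap g.toLinearMap hf hg)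
    (map f.symm.toLinearMap g.symm.toLinearMap
      (fun m a => f.injective (by simp [hf])) (fun m b => g.injective (by simp [hg])))
    (hom_ext (by simp)) (hom_ext (by simp))

@[simp] theorem congr_tmul (f : A ≃ₗ[ℂ] A') (g : B ≃ₗ[ℂ] B')
    (hf : ∀ (m : M) a, f (op m • a) = op m • f a)
    (hg : ∀ (m : M) b, g (m • b) = m • g b) (a : A) (b : B) :
    congr f g hf hg (tmul M a b) = tmul M (f a) (g b) := by simp [congr]

@[simp] theorem congr_symm_tmul (f : A ≃ₗ[ℂ] A') (g : B ≃ₗ[ℂ] B')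
    (hf : ∀ (m : M) a, f (op m • a) = op m • f a)
    (hg : ∀ (m : M) b, g (m • b) = m • g b) (a : A') (b : B') :
    (congr f g hf hg).symm (tmul M a b) = tmul M (f.symm a) (g.symm b) := by simp [congr]

/-- The twisted tensor product `a ⊗ b ↦ g b ⊗ f a` over a `*`-algebra `M` of antilinear maps that
exchange left and right multiplication, `f (a p) = p* f a` and `g (p b) = g b p*`. -/
def twist [StarRing M] {A B A' B' : Type*} [AddCommGroup A] [Module ℂ A] [Module Mᵐᵒᵖ A]
    [AddCommGroup B] [Module ℂ B] [Module M B] [AddCommGroup A'] [Module ℂ A'] [Module M A']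
    [AddCommGroup B'] [Module ℂ B'] [Module Mᵐᵒᵖ B']
    (f : A →ₛₗ[starRingEnd ℂ] A') (g : B →ₛₗ[starRingEnd ℂ] B')
    (hf : ∀ (m : M) a, f (op m • a) = star m • f a)
    (hg : ∀ (m : M) b, g (m • b) = op (star m) • g b) :
    BT M A B →ₛₗ[starRingEnd ℂ] BT M B' A' :=
  lift (LinearMap.mk₂'ₛₗ (starRingEnd ℂ) (starRingEnd ℂ) (fun a b => tmul M (g b) (f a))
    (fun a a' b => by rw [map_add, tmul_add]) (fun c a b => by rw [map_smulₛₗ, tmul_smul])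
    (fun a b b' => by rw [map_add, add_tmul]) (fun c a b => by rw [map_smulₛₗ, smul_tmul]))
    (by intro m a b; simp only [LinearMap.mk₂'ₛₗ_apply, hf, hg, balanced])

@[simp] theorem twist_tmul [StarRing M] {A B A' B' : Type*} [AddCommGroup A] [Module ℂ A]
    [Module Mᵐᵒᵖ A]
    [AddCommGroup B] [Module ℂ B] [Module M B] [AddCommGroup A'] [Module ℂ A'] [Module M A']
    [AddCommGroup B'] [Module ℂ B'] [Module Mᵐᵒᵖ B']
    (f : A →ₛₗ[starRingEnd ℂ] A') (g : B →ₛₗ[starRingEnd ℂ] B')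
    (hf : ∀ (m : M) a, f (op m • a) = star m • f a)
    (hg : ∀ (m : M) b, g (m • b) = op (star m) • g b) (a : A) (b : B) :
    twist f g hf hg (tmul M a b) = tmul M (g b) (f a) := by simp [twist]

end map

section bimodule

variable {M}
variable {A B : Type*} [AddCommGroup A] [Module ℂ A] [Module Mᵐᵒᵖ A]
    [AddCommGroup B] [Module ℂ B] [Module M B]

section left
variable [Module M A] [SMulCommClass M Mᵐᵒᵖ A] [IsScalarTower ℂ M A]

/-- Left multiplication by `m` on `A ⊗_M B`. -/
def actL (m : M) : BT M A B →ₗ[ℂ] BT M A B :=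
  map (DistribSMul.toLinearMap ℂ A m) LinearMap.id
    (by intro n a; simp [smul_comm]) (by simp)

@[simp] theorem actL_tmul (m : M) (a : A) (b : B) :
    actL m (tmul M a b) = tmul M (m • a) b := by simp [actL]

instance : Module M (BT M A B) :=
  Module.compHom (BT M A B) (R := Module.End ℂ (BT M A B))
    { toFun := actL
      map_one' := hom_ext (by simp)
      map_mul' := fun m n => hom_ext (by simp [mul_smul])
      map_zero' := hom_ext (by simp [zero_tmul])
      map_add' := fun m n => hom_ext (by simp [add_smul, add_tmul]) }

theorem smul_def (m : M) (t : BT M A B) : m • t = actL m t := rfl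

theorem act_tmul (m : M) (a : A) (b : B) : m • tmul M a b = tmul M (m • a) b := actL_tmul m a b

instance : IsScalarTower ℂ M (BT M A B) where
  smul_assoc c m t := by
    induction t using BT.induction with
    | h0 => simp
    | hadd x y hx hy => simp only [smul_add, hx, hy]
    | ht a b => simp only [act_tmul, smul_assoc, smul_tmul]

end left

section right
variable [Module Mᵐᵒᵖ B] [SMulCommClass M Mᵐᵒᵖ B] [IsScalarTower ℂ Mᵐᵒᵖ B]

/-- Right multiplication by `m` on `A ⊗_M B`. -/
def actR (m : Mᵐᵒᵖ) : BT M A B →ₗ[ℂ] BT M A B :=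
  map LinearMap.id (DistribSMul.toLinearMap ℂ B m)
    (by simp) (by intro n a; simp [smul_comm])

@[simp] theorem actR_tmul (m : Mᵐᵒᵖ) (a : A) (b : B) :
    actR m (tmul M a b) = tmul M a (m • b) := by simp [actR]

instance : Module Mᵐᵒᵖ (BT M A B) :=
  Module.compHom (BT M A B) (R := Module.End ℂ (BT M A B))
    { toFun := actR
      map_one' := hom_ext (by simp)
      map_mul' := fun m n => hom_ext (by simp [mul_smul])
      map_zero' := hom_ext (by simp [tmul_zero])
      map_add' := fun m n => hom_ext (by simp [add_smul, tmul_add]) }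

theorem op_smul_def (m : Mᵐᵒᵖ) (t : BT M A B) : m • t = actR m t := rfl

theorem op_act_tmul (m : Mᵐᵒᵖ) (a : A) (b : B) : m • tmul M a b = tmul M a (m • b) :=
  actR_tmul m a b

instance : IsScalarTower ℂ Mᵐᵒᵖ (BT M A B) where
  smul_assoc c m t := by
    induction t using BT.induction with
    | h0 => simp
    | hadd x y hx hy => simp only [smul_add, hx, hy]
    | ht a b => simp only [op_act_tmul, smul_assoc, tmul_smul]

end right

instance [Module M A] [SMulCommClass M Mᵐᵒᵖ A] [IsScalarTower ℂ M A]
    [Module Mᵐᵒᵖ B] [SMulCommClass M Mᵐᵒᵖ B] [IsScalarTower ℂ Mᵐᵒᵖ B] :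
    SMulCommClass M Mᵐᵒᵖ (BT M A B) where
  smul_comm m n t := by
    induction t using BT.induction with
    | h0 => simp
    | hadd x y hx hy => simp only [smul_add, hx, hy]
    | ht a b => simp only [act_tmul, op_act_tmul]

end bimodule

section assoc

variable (A B D : Type*) [AddCommGroup A] [Module ℂ A] [Module Mᵐᵒᵖ A]
    [AddCommGroup B] [Module ℂ B] [Module M B] [Module Mᵐᵒᵖ B] [SMulCommClass M Mᵐᵒᵖ B]
    [IsScalarTower ℂ M B] [IsScalarTower ℂ Mᵐᵒᵖ B]
    [AddCommGroup D] [Module ℂ D] [Module M D]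

/-- Reassociation `(a ⊗ b) ⊗ d ↦ a ⊗ (b ⊗ d)`. -/
def assocTo : BT M (BT M A B) D →ₗ[ℂ] BT M A (BT M B D) :=
  lift (lift (LinearMap.mk₂ ℂ (fun a b => (mk M A (BT M B D) a).comp (mk M B D b))
      (by intros; ext; simp [add_tmul]) (by intros; ext; simp [smul_tmul])
      (by intros; ext; simp [add_tmul, tmul_add]) (by intros; ext; simp [smul_tmul, tmul_smul]))
    (by intro m a b; ext d; simp [balanced, act_tmul]))
    (by
      intro m t d
      induction t using BT.induction with
      | h0 => simp
      | hadd x y hx hy => simp only [smul_add, map_add, LinearMap.add_apply, hx, hy]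
      | ht a b => simp [op_act_tmul, balanced])

@[simp] theorem assocTo_tmul (a : A) (b : B) (d : D) :
    assocTo M A B D (tmul M (tmul M a b) d) = tmul M a (tmul M b d) := by simp [assocTo]

/-- Reassociation `a ⊗ (b ⊗ d) ↦ (a ⊗ b) ⊗ d`. -/
def assocFrom : BT M A (BT M B D) →ₗ[ℂ] BT M (BT M A B) D :=
  lift (LinearMap.flip (lift (LinearMap.mk₂ ℂ
      (fun b d => ((mk M (BT M A B) D).flip d).comp ((mk M A B).flip b))
      (by intros; ext; simp [add_tmul, tmul_add]) (by intros; ext; simp [smul_tmul, tmul_smul])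
      (by intros; ext; simp [tmul_add]) (by intros; ext; simp [tmul_smul]))
    (by intro m a b; ext d; simp [← balanced, op_act_tmul])))
    (by
      intro m a t
      induction t using BT.induction with
      | h0 => simp
      | hadd x y hx hy => simp only [smul_add, map_add, hx, hy]
      | ht a b => simp [act_tmul, balanced])

@[simp] theorem assocFrom_tmul (a : A) (b : B) (d : D) :
    assocFrom M A B D (tmul M a (tmul M b d)) = tmul M (tmul M a b) d := by simp [assocFrom]

/-- Associativity of the tensor product over `M`. -/
def assoc : BT M (BT M A B) D ≃ₗ[ℂ] BT M A (BT M B D) :=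
  LinearEquiv.ofLinearMap (assocTo M A B D) (assocFrom M A B D)
    (by
      refine hom_ext fun a t => ?_
      induction t using BT.induction with
      | h0 => simp [tmul_zero]
      | hadd x y hx hy => rw [tmul_add, map_add, map_add, hx, hy]
      | ht b d => simp)
    (by
      refine hom_ext fun t d => ?_
      induction t using BT.induction with
      | h0 => simp [zero_tmul]
      | hadd x y hx hy => rw [add_tmul, map_add, map_add, hx, hy]
      | ht b d => simp)

variable {A B D}

@[simp] theorem assoc_tmul (a : A) (b : B) (d : D) :
    assoc M A B D (tmul M (tmul M a b) d) = tmul M a (tmul M b d) := by simp [assoc]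

@[simp] theorem assoc_symm_tmul (a : A) (b : B) (d : D) :
    (assoc M A B D).symm (tmul M a (tmul M b d)) = tmul M (tmul M a b) d := by simp [assoc]

end assoc

end BT

end BT

/-! ## Graded differential `*`-calculi, quantum vector bundles and quantum linear connections -/

/-- A graded unital `*`-algebra over `ℂ`; the involution respects the degree and is graded
antimultiplicative, `(x y)* = (-1)^(k l) y* x*` for `x`, `y` of degree `k`, `l`. -/
structure GradedStarAlg where
  carrier : Type*
  [ring : Ring carrier]
  [algebra : Algebra ℂ carrier]
  gr : ℕ → Submodule ℂ carrier
  [graded : GradedAlgebra gr]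
  conj : carrier →ₛₗ[starRingEnd ℂ] carrier
  conj_conj : ∀ x, conj (conj x) = x
  conj_mem : ∀ k, ∀ x ∈ gr k, conj x ∈ gr k
  conj_mul : ∀ k l, ∀ x ∈ gr k, ∀ y ∈ gr l, conj (x * y) = (-1 : ℂ) ^ (k * l) • (conj y * conj x)

attribute [instance] GradedStarAlg.ring GradedStarAlg.algebra GradedStarAlg.graded

/-- A graded differential `*`-algebra whose degree zero part is the `*`-algebra `M`. -/
structure DiffStarCalculus (M : Type*) [Ring M] [Algebra ℂ M] [StarRing M] [StarModule ℂ M]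
    extends GradedStarAlg where
  incl : M →ₐ[ℂ] carrier
  incl_injective : Function.Injective incl
  incl_range : ∀ x, x ∈ gr 0 ↔ ∃ p, incl p = x
  incl_star : ∀ p, incl (star p) = conj (incl p)
  d : carrier →ₗ[ℂ] carrier
  d_mem : ∀ k, ∀ x ∈ gr k, d x ∈ gr (k + 1)
  d_d : ∀ x, d (d x) = 0
  d_mul : ∀ k, ∀ x ∈ gr k, ∀ y, d (x * y) = d x * y + (-1 : ℂ) ^ k • (x * d y)
  d_conj : ∀ x, d (conj x) = conj (d x)

namespace DiffStarCalculus

variable {M : Type*} [Ring M] [Algebra ℂ M] [StarRing M] [StarModule ℂ M]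
  (C : DiffStarCalculus M)

/-- Forms are an `M`-bimodule: `p • ω = p ω`. -/
instance : Module M C.carrier := Module.compHom C.carrier C.incl.toRingHom

/-- Forms are an `M`-bimodule: `op p • ω = ω p`. -/
instance : Module Mᵐᵒᵖ C.carrier := Module.compHom C.carrier (RingHom.op C.incl.toRingHom)

theorem smul_def (p : M) (ω : C.carrier) : p • ω = C.incl p * ω := rfl

theorem op_smul_def (p : M) (ω : C.carrier) : op p • ω = ω * C.incl p := rfl

instance : SMulCommClass M Mᵐᵒᵖ C.carrier where
  smul_comm p q ω := by
    induction q using MulOpposite.rec' with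
    | _ q => simp only [smul_def, op_smul_def, mul_assoc]

instance : IsScalarTower ℂ M C.carrier where
  smul_assoc c p ω := by simp [smul_def]

instance : IsScalarTower ℂ Mᵐᵒᵖ C.carrier where
  smul_assoc c p ω := by
    induction p using MulOpposite.rec' with
    | _ p => rw [← op_smul]; simp only [op_smul_def]; simp

end DiffStarCalculus

section degree

variable (M : Type*) [Ring M] [Algebra ℂ M]
variable {A B D A' B' : Type*} [AddCommGroup A] [Module ℂ A] [Module Mᵐᵒᵖ A]
    [AddCommGroup B] [Module ℂ B] [Module M B]
    [AddCommGroup A'] [Module ℂ A'] [Module Mᵐᵒᵖ A']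
    [AddCommGroup B'] [Module ℂ B'] [Module M B']

/-- The image of `S ⊗ B` in `A ⊗_M B`, for `S ⊆ A`. -/
def BT.spanL (B : Type*) [AddCommGroup B] [Module ℂ B] [Module M B] (S : Submodule ℂ A) :
    Submodule ℂ (BT M A B) :=
  Submodule.span ℂ {t | ∃ a ∈ S, ∃ b : B, t = BT.tmul M a b}

/-- The image of `A ⊗ S` in `A ⊗_M B`, for `S ⊆ B`. -/
def BT.spanR (A : Type*) [AddCommGroup A] [Module ℂ A] [Module Mᵐᵒᵖ A] (S : Submodule ℂ B) :
    Submodule ℂ (BT M A B) :=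
  Submodule.span ℂ {t | ∃ a : A, ∃ b ∈ S, t = BT.tmul M a b}

namespace BT

variable {M}

theorem tmul_mem_spanL {S : Submodule ℂ A} {a : A} (ha : a ∈ S) (b : B) :
    tmul M a b ∈ spanL M B S := Submodule.subset_span ⟨a, ha, b, rfl⟩

theorem tmul_mem_spanR {S : Submodule ℂ B} (a : A) {b : B} (hb : b ∈ S) :
    tmul M a b ∈ spanR M A S := Submodule.subset_span ⟨a, b, hb, rfl⟩

theorem spanL_le {X : Type*} [AddCommGroup X] [Module ℂ X] {S : Submodule ℂ A}
    {U : Submodule ℂ X} (f : BT M A B →ₗ[ℂ] X) (h : ∀ a ∈ S, ∀ b, f (tmul M a b) ∈ U)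
    {t : BT M A B} (ht : t ∈ spanL M B S) : f t ∈ U := by
  have : spanL M B S ≤ U.comap f := by
    rw [spanL, Submodule.span_le]
    rintro _ ⟨a, ha, b, rfl⟩
    exact h a ha b
  exact this ht

theorem spanR_le {X : Type*} [AddCommGroup X] [Module ℂ X] {S : Submodule ℂ B}
    {U : Submodule ℂ X} (f : BT M A B →ₗ[ℂ] X) (h : ∀ a, ∀ b ∈ S, f (tmul M a b) ∈ U)
    {t : BT M A B} (ht : t ∈ spanR M A S) : f t ∈ U := by
  have : spanR M A S ≤ U.comap f := by
    rw [spanR, Submodule.span_le]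
    rintro _ ⟨a, b, hb, rfl⟩
    exact h a b hb
  exact this ht

end BT

namespace BT

variable {M}
variable {A B D : Type*} [AddCommGroup A] [Module ℂ A] [Module Mᵐᵒᵖ A]
    [AddCommGroup B] [Module ℂ B] [Module M B] [Module Mᵐᵒᵖ B] [SMulCommClass M Mᵐᵒᵖ B]
    [IsScalarTower ℂ M B] [IsScalarTower ℂ Mᵐᵒᵖ B]
    [AddCommGroup D] [Module ℂ D] [Module M D]

theorem assoc_mem_left (S : Submodule ℂ A) (t : BT M (BT M A B) D) :
    t ∈ spanL M D (spanL M B S) ↔ assoc M A B D t ∈ spanL M (BT M B D) S := by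
  constructor
  · refine spanL_le (assoc M A B D).toLinearMap fun u hu d => ?_
    refine spanL_le ((assoc M A B D).toLinearMap ∘ₗ (mk M (BT M A B) D).flip d) (fun a ha b => ?_) hu
    simpa using tmul_mem_spanL ha _
  · intro h
    suffices ∀ s ∈ spanL M (BT M B D) S, (assoc M A B D).symm s ∈ spanL M D (spanL M B S) by
      simpa using this _ h
    intro s hs
    refine spanL_le (assoc M A B D).symm.toLinearMap (fun a ha u => ?_) hs
    induction u using BT.induction with
    | h0 => simp [tmul_zero]
    | hadd x y hx hy => rw [tmul_add, map_add]; exact add_mem hx hy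
    | ht b d => simpa using tmul_mem_spanL (tmul_mem_spanL ha b) d

theorem assoc_mem_mid (S : Submodule ℂ B) (t : BT M (BT M A B) D) :
    t ∈ spanL M D (spanR M A S) ↔ assoc M A B D t ∈ spanR M A (spanL M D S) := by
  constructor
  · refine spanL_le (assoc M A B D).toLinearMap fun u hu d => ?_
    refine spanR_le ((assoc M A B D).toLinearMap ∘ₗ (mk M (BT M A B) D).flip d) (fun a b hb => ?_) hu
    simpa using tmul_mem_spanR a (tmul_mem_spanL hb d)
  · intro h
    suffices ∀ s ∈ spanR M A (spanL M D S), (assoc M A B D).symm s ∈ spanL M D (spanR M A S) by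
      simpa using this _ h
    intro s hs
    refine spanR_le (assoc M A B D).symm.toLinearMap (fun a u hu => ?_) hs
    refine spanL_le ((assoc M A B D).symm.toLinearMap ∘ₗ mk M A (BT M B D) a) (fun b hb d => ?_) hu
    simpa using tmul_mem_spanL (tmul_mem_spanR a hb) d

theorem assoc_mem_right (S : Submodule ℂ D) (t : BT M (BT M A B) D) :
    t ∈ spanR M (BT M A B) S ↔ assoc M A B D t ∈ spanR M A (spanR M B S) := by
  constructor
  · refine spanR_le (assoc M A B D).toLinearMap fun u d hd => ?_
    induction u using BT.induction with
    | h0 => simp [zero_tmul]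
    | hadd x y hx hy => rw [add_tmul, map_add]; exact add_mem hx hy
    | ht a b => simpa using tmul_mem_spanR a (tmul_mem_spanR b hd)
  · intro h
    suffices ∀ s ∈ spanR M A (spanR M B S), (assoc M A B D).symm s ∈ spanR M (BT M A B) S by
      simpa using this _ h
    intro s hs
    refine spanR_le (assoc M A B D).symm.toLinearMap (fun a u hu => ?_) hs
    refine spanR_le ((assoc M A B D).symm.toLinearMap ∘ₗ mk M A (BT M B D) a) (fun b d hd => ?_) hu
    simpa using tmul_mem_spanR (tmul M a b) hd

end BT

namespace BT

variable {M}

theorem congr_mem_spanL (f : A ≃ₗ[ℂ] A') (g : B ≃ₗ[ℂ] B')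
    (hf : ∀ (m : M) a, f (op m • a) = op m • f a) (hg : ∀ (m : M) b, g (m • b) = m • g b)
    (S : Submodule ℂ A) (S' : Submodule ℂ A') (h : ∀ a, a ∈ S ↔ f a ∈ S') (t : BT M A B) :
    t ∈ spanL M B S ↔ congr f g hf hg t ∈ spanL M B' S' := by
  constructor
  · refine spanL_le (congr f g hf hg).toLinearMap fun a ha b => ?_
    simpa using tmul_mem_spanL ((h a).1 ha) _
  · intro ht
    suffices ∀ s ∈ spanL M B' S', (congr f g hf hg).symm s ∈ spanL M B S by
      simpa using this _ ht
    intro s hs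
    refine spanL_le (congr f g hf hg).symm.toLinearMap (fun a ha b => ?_) hs
    simpa using tmul_mem_spanL ((h (f.symm a)).2 (by simpa using ha)) _

theorem congr_mem_spanR (f : A ≃ₗ[ℂ] A') (g : B ≃ₗ[ℂ] B')
    (hf : ∀ (m : M) a, f (op m • a) = op m • f a) (hg : ∀ (m : M) b, g (m • b) = m • g b)
    (S : Submodule ℂ B) (S' : Submodule ℂ B') (h : ∀ b, b ∈ S ↔ g b ∈ S') (t : BT M A B) :
    t ∈ spanR M A S ↔ congr f g hf hg t ∈ spanR M A' S' := by
  constructor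
  · refine spanR_le (congr f g hf hg).toLinearMap fun a b hb => ?_
    simpa using tmul_mem_spanR _ ((h b).1 hb)
  · intro ht
    suffices ∀ s ∈ spanR M A' S', (congr f g hf hg).symm s ∈ spanR M A S by
      simpa using this _ ht
    intro s hs
    refine spanR_le (congr f g hf hg).symm.toLinearMap (fun a b hb => ?_) hs
    simpa using tmul_mem_spanR _ ((h (g.symm b)).2 (by simpa using hb))

end BT

end degree

section projective

theorem exists_dual_basis (R X : Type*) [Ring R] [AddCommGroup X] [Module R X]
    [Module.Finite R X] [Module.Projective R X] :
    ∃ (n : ℕ) (a : Fin n → X) (φ : Fin n → X →ₗ[R] R), ∀ x, x = ∑ i, φ i x • a i := by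
  obtain ⟨n, f, g, -, -, h⟩ := Module.Finite.exists_comp_eq_id_of_projective R X
  refine ⟨n, fun i => f (fun j => if i = j then 1 else 0), fun i => LinearMap.proj i ∘ₗ g, fun x => ?_⟩
  have hx : f (g x) = x := LinearMap.congr_fun h x
  conv_lhs => rw [← hx, LinearMap.pi_apply_eq_sum_univ f]
  rfl

theorem finite_projective_of_dual_basis {R X ι : Type*} [Ring R] [AddCommGroup X] [Module R X]
    [Fintype ι] (a : ι → X) (φ : ι → X →ₗ[R] R) (h : ∀ x, x = ∑ i, φ i x • a i) :
    Module.Finite R X ∧ Module.Projective R X := by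
  have hs : (Fintype.linearCombination R a) ∘ₗ LinearMap.pi φ = LinearMap.id := by
    ext x
    simpa [Fintype.linearCombination_apply] using (h x).symm
  refine ⟨Module.Finite.of_surjective (Fintype.linearCombination R a) fun x =>
    ⟨LinearMap.pi φ x, LinearMap.congr_fun hs x⟩, Module.Projective.of_split _ _ hs⟩

variable {M : Type*} [Ring M] [Algebra ℂ M]
variable {A B : Type*} [AddCommGroup A] [Module ℂ A] [Module M A] [Module Mᵐᵒᵖ A]
    [SMulCommClass M Mᵐᵒᵖ A] [IsScalarTower ℂ M A] [IsScalarTower ℂ Mᵐᵒᵖ A]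
    [AddCommGroup B] [Module ℂ B] [Module M B] [Module Mᵐᵒᵖ B]
    [SMulCommClass M Mᵐᵒᵖ B] [IsScalarTower ℂ M B] [IsScalarTower ℂ Mᵐᵒᵖ B]

theorem BT.finite_projective_left [Module.Finite M A] [Module.Projective M A]
    [Module.Finite M B] [Module.Projective M B] :
    Module.Finite M (BT M A B) ∧ Module.Projective M (BT M A B) := by
  obtain ⟨n, a, φ, hφ⟩ := exists_dual_basis M A
  obtain ⟨k, b, ψ, hψ⟩ := exists_dual_basis M B
  have hc : ∀ i (c : ℂ) x, φ i (c • x) = c • φ i x := fun i c x =>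
    ((φ i).restrictScalars ℂ).map_smul c x
  have hc' : ∀ j (c : ℂ) x, ψ j (c • x) = c • ψ j x := fun j c x =>
    ((ψ j).restrictScalars ℂ).map_smul c x
  let F : Fin n × Fin k → BT M A B →ₗ[ℂ] M := fun ij =>
    BT.lift (LinearMap.mk₂ ℂ (fun x y => φ ij.1 (op (ψ ij.2 y) • x))
      (by intros; rw [smul_add, map_add])
      (by intros; rw [smul_comm, hc])
      (by intros; rw [map_add, op_add, add_smul, map_add])
      (by intros; rw [hc', op_smul, smul_assoc, hc]))
      (by intro m x y; simp only [LinearMap.mk₂_apply]; rw [(ψ ij.2).map_smul, smul_eq_mul, op_mul, mul_smul])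
  have hF : ∀ ij x y, F ij (BT.tmul M x y) = φ ij.1 (op (ψ ij.2 y) • x) := fun ij x y => by simp [F]
  have hFm : ∀ ij (m : M) t, F ij (m • t) = m • F ij t := by
    intro ij m t
    induction t using BT.induction with
    | h0 => simp
    | hadd x y hx hy => simp only [smul_add, map_add, hx, hy]
    | ht x y => rw [BT.act_tmul, hF, hF, ← smul_comm, map_smul]
  refine finite_projective_of_dual_basis (fun ij : Fin n × Fin k => BT.tmul M (a ij.1) (b ij.2))
    (fun ij => { toFun := F ij, map_add' := map_add _, map_smul' := hFm ij }) fun t => ?_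
  induction t using BT.induction with
  | h0 => simp
  | hadd x y hx hy =>
    simp only [map_add, add_smul, Finset.sum_add_distrib]
    rw [← hx, ← hy]
  | ht x y =>
    simp only [LinearMap.coe_mk, AddHom.coe_mk, hF, Fintype.sum_prod_type_right, BT.act_tmul]
    have h1 : ∀ j, ∑ i, BT.tmul M (φ i (op (ψ j y) • x) • a i) (b j) =
        BT.tmul M x (ψ j y • b j) := by
      intro j
      rw [← BT.balanced]
      conv_rhs => rw [hφ (op (ψ j y) • x)]
      exact (map_sum ((BT.mk M A B).flip (b j)) _ _).symm
    simp only [h1]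
    conv_lhs => rw [hψ y]
    exact map_sum (BT.mk M A B x) _ _

theorem BT.finite_projective_right [Module.Finite Mᵐᵒᵖ A] [Module.Projective Mᵐᵒᵖ A]
    [Module.Finite Mᵐᵒᵖ B] [Module.Projective Mᵐᵒᵖ B] :
    Module.Finite Mᵐᵒᵖ (BT M A B) ∧ Module.Projective Mᵐᵒᵖ (BT M A B) := by
  obtain ⟨n, a, φ, hφ⟩ := exists_dual_basis Mᵐᵒᵖ A
  obtain ⟨k, b, ψ, hψ⟩ := exists_dual_basis Mᵐᵒᵖ B
  have hc : ∀ i (c : ℂ) x, φ i (c • x) = c • φ i x := fun i c x =>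
    ((φ i).restrictScalars ℂ).map_smul c x
  have hc' : ∀ j (c : ℂ) x, ψ j (c • x) = c • ψ j x := fun j c x =>
    ((ψ j).restrictScalars ℂ).map_smul c x
  let F : Fin n × Fin k → BT M A B →ₗ[ℂ] Mᵐᵒᵖ := fun ij =>
    BT.lift (LinearMap.mk₂ ℂ (fun x y => ψ ij.2 (unop (φ ij.1 x) • y))
      (by intros; rw [map_add, unop_add, add_smul, map_add])
      (by intros; rw [hc, unop_smul, smul_assoc, hc'])
      (by intros; rw [smul_add, map_add])
      (by intros; rw [smul_comm, hc']))
      (by intro m x y; simp only [LinearMap.mk₂_apply]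
          rw [(φ ij.1).map_smul, smul_eq_mul, unop_mul, mul_smul, unop_op])
  have hF : ∀ ij x y, F ij (BT.tmul M x y) = ψ ij.2 (unop (φ ij.1 x) • y) := fun ij x y => by simp [F]
  have hFm : ∀ ij (m : Mᵐᵒᵖ) t, F ij (m • t) = m • F ij t := by
    intro ij m t
    induction t using BT.induction with
    | h0 => simp
    | hadd x y hx hy => simp only [smul_add, map_add, hx, hy]
    | ht x y => rw [BT.op_act_tmul, hF, hF, smul_comm, map_smul]
  refine finite_projective_of_dual_basis (fun ij : Fin n × Fin k => BT.tmul M (a ij.1) (b ij.2))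
    (fun ij => { toFun := F ij, map_add' := map_add _, map_smul' := hFm ij }) fun t => ?_
  induction t using BT.induction with
  | h0 => simp
  | hadd x y hx hy =>
    simp only [map_add, add_smul, Finset.sum_add_distrib]
    rw [← hx, ← hy]
  | ht x y =>
    simp only [LinearMap.coe_mk, AddHom.coe_mk, hF, Fintype.sum_prod_type, BT.op_act_tmul]
    have h1 : ∀ i, ∑ j, BT.tmul M (a i) (ψ j (unop (φ i x) • y) • b j) =
        BT.tmul M (φ i x • a i) y := by
      intro i
      conv_rhs => rw [← op_unop (φ i x)]
      rw [BT.balanced]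
      conv_rhs => rw [hψ (unop (φ i x) • y)]
      exact (map_sum (BT.mk M A B (a i)) _ _).symm
    simp only [h1]
    conv_lhs => rw [hφ x]
    exact map_sum ((BT.mk M A B).flip y) _ _

end projective

/-- A quantum vector bundle over the quantum space `M` (an `M`-bimodule that is finitely generated
and projective on both sides) for which the calculus `C` is admissible by means of `σ`, with a
quantum linear connection `nabla`. The values of `nabla` lie in the degree one part of
`Ω ⊗_M Γ`, that is, in `Ω¹ ⊗_M Γ`. -/
structure QVB {M : Type*} [Ring M] [Algebra ℂ M] [StarRing M] [StarModule ℂ M]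
    (C : DiffStarCalculus M) where
  Γ : Type*
  [addCommGroup : AddCommGroup Γ]
  [module : Module ℂ Γ]
  [moduleL : Module M Γ]
  [moduleR : Module Mᵐᵒᵖ Γ]
  [bimodule : SMulCommClass M Mᵐᵒᵖ Γ]
  [towerL : IsScalarTower ℂ M Γ]
  [towerR : IsScalarTower ℂ Mᵐᵒᵖ Γ]
  [finiteL : Module.Finite M Γ]
  [projectiveL : Module.Projective M Γ]
  [finiteR : Module.Finite Mᵐᵒᵖ Γ]
  [projectiveR : Module.Projective Mᵐᵒᵖ Γ]
  σ : BT M C.carrier Γ ≃ₗ[ℂ] BT M Γ C.carrier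
  σ_left : ∀ (p : M) t, σ (p • t) = p • σ t
  σ_right : ∀ (p : M) t, σ (op p • t) = op p • σ t
  σ_degree : ∀ k t, t ∈ BT.spanL M Γ (C.gr k) ↔ σ t ∈ BT.spanR M Γ (C.gr k)
  nabla : Γ →ₗ[ℂ] BT M C.carrier Γ
  nabla_degree : ∀ x, nabla x ∈ BT.spanL M Γ (C.gr 1)
  nabla_left : ∀ (p : M) x, nabla (p • x) = p • nabla x + BT.tmul M (C.d (C.incl p)) x
  nabla_right : ∀ (p : M) x,
    nabla (op p • x) = op p • nabla x + σ.symm (BT.tmul M x (C.d (C.incl p)))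

attribute [instance] QVB.addCommGroup QVB.module QVB.moduleL QVB.moduleR QVB.bimodule QVB.towerL
  QVB.towerR QVB.finiteL QVB.projectiveL QVB.finiteR QVB.projectiveR

namespace QVB

variable {M : Type*} [Ring M] [Algebra ℂ M] [StarRing M] [StarModule ℂ M]
  {C : DiffStarCalculus M}

section

variable (E F : QVB C)

theorem σ_symm_left (p : M) (t : BT M E.Γ C.carrier) : E.σ.symm (p • t) = p • E.σ.symm t :=
  E.σ.injective (by simp [E.σ_left])

theorem σ_symm_right (p : M) (t : BT M E.Γ C.carrier) :
    E.σ.symm (op p • t) = op p • E.σ.symm t :=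
  E.σ.injective (by simp [E.σ_right])

/-- `σ₁ ⊗ id : (Ω ⊗ Γ₁) ⊗ Γ₂ → (Γ₁ ⊗ Ω) ⊗ Γ₂`. -/
def σId : BT M (BT M C.carrier E.Γ) F.Γ ≃ₗ[ℂ] BT M (BT M E.Γ C.carrier) F.Γ :=
  BT.congr E.σ (LinearEquiv.refl ℂ F.Γ) E.σ_right (fun _ _ => rfl)

/-- `id ⊗ σ₂ : Γ₁ ⊗ (Ω ⊗ Γ₂) → Γ₁ ⊗ (Γ₂ ⊗ Ω)`. -/
def idσ : BT M E.Γ (BT M C.carrier F.Γ) ≃ₗ[ℂ] BT M E.Γ (BT M F.Γ C.carrier) :=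
  BT.congr (LinearEquiv.refl ℂ E.Γ) F.σ (fun _ _ => rfl) F.σ_left

/-- `(id ⊗ σ₂) ∘ (σ₁ ⊗ id)`, up to reassociation. -/
def σTensor : BT M C.carrier (BT M E.Γ F.Γ) ≃ₗ[ℂ] BT M (BT M E.Γ F.Γ) C.carrier :=
  (BT.assoc M C.carrier E.Γ F.Γ).symm ≪≫ₗ σId E F ≪≫ₗ BT.assoc M E.Γ C.carrier F.Γ ≪≫ₗ
    idσ E F ≪≫ₗ (BT.assoc M E.Γ F.Γ C.carrier).symm

end

end QVB

namespace BT

variable {M : Type*} [Ring M] [Algebra ℂ M]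
variable {A B D : Type*} [AddCommGroup A] [Module ℂ A] [Module Mᵐᵒᵖ A]
    [AddCommGroup B] [Module ℂ B] [Module M B] [Module Mᵐᵒᵖ B] [SMulCommClass M Mᵐᵒᵖ B]
    [IsScalarTower ℂ M B] [IsScalarTower ℂ Mᵐᵒᵖ B]
    [AddCommGroup D] [Module ℂ D] [Module M D]

theorem assoc_left [Module M A] [SMulCommClass M Mᵐᵒᵖ A] [IsScalarTower ℂ M A]
    (p : M) (t : BT M (BT M A B) D) : assoc M A B D (p • t) = p • assoc M A B D t := by
  induction t using BT.induction with
  | h0 => simp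
  | hadd x y hx hy => simp only [smul_add, map_add, hx, hy]
  | ht s d =>
    induction s using BT.induction with
    | h0 => simp [zero_tmul]
    | hadd x y hx hy => simp only [add_tmul, smul_add, map_add, hx, hy]
    | ht a b => simp [act_tmul]

theorem assoc_right [Module Mᵐᵒᵖ D] [SMulCommClass M Mᵐᵒᵖ D] [IsScalarTower ℂ Mᵐᵒᵖ D]
    (p : Mᵐᵒᵖ) (t : BT M (BT M A B) D) : assoc M A B D (p • t) = p • assoc M A B D t := by
  induction t using BT.induction with
  | h0 => simp
  | hadd x y hx hy => simp only [smul_add, map_add, hx, hy]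
  | ht s d =>
    induction s using BT.induction with
    | h0 => simp [zero_tmul]
    | hadd x y hx hy => simp only [add_tmul, smul_add, map_add, hx, hy]
    | ht a b => simp [op_act_tmul]

theorem assoc_symm_left [Module M A] [SMulCommClass M Mᵐᵒᵖ A] [IsScalarTower ℂ M A]
    (p : M) (t : BT M A (BT M B D)) : (assoc M A B D).symm (p • t) = p • (assoc M A B D).symm t :=
  (assoc M A B D).injective (by simp [assoc_left])

theorem assoc_symm_right [Module Mᵐᵒᵖ D] [SMulCommClass M Mᵐᵒᵖ D] [IsScalarTower ℂ Mᵐᵒᵖ D]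
    (p : Mᵐᵒᵖ) (t : BT M A (BT M B D)) :
    (assoc M A B D).symm (p • t) = p • (assoc M A B D).symm t :=
  (assoc M A B D).injective (by simp [assoc_right])

variable {A' B' : Type*} [AddCommGroup A'] [Module ℂ A'] [Module Mᵐᵒᵖ A']
    [AddCommGroup B'] [Module ℂ B'] [Module M B']

theorem congr_left [Module M A] [SMulCommClass M Mᵐᵒᵖ A] [IsScalarTower ℂ M A]
    [Module M A'] [SMulCommClass M Mᵐᵒᵖ A'] [IsScalarTower ℂ M A']
    (f : A ≃ₗ[ℂ] A') (g : B ≃ₗ[ℂ] B')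
    (hf : ∀ (m : M) a, f (op m • a) = op m • f a) (hg : ∀ (m : M) b, g (m • b) = m • g b)
    (hf' : ∀ (m : M) a, f (m • a) = m • f a) (p : M) (t : BT M A B) :
    congr f g hf hg (p • t) = p • congr f g hf hg t := by
  induction t using BT.induction with
  | h0 => simp
  | hadd x y hx hy => simp only [smul_add, map_add, hx, hy]
  | ht a b => simp [act_tmul, hf']

theorem congr_right [Module Mᵐᵒᵖ B'] [SMulCommClass M Mᵐᵒᵖ B'] [IsScalarTower ℂ Mᵐᵒᵖ B']
    (f : A ≃ₗ[ℂ] A') (g : B ≃ₗ[ℂ] B')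
    (hf : ∀ (m : M) a, f (op m • a) = op m • f a) (hg : ∀ (m : M) b, g (m • b) = m • g b)
    (hg' : ∀ (m : M) b, g (op m • b) = op m • g b) (p : M) (t : BT M A B) :
    congr f g hf hg (op p • t) = op p • congr f g hf hg t := by
  induction t using BT.induction with
  | h0 => simp
  | hadd x y hx hy => simp only [smul_add, map_add, hx, hy]
  | ht a b => simp [op_act_tmul, hg']

end BT

namespace QVB

variable {M : Type*} [Ring M] [Algebra ℂ M] [StarRing M] [StarModule ℂ M]
  {C : DiffStarCalculus M} (E F : QVB C)

theorem σId_left (p : M) (t : BT M (BT M C.carrier E.Γ) F.Γ) :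
    σId E F (p • t) = p • σId E F t := BT.congr_left _ _ _ _ E.σ_left p t

theorem σId_right (p : M) (t : BT M (BT M C.carrier E.Γ) F.Γ) :
    σId E F (op p • t) = op p • σId E F t := BT.congr_right _ _ _ _ (fun _ _ => rfl) p t

theorem idσ_left (p : M) (t : BT M E.Γ (BT M C.carrier F.Γ)) :
    idσ E F (p • t) = p • idσ E F t := BT.congr_left _ _ _ _ (fun _ _ => rfl) p t

theorem idσ_right (p : M) (t : BT M E.Γ (BT M C.carrier F.Γ)) :
    idσ E F (op p • t) = op p • idσ E F t := BT.congr_right _ _ _ _ F.σ_right p t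

theorem σId_symm_left (p : M) (t : BT M (BT M E.Γ C.carrier) F.Γ) :
    (σId E F).symm (p • t) = p • (σId E F).symm t :=
  (σId E F).injective (by simp [σId_left])

theorem σId_symm_right (p : M) (t : BT M (BT M E.Γ C.carrier) F.Γ) :
    (σId E F).symm (op p • t) = op p • (σId E F).symm t :=
  (σId E F).injective (by simp [σId_right])

@[simp] theorem σId_symm_tmul (t : BT M E.Γ C.carrier) (y : F.Γ) :
    (σId E F).symm (BT.tmul M t y) = BT.tmul M (E.σ.symm t) y :=
  BT.congr_symm_tmul _ _ _ _ _ _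

@[simp] theorem idσ_symm_tmul (x : E.Γ) (t : BT M F.Γ C.carrier) :
    (idσ E F).symm (BT.tmul M x t) = BT.tmul M x (F.σ.symm t) :=
  BT.congr_symm_tmul _ _ _ _ _ _

/-- The map `(σ₁⁻¹ ⊗ id)` from `Γ₁ ⊗ (Ω ⊗ Γ₂)` to `Ω ⊗ (Γ₁ ⊗ Γ₂)`, up to reassociation. -/
def moveForm : BT M E.Γ (BT M C.carrier F.Γ) ≃ₗ[ℂ] BT M C.carrier (BT M E.Γ F.Γ) :=
  (BT.assoc M E.Γ C.carrier F.Γ).symm ≪≫ₗ (σId E F).symm ≪≫ₗ BT.assoc M C.carrier E.Γ F.Γ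

theorem moveForm_left (p : M) (t : BT M E.Γ (BT M C.carrier F.Γ)) :
    moveForm E F (p • t) = p • moveForm E F t := by
  simp only [moveForm, LinearEquiv.trans_apply, BT.assoc_symm_left, σId_symm_left, BT.assoc_left]

theorem moveForm_right (p : M) (t : BT M E.Γ (BT M C.carrier F.Γ)) :
    moveForm E F (op p • t) = op p • moveForm E F t := by
  simp only [moveForm, LinearEquiv.trans_apply, BT.assoc_symm_right, σId_symm_right,
    BT.assoc_right]

theorem moveForm_tmul (x : E.Γ) (ω : C.carrier) (y : F.Γ) :
    moveForm E F (BT.tmul M x (BT.tmul M ω y)) =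
      BT.assoc M C.carrier E.Γ F.Γ (BT.tmul M (E.σ.symm (BT.tmul M x ω)) y) := by
  simp [moveForm]

theorem moveForm_mem (k : ℕ) {t : BT M E.Γ (BT M C.carrier F.Γ)}
    (ht : t ∈ BT.spanR M E.Γ (BT.spanL M F.Γ (C.gr k))) :
    moveForm E F t ∈ BT.spanL M (BT M E.Γ F.Γ) (C.gr k) := by
  simp only [moveForm, LinearEquiv.trans_apply]
  rw [← BT.assoc_mem_left, BT.congr_mem_spanL E.σ (LinearEquiv.refl ℂ F.Γ) E.σ_right
    (fun _ _ => rfl) _ _ (E.σ_degree k), BT.assoc_mem_mid]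
  change BT.assoc M E.Γ C.carrier F.Γ (σId E F ((σId E F).symm _)) ∈ _
  simpa using ht

/-- `x₁ ⊗ x₂ ↦ ∇₁ x₁ ⊗ x₂ + (σ₁⁻¹ ⊗ id)(x₁ ⊗ ∇₂ x₂)`. -/
def nablaTensor : BT M E.Γ F.Γ →ₗ[ℂ] BT M C.carrier (BT M E.Γ F.Γ) :=
  BT.lift (LinearMap.mk₂ ℂ
    (fun x y => BT.assoc M C.carrier E.Γ F.Γ (BT.tmul M (E.nabla x) y) +
      moveForm E F (BT.tmul M x (F.nabla y)))
    (by intros; simp only [map_add, BT.add_tmul]; abel)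
    (by intros; simp only [map_smul, BT.smul_tmul, smul_add])
    (by intros; simp only [map_add, BT.tmul_add]; abel)
    (by intros; simp only [map_smul, BT.tmul_smul, smul_add]))
    (by
      intro p x y
      simp only [LinearMap.mk₂_apply, E.nabla_right, F.nabla_left, BT.add_tmul, BT.tmul_add,
        map_add, moveForm_tmul, BT.balanced]
      abel)

@[simp] theorem nablaTensor_tmul (x : E.Γ) (y : F.Γ) : nablaTensor E F (BT.tmul M x y) =
    BT.assoc M C.carrier E.Γ F.Γ (BT.tmul M (E.nabla x) y) +
      moveForm E F (BT.tmul M x (F.nabla y)) := by simp [nablaTensor]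

/-- The tensor product of two quantum vector bundles with quantum linear connections. -/
def tensor : QVB C where
  Γ := BT M E.Γ F.Γ
  finiteL := BT.finite_projective_left.1
  projectiveL := BT.finite_projective_left.2
  finiteR := BT.finite_projective_right.1
  projectiveR := BT.finite_projective_right.2
  σ := σTensor E F
  σ_left p t := by
    simp only [σTensor, LinearEquiv.trans_apply, BT.assoc_symm_left, σId_left, BT.assoc_left,
      idσ_left]
  σ_right p t := by
    simp only [σTensor, LinearEquiv.trans_apply, BT.assoc_symm_right, σId_right, BT.assoc_right,
      idσ_right]
  σ_degree k t := by
    simp only [σTensor, LinearEquiv.trans_apply]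
    rw [BT.assoc_mem_right, LinearEquiv.apply_symm_apply]
    have h := BT.assoc_mem_left (C.gr k) ((BT.assoc M C.carrier E.Γ F.Γ).symm t)
    rw [LinearEquiv.apply_symm_apply] at h
    rw [← h, BT.congr_mem_spanL E.σ (LinearEquiv.refl ℂ F.Γ) E.σ_right
      (fun _ _ => rfl) _ _ (E.σ_degree k), BT.assoc_mem_mid,
      BT.congr_mem_spanR (LinearEquiv.refl ℂ E.Γ) F.σ (fun _ _ => rfl) F.σ_left _ _ (F.σ_degree k)]
    rfl
  nabla := nablaTensor E F
  nabla_degree t := by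
    induction t using BT.induction with
    | h0 => simp
    | hadd x y hx hy => rw [map_add]; exact add_mem hx hy
    | ht x y =>
      rw [nablaTensor_tmul]
      refine add_mem ?_ (moveForm_mem E F 1 (BT.tmul_mem_spanR x (F.nabla_degree y)))
      rw [← BT.assoc_mem_left]
      exact BT.tmul_mem_spanL (E.nabla_degree x) y
  nabla_left p t := by
    induction t using BT.induction with
    | h0 => simp [BT.tmul_zero]
    | hadd x y hx hy => simp only [smul_add, map_add, hx, hy, BT.tmul_add]; abel
    | ht x y =>
      simp only [BT.act_tmul, nablaTensor_tmul, E.nabla_left, BT.add_tmul, map_add, smul_add,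
        BT.assoc_tmul]
      rw [← BT.act_tmul, ← BT.act_tmul, BT.assoc_left, moveForm_left]
      abel
  nabla_right p t := by
    induction t using BT.induction with
    | h0 => simp [BT.zero_tmul]
    | hadd x y hx hy => simp only [smul_add, map_add, hx, hy, BT.add_tmul]; abel
    | ht x y =>
      simp only [BT.op_act_tmul, nablaTensor_tmul, F.nabla_right, BT.tmul_add, map_add, smul_add]
      rw [← BT.op_act_tmul, ← BT.op_act_tmul, BT.assoc_right, moveForm_right]
      have : (σTensor E F).symm (BT.tmul M (BT.tmul M x y) (C.d (C.incl p))) =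
          moveForm E F (BT.tmul M x (F.σ.symm (BT.tmul M y (C.d (C.incl p))))) := by
        simp [σTensor, moveForm]
      rw [this]
      abel

/-- Parallel isomorphisms of degree `0`: invertible `M`-bimodule maps commuting with the
connections and with the maps `σ`. -/
structure ParallelIso (E F : QVB C) where
  equiv : E.Γ ≃ₗ[ℂ] F.Γ
  left : ∀ (p : M) x, equiv (p • x) = p • equiv x
  right : ∀ (p : M) x, equiv (op p • x) = op p • equiv x
  parallel : ∀ x, BT.map LinearMap.id equiv.toLinearMap (fun _ _ => rfl) left (E.nabla x) =
    F.nabla (equiv x)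
  intertwines : ∀ t, BT.map equiv.toLinearMap LinearMap.id right (fun _ _ => rfl) (E.σ t) =
    F.σ (BT.map LinearMap.id equiv.toLinearMap (fun _ _ => rfl) left t)

end QVB

/-! ## Quantum principal bundles, horizontal forms and covariant derivatives -/

/-- A quantum principal `G`-bundle over the quantum space `M`. -/
structure QPBundle (G : Type*) [Ring G] [HopfAlgebra ℂ G] [StarRing G] [StarModule ℂ G]
    (M : Type*) [Ring M] [Algebra ℂ M] [StarRing M] [StarModule ℂ M] where
  /-- the total quantum space -/
  tot : Type*
  [ring : Ring tot]
  [algebra : Algebra ℂ tot]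
  [starRing : StarRing tot]
  [starModule : StarModule ℂ tot]
  /-- the coaction of `G`, a morphism of unital `*`-algebras -/
  rep : Corep G tot
  coact_one : rep.coact 1 = 1
  coact_mul : ∀ x y, rep.coact (x * y) = rep.coact x * rep.coact y
  coact_star : ∀ x, rep.coact (star x) = star (rep.coact x)
  /-- the base quantum space, identified with the right invariant elements -/
  incl : M →⋆ₐ[ℂ] tot
  incl_injective : Function.Injective incl
  invariant_iff : ∀ x, rep.coact x = x ⊗ₜ[ℂ] (1 : G) ↔ ∃ p, incl p = x
  /-- the map `x ⊗ y ↦ (x ⊗ 1) Φ(y)` is surjective -/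
  free : ∀ z : tot ⊗[ℂ] G, z ∈ Submodule.span ℂ
    {t : tot ⊗[ℂ] G | ∃ x y, t = (x ⊗ₜ[ℂ] (1 : G)) * rep.coact y}

attribute [instance] QPBundle.ring QPBundle.algebra QPBundle.starRing QPBundle.starModule

section bundle

open scoped ComplexOrder

variable {G : Type*} [Ring G] [HopfAlgebra ℂ G] [StarRing G] [StarModule ℂ G]
  {M : Type*} [Ring M] [Algebra ℂ M] [StarRing M] [StarModule ℂ M]

/-- For the corepresentation `α` there are a basis `e`, morphisms `T_1, …, T_d` from `α` to the
total space and a strictly positive matrix `Z` such that, with `x_{ki} = T_k (e_i)`,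
`∑_k x_{ki}* x_{kj} = δ_{ij}` and `(Z X)ᵀ X* = 1`, where `X* = (x_{ij}*)`. -/
def QPBundle.HasGenerators (P : QPBundle G M) {V : Type*} [AddCommGroup V] [Module ℂ V]
    (α : Corep G V) : Prop :=
  ∃ (n d : ℕ) (e : Module.Basis (Fin n) ℂ V) (T : Fin d → Corep.Hom0 α P.rep)
    (Z : Matrix (Fin d) (Fin d) ℂ), Z.PosDef ∧
    (∀ i j, ∑ k, star ((T k).1 (e i)) * (T k).1 (e j) = if i = j then 1 else 0) ∧
    (∀ i j, ∑ k, (∑ l, Z k l • (T l).1 (e i)) * star ((T k).1 (e j)) = if i = j then 1 else 0)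

/-- The standing assumption on the bundle: the generators exist for all irreducible finite
dimensional corepresentations. The condition on `α` is invariant under equivalence, so that it is
the same to ask it for the members of a complete set of pairwise nonequivalent irreducible ones. -/
def QPBundle.HasAllGenerators (P : QPBundle G M) : Prop :=
  ∀ (V : Type) [AddCommGroup V] [Module ℂ V] [FiniteDimensional ℂ V] (α : Corep G V),
    α.IsIrreducible → P.HasGenerators α

universe wh wb

/-- The horizontal and base forms of a differential calculus on the bundle `P`: a graded
`*`-algebra `hor` with degree zero part the total space, with a coaction `rep` extending the one of
the total space, and with a graded `*`-subalgebra `base` of all invariant elements, which carries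
the structure of a graded differential `*`-algebra generated by its degree zero part `M`. -/
structure HorizontalCalculus (P : QPBundle G M) where
  hor : GradedStarAlg.{wh}
  inclTot : P.tot →ₐ[ℂ] hor.carrier
  inclTot_injective : Function.Injective inclTot
  inclTot_range : ∀ φ, φ ∈ hor.gr 0 ↔ ∃ x, inclTot x = φ
  inclTot_star : ∀ x, inclTot (star x) = hor.conj (inclTot x)
  rep : Corep G hor.carrier
  coact_one : rep.coact 1 = 1
  coact_mul : ∀ φ ψ, rep.coact (φ * ψ) = rep.coact φ * rep.coact ψ
  coact_conj : ∀ φ, rep.coact (hor.conj φ) =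
    TensorProduct.map hor.conj (starLinearEquiv ℂ (A := G)).toLinearMap (rep.coact φ)
  coact_degree : ∀ k, ∀ φ ∈ hor.gr k,
    rep.coact φ ∈ LinearMap.range (LinearMap.rTensor G (hor.gr k).subtype)
  coact_extends : ∀ x, rep.coact (inclTot x) =
    LinearMap.rTensor G inclTot.toLinearMap (P.rep.coact x)
  base : DiffStarCalculus.{_, wb} M
  inclBase : base.carrier →ₐ[ℂ] hor.carrier
  inclBase_injective : Function.Injective inclBase
  inclBase_degree : ∀ k, ∀ μ ∈ base.gr k, inclBase μ ∈ hor.gr k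
  inclBase_conj : ∀ μ, inclBase (base.conj μ) = hor.conj (inclBase μ)
  inclBase_incl : ∀ p, inclBase (base.incl p) = inclTot (P.incl p)
  invariant_iff : ∀ φ, rep.coact φ = φ ⊗ₜ[ℂ] (1 : G) ↔ ∃ μ, inclBase μ = φ
  base_generated : ∀ S : Subalgebra ℂ base.carrier, (∀ p, base.incl p ∈ S) →
    (∀ μ ∈ S, base.d μ ∈ S) → (∀ μ ∈ S, base.conj μ ∈ S) → S = ⊤

/-- The covariant derivatives of quantum principal connections: first order `*`-preserving
antiderivations of the horizontal forms that commute with the coaction and extend the differential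
of the base forms. -/
structure HorizontalCalculus.CovDer {P : QPBundle G M} (H : HorizontalCalculus P) where
  D : H.hor.carrier →ₗ[ℂ] H.hor.carrier
  D_degree : ∀ k, ∀ φ ∈ H.hor.gr k, D φ ∈ H.hor.gr (k + 1)
  D_mem : D ∈ Corep.Hom0 H.rep H.rep
  D_mul : ∀ k, ∀ φ ∈ H.hor.gr k, ∀ ψ, D (φ * ψ) = D φ * ψ + (-1 : ℂ) ^ k • (φ * D ψ)
  D_conj : ∀ φ, D (H.hor.conj φ) = H.hor.conj (D φ)
  D_base : ∀ μ, D (H.inclBase μ) = H.inclBase (H.base.d μ)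

/-! ## Associated bundles -/

theorem rTensor_mulLeft_apply {X : Type*} [Ring X] [Algebra ℂ X] (x : X) (z : X ⊗[ℂ] G) :
    LinearMap.rTensor G (LinearMap.mulLeft ℂ x) z = (x ⊗ₜ[ℂ] (1 : G)) * z := by
  induction z with
  | zero => simp
  | add a b ha hb => rw [map_add, ha, hb, mul_add]
  | tmul a b => simp

theorem rTensor_mulRight_apply {X : Type*} [Ring X] [Algebra ℂ X] (x : X) (z : X ⊗[ℂ] G) :
    LinearMap.rTensor G (LinearMap.mulRight ℂ x) z = z * (x ⊗ₜ[ℂ] (1 : G)) := by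
  induction z with
  | zero => simp
  | add a b ha hb => rw [map_add, ha, hb, add_mul]
  | tmul a b => simp

namespace QPBundle

variable (P : QPBundle G M) {V V' : Type*} [AddCommGroup V] [Module ℂ V]
  [AddCommGroup V'] [Module ℂ V'] (α : Corep G V) (α' : Corep G V')

theorem coact_incl (p : M) : P.rep.coact (P.incl p) = P.incl p ⊗ₜ[ℂ] (1 : G) :=
  (P.invariant_iff _).2 ⟨p, rfl⟩

/-- The sections of the associated bundle: the degree `0` morphisms from `α` to the coaction on
the total space. -/
def Sec : Type _ := Corep.Hom0 α P.rep

instance : AddCommGroup (P.Sec α) := inferInstanceAs (AddCommGroup (Corep.Hom0 α P.rep))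

instance : Module ℂ (P.Sec α) := inferInstanceAs (Module ℂ (Corep.Hom0 α P.rep))

variable {α α'} in
/-- The linear map underlying a section. -/
def Sec.toLin : P.Sec α →ₗ[ℂ] V →ₗ[ℂ] P.tot := (Corep.Hom0 α P.rep).subtype

variable {P α}

theorem Sec.ext {T S : P.Sec α} (h : ∀ v, Sec.toLin P T v = Sec.toLin P S v) : T = S :=
  Subtype.ext (LinearMap.ext h)

theorem Sec.coact (T : P.Sec α) (v : V) : P.rep.coact (Sec.toLin P T v) =
    LinearMap.rTensor G (Sec.toLin P T) (α.coact v) := T.2 v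

variable (P α)

/-- A section from a linear map that is a morphism. -/
def Sec.mk (f : V →ₗ[ℂ] P.tot) (hf : f ∈ Corep.Hom0 α P.rep) : P.Sec α := ⟨f, hf⟩

@[simp] theorem Sec.toLin_mk (f : V →ₗ[ℂ] P.tot) (hf : f ∈ Corep.Hom0 α P.rep) :
    Sec.toLin P (Sec.mk P α f hf) = f := rfl

/-- `(p T)(v) = p T(v)` -/
instance : SMul M (P.Sec α) where
  smul p T := Sec.mk P α (LinearMap.mulLeft ℂ (P.incl p) ∘ₗ Sec.toLin P T) (by
    intro v
    rw [LinearMap.rTensor_comp, LinearMap.comp_apply, LinearMap.comp_apply, ← Sec.coact, rTensor_mulLeft_apply,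
      ← P.coact_incl, ← P.coact_mul]
    rfl)

/-- `(T p)(v) = T(v) p` -/
instance : SMul Mᵐᵒᵖ (P.Sec α) where
  smul p T := Sec.mk P α (LinearMap.mulRight ℂ (P.incl p.unop) ∘ₗ Sec.toLin P T) (by
    intro v
    rw [LinearMap.rTensor_comp, LinearMap.comp_apply, LinearMap.comp_apply, ← Sec.coact, rTensor_mulRight_apply,
      ← P.coact_incl, ← P.coact_mul]
    rfl)

variable {P α}

@[simp] theorem Sec.smul_apply (p : M) (T : P.Sec α) (v : V) :
    Sec.toLin P (p • T) v = P.incl p * Sec.toLin P T v := rfl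

@[simp] theorem Sec.op_smul_apply (p : M) (T : P.Sec α) (v : V) :
    Sec.toLin P (op p • T) v = Sec.toLin P T v * P.incl p := rfl

@[simp] theorem Sec.op_smul_apply' (p : Mᵐᵒᵖ) (T : P.Sec α) (v : V) :
    Sec.toLin P (p • T) v = Sec.toLin P T v * P.incl p.unop := rfl

instance : Module M (P.Sec α) where
  one_smul T := Sec.ext fun v => by simp
  mul_smul p q T := Sec.ext fun v => by simp [mul_assoc]
  smul_zero p := Sec.ext fun v => by simp
  smul_add p T S := Sec.ext fun v => by simp [mul_add]
  add_smul p q T := Sec.ext fun v => by simp [add_mul]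
  zero_smul T := Sec.ext fun v => by simp

instance : Module Mᵐᵒᵖ (P.Sec α) where
  one_smul T := Sec.ext fun v => by simp
  mul_smul p q T := Sec.ext fun v => by simp [mul_assoc]
  smul_zero p := Sec.ext fun v => by simp
  smul_add p T S := Sec.ext fun v => by simp [add_mul]
  add_smul p q T := Sec.ext fun v => by simp [mul_add]
  zero_smul T := Sec.ext fun v => by simp

instance : SMulCommClass M Mᵐᵒᵖ (P.Sec α) where
  smul_comm p q T := Sec.ext fun v => by simp [mul_assoc]

instance : IsScalarTower ℂ M (P.Sec α) where
  smul_assoc c p T := Sec.ext fun v => by simp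

instance : IsScalarTower ℂ Mᵐᵒᵖ (P.Sec α) where
  smul_assoc c p T := Sec.ext fun v => by simp

variable {α'}

/-- The map `T ↦ T ∘ f` for a degree `0` morphism `f`. -/
def Sec.pull (P : QPBundle G M) (f : V →ₗ[ℂ] V') (hf : f ∈ Corep.Hom0 α α') : P.Sec α' →ₗ[ℂ] P.Sec α where
  toFun T := Sec.mk P α (Sec.toLin P T ∘ₗ f) (by
    intro v
    rw [LinearMap.rTensor_comp, LinearMap.comp_apply, LinearMap.comp_apply, ← hf v, ← Sec.coact])
  map_add' T S := Sec.ext fun v => by simp; rfl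
  map_smul' c T := Sec.ext fun v => by simp; rfl

@[simp] theorem Sec.pull_apply (f : V →ₗ[ℂ] V') (hf : f ∈ Corep.Hom0 α α') (T : P.Sec α')
    (v : V) : Sec.toLin P (Sec.pull P f hf T) v = Sec.toLin P T (f v) := rfl

/-- The map `T ↦ T* ∘ f`, `T* v = (T v)*`, for a degree `1` morphism `f`. -/
def Sec.pullStar (P : QPBundle G M) (f : V →ₛₗ[starRingEnd ℂ] V') (hf : f ∈ Corep.Hom1 α α') :
    P.Sec α' →ₛₗ[starRingEnd ℂ] P.Sec α where
  toFun T := Sec.mk P α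
    ((starLinearEquiv ℂ (A := P.tot)).toLinearMap.comp ((Sec.toLin P T).comp f)) (by
      intro v
      change P.rep.coact (star (Sec.toLin P T (f v))) = _
      rw [P.coact_star, Sec.coact, hf v]
      generalize α.coact v = s
      induction s with
      | zero => simp
      | add a b ha hb => simp only [map_add, star_add, ha, hb]
      | tmul w g => simp)
  map_add' T S := Sec.ext fun v => by simp; rfl
  map_smul' c T := Sec.ext fun v => by simp; rfl

@[simp] theorem Sec.pullStar_apply (f : V →ₛₗ[starRingEnd ℂ] V') (hf : f ∈ Corep.Hom1 α α')
    (T : P.Sec α') (v : V) :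
    Sec.toLin P (Sec.pullStar P f hf T) v = star (Sec.toLin P T (f v)) := rfl

theorem Sec.pull_left (f : V →ₗ[ℂ] V') (hf : f ∈ Corep.Hom0 α α') (p : M) (T : P.Sec α') :
    Sec.pull P f hf (p • T) = p • Sec.pull P f hf T := Sec.ext fun v => by simp

theorem Sec.pull_right (f : V →ₗ[ℂ] V') (hf : f ∈ Corep.Hom0 α α') (p : M) (T : P.Sec α') :
    Sec.pull P f hf (op p • T) = op p • Sec.pull P f hf T := Sec.ext fun v => by simp

theorem Sec.pullStar_left (f : V →ₛₗ[starRingEnd ℂ] V') (hf : f ∈ Corep.Hom1 α α') (p : M)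
    (T : P.Sec α') : Sec.pullStar P f hf (p • T) = op (star p) • Sec.pullStar P f hf T :=
  Sec.ext fun v => by
    rw [Sec.pullStar_apply, Sec.smul_apply, star_mul, ← map_star P.incl, ← Sec.pullStar_apply f hf,
      Sec.op_smul_apply]

theorem Sec.pullStar_right (f : V →ₛₗ[starRingEnd ℂ] V') (hf : f ∈ Corep.Hom1 α α') (p : M)
    (T : P.Sec α') : Sec.pullStar P f hf (op p • T) = star p • Sec.pullStar P f hf T :=
  Sec.ext fun v => by
    rw [Sec.pullStar_apply, Sec.op_smul_apply, star_mul, ← map_star P.incl, ← Sec.pullStar_apply f hf,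
      Sec.smul_apply]

end QPBundle




namespace HorizontalCalculus

variable {P : QPBundle G M} (H : HorizontalCalculus P) {V : Type*} [AddCommGroup V] [Module ℂ V]
  (α : Corep G V)

/-- The degree `0` morphisms from `α` to the coaction on the horizontal forms. -/
abbrev HSec : Type _ := Corep.Hom0 α H.rep

theorem coact_base (μ : H.base.carrier) :
    H.rep.coact (H.inclBase μ) = H.inclBase μ ⊗ₜ[ℂ] (1 : G) := (H.invariant_iff _).2 ⟨μ, rfl⟩

theorem coact_sec (T : P.Sec α) (v : V) : H.rep.coact (H.inclTot (QPBundle.Sec.toLin P T v)) =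
    LinearMap.rTensor G (H.inclTot.toLinearMap ∘ₗ QPBundle.Sec.toLin P T) (α.coact v) := by
  rw [H.coact_extends, QPBundle.Sec.coact, LinearMap.rTensor_comp, LinearMap.comp_apply]

theorem mulLeft_mem (μ : H.base.carrier) (T : P.Sec α) :
    LinearMap.mulLeft ℂ (H.inclBase μ) ∘ₗ H.inclTot.toLinearMap ∘ₗ QPBundle.Sec.toLin P T ∈
      Corep.Hom0 α H.rep := by
  intro v
  rw [LinearMap.rTensor_comp, LinearMap.comp_apply, LinearMap.comp_apply, LinearMap.comp_apply, AlgHom.toLinearMap_apply, ← coact_sec,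
    rTensor_mulLeft_apply, ← H.coact_base, ← H.coact_mul]
  rfl

theorem mulRight_mem (μ : H.base.carrier) (T : P.Sec α) :
    LinearMap.mulRight ℂ (H.inclBase μ) ∘ₗ H.inclTot.toLinearMap ∘ₗ QPBundle.Sec.toLin P T ∈
      Corep.Hom0 α H.rep := by
  intro v
  rw [LinearMap.rTensor_comp, LinearMap.comp_apply, LinearMap.comp_apply, LinearMap.comp_apply, AlgHom.toLinearMap_apply, ← coact_sec,
    rTensor_mulRight_apply, ← H.coact_base, ← H.coact_mul]
  rfl

/-- `μ ⊗_M T ↦ μ T`, where `(μ T)(v) = μ T(v)`. -/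
def leftForm : BT M H.base.carrier (P.Sec α) →ₗ[ℂ] H.HSec α :=
  BT.lift (LinearMap.mk₂ ℂ (fun μ T => (⟨_, H.mulLeft_mem α μ T⟩ : H.HSec α))
    (fun μ ν T => Subtype.ext (LinearMap.ext fun v => by simp [add_mul]))
    (fun c μ T => Subtype.ext (LinearMap.ext fun v => by simp))
    (fun μ T S => Subtype.ext (LinearMap.ext fun v => by simp [mul_add]))
    (fun c μ T => Subtype.ext (LinearMap.ext fun v => by simp)))
    (fun p μ T => Subtype.ext (LinearMap.ext fun v => by
      simp [DiffStarCalculus.op_smul_def, mul_assoc]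
      rw [H.inclBase_incl]))

/-- `T ⊗_M μ ↦ T μ`, where `(T μ)(v) = T(v) μ`. -/
def rightForm : BT M (P.Sec α) H.base.carrier →ₗ[ℂ] H.HSec α :=
  BT.lift (LinearMap.mk₂ ℂ (fun T μ => (⟨_, H.mulRight_mem α μ T⟩ : H.HSec α))
    (fun T S μ => Subtype.ext (LinearMap.ext fun v => by simp [add_mul]))
    (fun c T μ => Subtype.ext (LinearMap.ext fun v => by simp))
    (fun T μ ν => Subtype.ext (LinearMap.ext fun v => by simp [mul_add]))
    (fun c T μ => Subtype.ext (LinearMap.ext fun v => by simp)))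
    (fun p T μ => Subtype.ext (LinearMap.ext fun v => by
      simp [DiffStarCalculus.smul_def, mul_assoc]
      rw [H.inclBase_incl]))

@[simp] theorem leftForm_tmul (μ : H.base.carrier) (T : P.Sec α) (v : V) :
    (H.leftForm α (BT.tmul M μ T)).1 v =
      H.inclBase μ * H.inclTot (QPBundle.Sec.toLin P T v) := by simp [leftForm]

@[simp] theorem rightForm_tmul (μ : H.base.carrier) (T : P.Sec α) (v : V) :
    (H.rightForm α (BT.tmul M T μ)).1 v =
      H.inclTot (QPBundle.Sec.toLin P T v) * H.inclBase μ := by simp [rightForm]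

theorem leftForm_left (p : M) (t : BT M H.base.carrier (P.Sec α)) (v : V) :
    (H.leftForm α (p • t)).1 v = H.inclTot (P.incl p) * (H.leftForm α t).1 v := by
  induction t using BT.induction with
  | h0 => simp
  | hadd x y hx hy => simp only [smul_add, map_add, Submodule.coe_add, LinearMap.add_apply, hx, hy,
      mul_add]
  | ht μ T => simp [BT.act_tmul, DiffStarCalculus.smul_def, H.inclBase_incl, mul_assoc]

theorem leftForm_right (p : M) (t : BT M H.base.carrier (P.Sec α)) (v : V) :
    (H.leftForm α (op p • t)).1 v = (H.leftForm α t).1 v * H.inclTot (P.incl p) := by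
  induction t using BT.induction with
  | h0 => simp
  | hadd x y hx hy => simp only [smul_add, map_add, Submodule.coe_add, LinearMap.add_apply, hx, hy,
      add_mul]
  | ht μ T => simp [BT.op_act_tmul, mul_assoc]

theorem rightForm_left (p : M) (t : BT M (P.Sec α) H.base.carrier) (v : V) :
    (H.rightForm α (p • t)).1 v = H.inclTot (P.incl p) * (H.rightForm α t).1 v := by
  induction t using BT.induction with
  | h0 => simp
  | hadd x y hx hy => simp only [smul_add, map_add, Submodule.coe_add, LinearMap.add_apply, hx, hy,
      mul_add]
  | ht μ T => simp [BT.act_tmul, mul_assoc]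

theorem rightForm_right (p : M) (t : BT M (P.Sec α) H.base.carrier) (v : V) :
    (H.rightForm α (op p • t)).1 v = (H.rightForm α t).1 v * H.inclTot (P.incl p) := by
  induction t using BT.induction with
  | h0 => simp
  | hadd x y hx hy => simp only [smul_add, map_add, Submodule.coe_add, LinearMap.add_apply, hx, hy,
      add_mul]
  | ht μ T => simp [BT.op_act_tmul, DiffStarCalculus.op_smul_def, H.inclBase_incl, mul_assoc]

end HorizontalCalculus

theorem GradedStarAlg.proj_mul_of_right (X : GradedStarAlg) (k : ℕ) (x y : X.carrier)
    (hy : y ∈ X.gr 0) : GradedAlgebra.proj X.gr k (x * y) = GradedAlgebra.proj X.gr k x * y := by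
  rw [GradedAlgebra.proj_apply, GradedAlgebra.proj_apply,
    ← DirectSum.coe_decompose_mul_add_of_right_mem X.gr hy, add_zero]

theorem GradedStarAlg.proj_mul_of_left (X : GradedStarAlg) (k : ℕ) (x y : X.carrier)
    (hx : x ∈ X.gr 0) : GradedAlgebra.proj X.gr k (x * y) = x * GradedAlgebra.proj X.gr k y := by
  rw [GradedAlgebra.proj_apply, GradedAlgebra.proj_apply,
    ← DirectSum.coe_decompose_mul_add_of_left_mem X.gr hx, zero_add]

namespace HorizontalCalculus

variable {P : QPBundle G M} (H : HorizontalCalculus P) {V : Type*} [AddCommGroup V] [Module ℂ V]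
  (α : Corep G V)

theorem inclTot_mem (x : P.tot) : H.inclTot x ∈ H.hor.gr 0 := (H.inclTot_range _).2 ⟨x, rfl⟩

theorem inclBase_proj (k : ℕ) (μ : H.base.carrier) :
    H.inclBase (GradedAlgebra.proj H.base.gr k μ) =
      GradedAlgebra.proj H.hor.gr k (H.inclBase μ) := by
  induction μ using DirectSum.Decomposition.inductionOn H.base.gr with
  | zero => simp
  | @homogeneous i m =>
    have hm := H.inclBase_degree i m m.2
    rw [GradedAlgebra.proj_apply, GradedAlgebra.proj_apply]
    by_cases h : i = k
    · subst h
      rw [DirectSum.decompose_of_mem_same _ m.2, DirectSum.decompose_of_mem_same _ hm]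
    · rw [DirectSum.decompose_of_mem_ne _ m.2 h, DirectSum.decompose_of_mem_ne _ hm h, map_zero]
  | add a b ha hb => simp only [map_add, ha, hb]

/-- The degree `k` component on `Ω ⊗_M Γ`. -/
def compL (k : ℕ) : BT M H.base.carrier (P.Sec α) →ₗ[ℂ] BT M H.base.carrier (P.Sec α) :=
  BT.map (GradedAlgebra.proj H.base.gr k) LinearMap.id
    (fun p μ => H.base.proj_mul_of_right k μ _ ((H.base.incl_range _).2 ⟨p, rfl⟩)) (fun _ _ => rfl)

/-- The degree `k` component on `Γ ⊗_M Ω`. -/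
def compR (k : ℕ) : BT M (P.Sec α) H.base.carrier →ₗ[ℂ] BT M (P.Sec α) H.base.carrier :=
  BT.map LinearMap.id (GradedAlgebra.proj H.base.gr k) (fun _ _ => rfl)
    (fun p μ => H.base.proj_mul_of_left k _ μ ((H.base.incl_range _).2 ⟨p, rfl⟩))

theorem leftForm_compL (k : ℕ) (t : BT M H.base.carrier (P.Sec α)) (v : V) :
    (H.leftForm α (H.compL α k t)).1 v =
      GradedAlgebra.proj H.hor.gr k ((H.leftForm α t).1 v) := by
  induction t using BT.induction with
  | h0 => simp
  | hadd x y hx hy => simp only [map_add, Submodule.coe_add, LinearMap.add_apply, hx, hy]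
  | ht μ T =>
    rw [compL, BT.map_tmul, leftForm_tmul, leftForm_tmul, inclBase_proj,
      H.hor.proj_mul_of_right k _ _ (H.inclTot_mem _)]
    rfl

theorem rightForm_compR (k : ℕ) (t : BT M (P.Sec α) H.base.carrier) (v : V) :
    (H.rightForm α (H.compR α k t)).1 v =
      GradedAlgebra.proj H.hor.gr k ((H.rightForm α t).1 v) := by
  induction t using BT.induction with
  | h0 => simp
  | hadd x y hx hy => simp only [map_add, Submodule.coe_add, LinearMap.add_apply, hx, hy]
  | ht T μ =>
    rw [compR, BT.map_tmul, rightForm_tmul, rightForm_tmul, inclBase_proj,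
      H.hor.proj_mul_of_left k _ _ (H.inclTot_mem _)]
    rfl

theorem compL_mem (k : ℕ) (t : BT M H.base.carrier (P.Sec α)) :
    H.compL α k t ∈ BT.spanL M (P.Sec α) (H.base.gr k) := by
  induction t using BT.induction with
  | h0 => simp
  | hadd x y hx hy => rw [map_add]; exact add_mem hx hy
  | ht μ T =>
    rw [compL, BT.map_tmul]
    exact BT.tmul_mem_spanL (by rw [GradedAlgebra.proj_apply]; exact Subtype.prop _) _

theorem compR_mem (k : ℕ) (t : BT M (P.Sec α) H.base.carrier) :
    H.compR α k t ∈ BT.spanR M (P.Sec α) (H.base.gr k) := by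
  induction t using BT.induction with
  | h0 => simp
  | hadd x y hx hy => rw [map_add]; exact add_mem hx hy
  | ht μ T =>
    rw [compR, BT.map_tmul]
    exact BT.tmul_mem_spanR _ (by rw [GradedAlgebra.proj_apply]; exact Subtype.prop _)

theorem proj_of_mem {X : GradedStarAlg} {k : ℕ} {x : X.carrier} (hx : x ∈ X.gr k) :
    GradedAlgebra.proj X.gr k x = x := by
  rw [GradedAlgebra.proj_apply, DirectSum.decompose_of_mem_same _ hx]

theorem mem_spanL_iff (hinj : Function.Injective (H.leftForm α)) (k : ℕ)
    (t : BT M H.base.carrier (P.Sec α)) :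
    t ∈ BT.spanL M (P.Sec α) (H.base.gr k) ↔ ∀ v, (H.leftForm α t).1 v ∈ H.hor.gr k := by
  constructor
  · intro ht v
    refine BT.spanL_le ((LinearMap.applyₗ v) ∘ₗ (Corep.Hom0 α H.rep).subtype ∘ₗ H.leftForm α)
      (fun μ hμ T => ?_) ht
    simpa using SetLike.mul_mem_graded (H.inclBase_degree k μ hμ) (H.inclTot_mem _)
  · intro h
    have : H.compL α k t = t := hinj (Subtype.ext (LinearMap.ext fun v => by
      rw [leftForm_compL, proj_of_mem (h v)]))
    rw [← this]
    exact H.compL_mem α k t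

theorem mem_spanR_iff (hinj : Function.Injective (H.rightForm α)) (k : ℕ)
    (t : BT M (P.Sec α) H.base.carrier) :
    t ∈ BT.spanR M (P.Sec α) (H.base.gr k) ↔ ∀ v, (H.rightForm α t).1 v ∈ H.hor.gr k := by
  constructor
  · intro ht v
    refine BT.spanR_le ((LinearMap.applyₗ v) ∘ₗ (Corep.Hom0 α H.rep).subtype ∘ₗ H.rightForm α)
      (fun T μ hμ => ?_) ht
    simpa using SetLike.mul_mem_graded (H.inclTot_mem _) (H.inclBase_degree k μ hμ)
  · intro h
    have : H.compR α k t = t := hinj (Subtype.ext (LinearMap.ext fun v => by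
      rw [rightForm_compR, proj_of_mem (h v)]))
    rw [← this]
    exact H.compR_mem α k t

/-- What is needed for the associated bundle of `α` to be a quantum vector bundle with a connection:
the sections are a finitely generated projective module on both sides, and every
form of type `α` on the total space is uniquely a bundle valued form on the base, in
both orders. -/
structure Associable : Prop where
  finiteL : Module.Finite M (P.Sec α)
  projectiveL : Module.Projective M (P.Sec α)
  finiteR : Module.Finite Mᵐᵒᵖ (P.Sec α)
  projectiveR : Module.Projective Mᵐᵒᵖ (P.Sec α)
  bijectiveL : Function.Bijective (H.leftForm α)
  bijectiveR : Function.Bijective (H.rightForm α)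

variable {H α}

/-- The inverse of `μ ⊗ T ↦ μ T`. -/
def upsL (h : H.Associable α) : H.HSec α ≃ₗ[ℂ] BT M H.base.carrier (P.Sec α) :=
  (LinearEquiv.ofBijective (H.leftForm α) h.bijectiveL).symm

/-- The inverse of `T ⊗ μ ↦ T μ`. -/
def upsR (h : H.Associable α) : H.HSec α ≃ₗ[ℂ] BT M (P.Sec α) H.base.carrier :=
  (LinearEquiv.ofBijective (H.rightForm α) h.bijectiveR).symm

@[simp] theorem leftForm_upsL (h : H.Associable α) (τ : H.HSec α) :
    H.leftForm α (upsL h τ) = τ :=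
  (LinearEquiv.ofBijective (H.leftForm α) h.bijectiveL).apply_symm_apply τ

@[simp] theorem rightForm_upsR (h : H.Associable α) (τ : H.HSec α) :
    H.rightForm α (upsR h τ) = τ :=
  (LinearEquiv.ofBijective (H.rightForm α) h.bijectiveR).apply_symm_apply τ

/-- The map `σ`, which sends `∑ μ ⊗ T` to `∑ T' ⊗ μ'` with `∑ μ T = ∑ T' μ'`. -/
def assocσ (h : H.Associable α) :
    BT M H.base.carrier (P.Sec α) ≃ₗ[ℂ] BT M (P.Sec α) H.base.carrier :=
  (upsL h).symm ≪≫ₗ upsR h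

@[simp] theorem rightForm_assocσ (h : H.Associable α) (t : BT M H.base.carrier (P.Sec α)) :
    H.rightForm α (assocσ h t) = H.leftForm α t := by
  rw [assocσ, LinearEquiv.trans_apply, rightForm_upsR]; rfl

theorem leftForm_assocσ_symm (h : H.Associable α) (t : BT M (P.Sec α) H.base.carrier) :
    H.leftForm α ((assocσ h).symm t) = H.rightForm α t := by
  rw [← rightForm_assocσ h, LinearEquiv.apply_symm_apply]

/-- `T ↦ D ∘ T`. -/
def CovDer.comp (Δ : H.CovDer) (α : Corep G V) : P.Sec α →ₗ[ℂ] H.HSec α where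
  toFun T := ⟨Δ.D ∘ₗ H.inclTot.toLinearMap ∘ₗ QPBundle.Sec.toLin P T, by
    intro v
    rw [LinearMap.rTensor_comp, LinearMap.comp_apply, LinearMap.comp_apply, LinearMap.comp_apply, AlgHom.toLinearMap_apply, ← coact_sec]
    exact Δ.D_mem _⟩
  map_add' T S := Subtype.ext (LinearMap.ext fun v => by simp)
  map_smul' c T := Subtype.ext (LinearMap.ext fun v => by simp)

@[simp] theorem CovDer.comp_apply (Δ : H.CovDer) (T : P.Sec α) (v : V) :
    (Δ.comp α T).1 v = Δ.D (H.inclTot (QPBundle.Sec.toLin P T v)) := rfl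

theorem incl_mem_zero (H : HorizontalCalculus P) (p : M) :
    H.inclTot (P.incl p) ∈ H.hor.gr 0 := H.inclTot_mem _

/-- The quantum association functor on objects: the associated bundle of the corepresentation `α`
with the induced connection `T ↦ Υ (D ∘ T)`. -/
def assocBundle (Δ : H.CovDer) (h : H.Associable α) : QVB H.base where
  Γ := P.Sec α
  finiteL := h.finiteL
  projectiveL := h.projectiveL
  finiteR := h.finiteR
  projectiveR := h.projectiveR
  σ := assocσ h
  σ_left p t := h.bijectiveR.1 (Subtype.ext (LinearMap.ext fun v => by
    rw [rightForm_assocσ, leftForm_left, rightForm_left, rightForm_assocσ]))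
  σ_right p t := h.bijectiveR.1 (Subtype.ext (LinearMap.ext fun v => by
    rw [rightForm_assocσ, leftForm_right, rightForm_right, rightForm_assocσ]))
  σ_degree k t := by
    rw [H.mem_spanL_iff α h.bijectiveL.1, H.mem_spanR_iff α h.bijectiveR.1, rightForm_assocσ]
  nabla := (upsL h).toLinearMap ∘ₗ Δ.comp α
  nabla_degree T := by
    rw [H.mem_spanL_iff α h.bijectiveL.1]
    intro v
    simpa using Δ.D_degree 0 _ (H.inclTot_mem _)
  nabla_left p T := h.bijectiveL.1 (Subtype.ext (LinearMap.ext fun v => by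
    have := Δ.D_mul 0 _ (H.incl_mem_zero p) (H.inclTot (QPBundle.Sec.toLin P T v))
    rw [← H.inclBase_incl, Δ.D_base, pow_zero, one_smul] at this
    simp only [LinearMap.comp_apply, LinearEquiv.coe_coe, map_add, leftForm_upsL,
      CovDer.comp_apply, QPBundle.Sec.smul_apply, map_mul, Submodule.coe_add,
      LinearMap.add_apply, leftForm_left, leftForm_tmul]
    rw [← H.inclBase_incl, this, add_comm]))
  nabla_right p T := h.bijectiveL.1 (Subtype.ext (LinearMap.ext fun v => by
    have := Δ.D_mul 0 _ (H.inclTot_mem (QPBundle.Sec.toLin P T v)) (H.inclTot (P.incl p))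
    rw [← H.inclBase_incl, Δ.D_base, pow_zero, one_smul] at this
    simp only [LinearMap.comp_apply, LinearEquiv.coe_coe, map_add, leftForm_upsL,
      CovDer.comp_apply, QPBundle.Sec.op_smul_apply, map_mul, Submodule.coe_add,
      LinearMap.add_apply, leftForm_right, leftForm_assocσ_symm, rightForm_tmul]
    rw [← H.inclBase_incl, this]))

end HorizontalCalculus

namespace HorizontalCalculus

universe v

variable {P : QPBundle G M} {H : HorizontalCalculus P}

/-- The quantum association functor on the finite dimensional corepresentations. -/
def qAss (Δ : H.CovDer) (h : ∀ α : QRep.{v} G, H.Associable α.rep) (α : QRep.{v} G) :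
    QVB H.base := assocBundle Δ (h α)

/-- The linear equivalence underlying an isomorphism from `qAss (α ⊗ β)` to
`qAss α ⊗ qAss β`. -/
def tensorEquiv {Δ : H.CovDer} {h : ∀ α : QRep.{v} G, H.Associable α.rep} {α β : QRep.{v} G}
    (A : QVB.ParallelIso (qAss Δ h (α.tensor β)) ((qAss Δ h α).tensor (qAss Δ h β))) :
    P.Sec (α.rep.tensor β.rep) ≃ₗ[ℂ] BT M (P.Sec α.rep) (P.Sec β.rep) := A.equiv

end HorizontalCalculus

end bundle

end

universe v uG uM uP uH uB

/-! Everything follows from frames. A left frame of `α` consists of sections `T_k` and invariant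
elements `y_k` of `V ⊗ B`, where `B` is the total space, with `∑ y_k T_k(v) = v ⊗ 1`. If `τ : V → X`
is a morphism into a comodule algebra `X` that receives `B`, applying `τ` to the first leg of `y_k`
and multiplying gives coefficients `c_k(τ)` with `τ(v) = ∑ c_k(τ) T_k(v)`, and these are invariant
because `y_k` is. With `X = B` they lie in `M`, so the `T_k` and `c_k` form a dual basis and the
sections are finitely generated projective. With `X = Hor` they lie in `Ω(M)`, and `τ ↦ ∑ c_k(τ) ⊗
T_k` inverts `μ ⊗ T ↦ μ T` (`bijective_leftForm`). Right frames serve the other side. A left frame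
of `β` also inverts the product map `T ⊗ S ↦ (v ⊗ w ↦ T(v) S(w))`: a section over `α ⊗ β` is
expanded in its second argument, and its coefficients are sections over `α` (`bijective_mulSec`).

For an irreducible `α` with matrix `u`, put `x_{ki} = T_k(e_i)` and `y_k = ∑ e_i ⊗ x_{ki}*`. The
frame identity is then `∑_k x_{ki}* x_{kj} = δ_{ij}`, and the invariance of `y_k` amounts to `u u* =
1`. Applying the coaction to the orthogonality relation gives only `u* u = 1`; since the antipode
supplies a right inverse of `u`, the two one-sided inverses agree (`mul_eq_one_comm`). The relation
with `Z` gives the right frame in the same way, with the entrywise adjoint of `u` in place of `u`.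

Frames add up over direct sums, so it remains to decompose an arbitrary finite dimensional
corepresentation into irreducibles. A corepresentation is treated as a module over the free algebra
on the functionals on `G`, each functional acting by slicing the coaction; the submodules needed and
the linear maps are then the invariant subspaces and the morphisms. Unitary corepresentations are
semisimple by orthogonal complements, the regular one because it is a sum of images of unitary ones,
and a finite dimensional one because its coefficient maps embed it in a power of the regular one.

The compatibility with `∇` and `σ` is checked inside `Hor`. The spaces `Ω(M) ⊗_M Γ` and `Γ ⊗_M Ω(M)`
embed in the linear maps from `V` to `Hor`; there `σ` leaves the underlying map unchanged, `∇` is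
composition with `D`, and the product of sections is multiplication (`Realization`). Both identities
thereby reduce to associativity and to the Leibniz rule for `D` in degree `0`. Naturality in either
degree is checked for the product map, the inverse of `A`. -/

noncomputable section

/-! ### Morphisms of corepresentations and comodule algebras -/

namespace Corep

variable {G : Type*} [Ring G] [HopfAlgebra ℂ G]
variable {U V W X : Type*} [AddCommGroup U] [Module ℂ U] [AddCommGroup V] [Module ℂ V]
  [AddCommGroup W] [Module ℂ W] [Ring X] [Algebra ℂ X]
  {α : Corep G U} {β : Corep G V} {γ : Corep G W}

/-- A morphism maps invariant elements to invariant elements. -/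
theorem coact_map_of_invariant {f : U →ₗ[ℂ] V} (hf : f ∈ Hom0 α β) {u : U}
    (hu : α.coact u = u ⊗ₜ[ℂ] (1 : G)) : β.coact (f u) = f u ⊗ₜ[ℂ] (1 : G) := by
  rw [hf u, hu, LinearMap.rTensor_tmul]

theorem id_mem_hom0 : LinearMap.id ∈ Hom0 α α := fun v => by simp

theorem comp_mem_hom0 {g : V →ₗ[ℂ] W} {f : U →ₗ[ℂ] V} (hg : g ∈ Hom0 β γ) (hf : f ∈ Hom0 α β) :
    g ∘ₗ f ∈ Hom0 α γ := fun v => by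
  rw [LinearMap.rTensor_comp, LinearMap.comp_apply, LinearMap.comp_apply, hg, hf v]

/-- Tensoring on the right with an invariant element is a morphism. -/
theorem flip_mk_mem_hom0 {y : V} (hy : β.coact y = y ⊗ₜ[ℂ] (1 : G)) :
    (TensorProduct.mk ℂ U V).flip y ∈ Hom0 α (α.tensor β) := by
  intro v
  rw [LinearMap.flip_apply, TensorProduct.mk_apply, tensor_coact_tmul, hy]
  generalize α.coact v = s
  induction s with
  | zero => simp
  | add a b ha hb => simp only [TensorProduct.add_tmul, map_add, ha, hb]
  | tmul v g => simp

theorem assoc_symm_mem_hom0 : (TensorProduct.assoc ℂ U V W).symm.toLinearMap ∈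
    Hom0 (α.tensor (β.tensor γ)) ((α.tensor β).tensor γ) := by
  intro x
  induction x with
  | zero => simp
  | add a b ha hb => simp only [map_add, ha, hb]
  | tmul u x =>
    induction x with
    | zero => simp
    | add a b ha hb => simp only [TensorProduct.tmul_add, map_add, ha, hb]
    | tmul v w =>
      simp only [LinearEquiv.coe_coe, TensorProduct.assoc_symm_tmul, tensor_coact_tmul]
      generalize α.coact u = r
      generalize β.coact v = s
      generalize γ.coact w = t
      induction r with
      | zero => simp
      | add a b ha hb => simp only [TensorProduct.add_tmul, map_add, ha, hb]
      | tmul u g =>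
        induction s with
        | zero => simp
        | add a b ha hb => simp only [TensorProduct.add_tmul, TensorProduct.tmul_add, map_add, ha, hb]
        | tmul v h =>
          induction t with
          | zero => simp
          | add a b ha hb => simp only [TensorProduct.tmul_add, map_add, ha, hb]
          | tmul w k => simp [mul_assoc]

/-- The multiplication of a comodule algebra is a morphism. -/
theorem mul'_mem_hom0 {ξ : Corep G X} (hξ : ∀ x y, ξ.coact (x * y) = ξ.coact x * ξ.coact y) :
    LinearMap.mul' ℂ X ∈ Hom0 (ξ.tensor ξ) ξ := by
  intro z
  induction z with
  | zero => simp
  | add a b ha hb => simp only [map_add, ha, hb]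
  | tmul x y =>
    rw [LinearMap.mul'_apply, hξ, tensor_coact_tmul]
    generalize ξ.coact x = s
    generalize ξ.coact y = t
    induction s with
    | zero => simp
    | add a b ha hb => simp only [TensorProduct.add_tmul, add_mul, map_add, ha, hb]
    | tmul x g =>
      induction t with
      | zero => simp
      | add a b ha hb => simp only [TensorProduct.tmul_add, mul_add, map_add, ha, hb]
      | tmul y h => simp

/-- The product of two morphisms to a comodule algebra. -/
theorem mul'_comp_map_mem_hom0 {ξ : Corep G X}
    (hξ : ∀ x y, ξ.coact (x * y) = ξ.coact x * ξ.coact y)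
    {f : U →ₗ[ℂ] X} {g : V →ₗ[ℂ] X} (hf : f ∈ Hom0 α ξ) (hg : g ∈ Hom0 β ξ) :
    LinearMap.mul' ℂ X ∘ₗ TensorProduct.map f g ∈ Hom0 (α.tensor β) ξ :=
  comp_mem_hom0 (mul'_mem_hom0 hξ) (map_mem_hom0 hf hg)

end Corep

/-! ### Frames, projectivity of the sections, and bundle valued forms -/

section frames

variable {G : Type*} [Ring G] [HopfAlgebra ℂ G] [StarRing G] [StarModule ℂ G]
  {M : Type*} [Ring M] [Algebra ℂ M] [StarRing M] [StarModule ℂ M]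

namespace QPBundle

variable (P : QPBundle G M) {V : Type*} [AddCommGroup V] [Module ℂ V] (α : Corep G V)

/-- Sections `T_k` and invariant elements `y_k` of `V ⊗ B` with `∑ y_k T_k(v) = v ⊗ 1`. -/
structure LeftFrame (ι : Type*) [Fintype ι] where
  sec : ι → P.Sec α
  dual : ι → V ⊗[ℂ] P.tot
  invariant : ∀ k, (α.tensor P.rep).coact (dual k) = dual k ⊗ₜ[ℂ] (1 : G)
  sum_dual : ∀ v, ∑ k, LinearMap.lTensor V (LinearMap.mulRight ℂ (Sec.toLin P (sec k) v)) (dual k) =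
    v ⊗ₜ[ℂ] (1 : P.tot)

/-- Sections `T_k` and invariant elements `y_k` of `B ⊗ V` with `∑ T_k(v) y_k = 1 ⊗ v`. -/
structure RightFrame (ι : Type*) [Fintype ι] where
  sec : ι → P.Sec α
  dual : ι → P.tot ⊗[ℂ] V
  invariant : ∀ k, (P.rep.tensor α).coact (dual k) = dual k ⊗ₜ[ℂ] (1 : G)
  sum_dual : ∀ v, ∑ k, LinearMap.rTensor V (LinearMap.mulLeft ℂ (Sec.toLin P (sec k) v)) (dual k) =
    (1 : P.tot) ⊗ₜ[ℂ] v

variable {P α} {ι : Type*} [Fintype ι] {X : Type*} [Ring X] [Algebra ℂ X]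

/-- Expansion of a linear map in a left frame. -/
theorem LeftFrame.expand (F : P.LeftFrame α ι) (j : P.tot →ₐ[ℂ] X) (τ : V →ₗ[ℂ] X) (v : V) :
    ∑ k, LinearMap.mul' ℂ X (TensorProduct.map τ j.toLinearMap (F.dual k)) *
      j (Sec.toLin P (F.sec k) v) = τ v := by
  -- The factor `j b` is absorbed into the second leg of the dual element, where `sum_dual` applies.
  have key : ∀ (b : P.tot) (y : V ⊗[ℂ] P.tot),
      LinearMap.mul' ℂ X (TensorProduct.map τ j.toLinearMap y) * j b =
      LinearMap.mul' ℂ X (TensorProduct.map τ j.toLinearMap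
        (LinearMap.lTensor V (LinearMap.mulRight ℂ b) y)) := by
    intro b y
    induction y with
    | zero => simp
    | add a b ha hb => simp only [map_add, add_mul, ha, hb]
    | tmul v x => simp [mul_assoc]
  simp only [key, ← map_sum, F.sum_dual]
  simp

/-- Expansion of a linear map in a right frame. -/
theorem RightFrame.expand (F : P.RightFrame α ι) (j : P.tot →ₐ[ℂ] X) (τ : V →ₗ[ℂ] X) (v : V) :
    ∑ k, j (Sec.toLin P (F.sec k) v) *
      LinearMap.mul' ℂ X (TensorProduct.map j.toLinearMap τ (F.dual k)) = τ v := by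
  have key : ∀ (b : P.tot) (y : P.tot ⊗[ℂ] V),
      j b * LinearMap.mul' ℂ X (TensorProduct.map j.toLinearMap τ y) =
      LinearMap.mul' ℂ X (TensorProduct.map j.toLinearMap τ
        (LinearMap.rTensor V (LinearMap.mulLeft ℂ b) y)) := by
    intro b y
    induction y with
    | zero => simp
    | add a b ha hb => simp only [map_add, mul_add, ha, hb]
    | tmul v x => simp [mul_assoc]
  simp only [key, ← map_sum, F.sum_dual]
  simp

/-- The coefficient is the image of the invariant element `dual k` under the morphism "apply `τ ⊗
j`, then multiply". This is what puts frame coefficients into `M` or `Ω(M)`. -/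
theorem LeftFrame.coact_coeff (F : P.LeftFrame α ι) {ξ : Corep G X}
    (hξ : ∀ x y, ξ.coact (x * y) = ξ.coact x * ξ.coact y) {j : P.tot →ₐ[ℂ] X}
    (hj : j.toLinearMap ∈ Corep.Hom0 P.rep ξ) {τ : V →ₗ[ℂ] X} (hτ : τ ∈ Corep.Hom0 α ξ) (k : ι) :
    ξ.coact (LinearMap.mul' ℂ X (TensorProduct.map τ j.toLinearMap (F.dual k))) =
      LinearMap.mul' ℂ X (TensorProduct.map τ j.toLinearMap (F.dual k)) ⊗ₜ[ℂ] (1 : G) :=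
  Corep.coact_map_of_invariant (Corep.mul'_comp_map_mem_hom0 hξ hτ hj) (F.invariant k)

theorem RightFrame.coact_coeff (F : P.RightFrame α ι) {ξ : Corep G X}
    (hξ : ∀ x y, ξ.coact (x * y) = ξ.coact x * ξ.coact y) {j : P.tot →ₐ[ℂ] X}
    (hj : j.toLinearMap ∈ Corep.Hom0 P.rep ξ) {τ : V →ₗ[ℂ] X} (hτ : τ ∈ Corep.Hom0 α ξ) (k : ι) :
    ξ.coact (LinearMap.mul' ℂ X (TensorProduct.map j.toLinearMap τ (F.dual k))) =
      LinearMap.mul' ℂ X (TensorProduct.map j.toLinearMap τ (F.dual k)) ⊗ₜ[ℂ] (1 : G) :=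
  Corep.coact_map_of_invariant (Corep.mul'_comp_map_mem_hom0 hξ hj hτ) (F.invariant k)

/-- By associativity a left factor of `τ` comes out of its frame coefficients. This yields the
`M`-linearity of the coordinates and the coefficients of products `μ T` and `T ⊗ S`. -/
theorem mul'_map_mulLeft (j τ : V →ₗ[ℂ] X) (i : P.tot →ₗ[ℂ] X) (x : X)
    (h : ∀ v, τ v = x * j v) (y : V ⊗[ℂ] P.tot) :
    LinearMap.mul' ℂ X (TensorProduct.map τ i y) =
      x * LinearMap.mul' ℂ X (TensorProduct.map j i y) := by
  induction y with
  | zero => simp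
  | add a b ha hb => simp only [map_add, mul_add, ha, hb]
  | tmul v b => simp [h, mul_assoc]

theorem mul'_map_mulRight (j τ : V →ₗ[ℂ] X) (i : P.tot →ₗ[ℂ] X) (x : X)
    (h : ∀ v, τ v = j v * x) (y : P.tot ⊗[ℂ] V) :
    LinearMap.mul' ℂ X (TensorProduct.map i τ y) =
      LinearMap.mul' ℂ X (TensorProduct.map i j y) * x := by
  induction y with
  | zero => simp
  | add a b ha hb => simp only [map_add, add_mul, ha, hb]
  | tmul v b => simp [h, mul_assoc]

theorem id_mem : (AlgHom.id ℂ P.tot).toLinearMap ∈ Corep.Hom0 P.rep P.rep := Corep.id_mem_hom0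

/-- The coefficients of a section are invariant elements of the total space, so they come from `M`;
since `incl` is injective they do so uniquely, and linearity over `M` can be tested in the total
space. -/
theorem LeftFrame.exists_coord (F : P.LeftFrame α ι) (k : ι) :
    ∃ φ : P.Sec α →ₗ[M] M, ∀ T, P.incl (φ T) = LinearMap.mul' ℂ P.tot
      (TensorProduct.map (Sec.toLin P T) (AlgHom.id ℂ P.tot).toLinearMap (F.dual k)) := by
  choose φ hφ using fun T : P.Sec α =>
    (P.invariant_iff _).1 (F.coact_coeff P.coact_mul id_mem T.2 k)
  refine ⟨⟨⟨φ, fun T S => P.incl_injective ?_⟩, fun m T => P.incl_injective ?_⟩, hφ⟩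
  · rw [map_add, hφ, hφ, hφ]
    change LinearMap.mul' ℂ P.tot (TensorProduct.map (Sec.toLin P (T + S)) _ _) = _
    rw [map_add, TensorProduct.map_add_left, LinearMap.add_apply, map_add]
    rfl
  · change P.incl (φ (m • T)) = P.incl (m * φ T)
    rw [map_mul, hφ, hφ]
    exact mul'_map_mulLeft _ _ _ _ (Sec.smul_apply m T) _

theorem RightFrame.exists_coord (F : P.RightFrame α ι) (k : ι) :
    ∃ φ : P.Sec α →ₗ[Mᵐᵒᵖ] Mᵐᵒᵖ, ∀ T, P.incl (φ T).unop = LinearMap.mul' ℂ P.tot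
      (TensorProduct.map (AlgHom.id ℂ P.tot).toLinearMap (Sec.toLin P T) (F.dual k)) := by
  choose φ hφ using fun T : P.Sec α =>
    (P.invariant_iff _).1 (F.coact_coeff P.coact_mul id_mem T.2 k)
  refine ⟨⟨⟨fun T => op (φ T), fun T S => unop_injective (P.incl_injective ?_)⟩,
    fun m T => unop_injective (P.incl_injective ?_)⟩, hφ⟩
  · rw [unop_add, map_add, unop_op, unop_op, unop_op, hφ, hφ, hφ]
    change LinearMap.mul' ℂ P.tot (TensorProduct.map _ (Sec.toLin P (T + S)) _) = _
    rw [map_add, TensorProduct.map_add_right, LinearMap.add_apply, map_add]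
    rfl
  · change P.incl (φ (m • T)) = P.incl (φ T * m.unop)
    rw [map_mul, hφ, hφ]
    exact mul'_map_mulRight _ _ _ _ (Sec.op_smul_apply' m T) _

theorem LeftFrame.sum_coord (F : P.LeftFrame α ι) {φ : ι → P.Sec α →ₗ[M] M}
    (hφ : ∀ k T, P.incl (φ k T) = LinearMap.mul' ℂ P.tot
      (TensorProduct.map (Sec.toLin P T) (AlgHom.id ℂ P.tot).toLinearMap (F.dual k)))
    (T : P.Sec α) : T = ∑ k, φ k T • F.sec k := by
  refine Sec.ext fun v => ?_
  rw [map_sum, LinearMap.sum_apply]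
  simp only [Sec.smul_apply, hφ]
  exact (F.expand (AlgHom.id ℂ P.tot) _ v).symm

theorem RightFrame.sum_coord (F : P.RightFrame α ι) {φ : ι → P.Sec α →ₗ[Mᵐᵒᵖ] Mᵐᵒᵖ}
    (hφ : ∀ k T, P.incl (φ k T).unop = LinearMap.mul' ℂ P.tot
      (TensorProduct.map (AlgHom.id ℂ P.tot).toLinearMap (Sec.toLin P T) (F.dual k)))
    (T : P.Sec α) : T = ∑ k, φ k T • F.sec k := by
  refine Sec.ext fun v => ?_
  rw [map_sum, LinearMap.sum_apply]
  simp only [Sec.op_smul_apply', hφ]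
  exact (F.expand (AlgHom.id ℂ P.tot) _ v).symm

end QPBundle

namespace HorizontalCalculus

open QPBundle

variable {P : QPBundle G M} (H : HorizontalCalculus P) {V : Type*} [AddCommGroup V] [Module ℂ V]
  {α : Corep G V} {ι : Type*} [Fintype ι]

theorem inclTot_mem_hom0 : H.inclTot.toLinearMap ∈ Corep.Hom0 P.rep H.rep := H.coact_extends

/-- The inverse is the frame expansion `τ ↦ ∑ c_k(τ) ⊗ T_k`, whose coefficients are invariant
horizontal forms and hence base forms. -/
theorem bijective_leftForm (F : P.LeftFrame α ι) : Function.Bijective (H.leftForm α) := by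
  choose φ hφ using F.exists_coord
  have hF := fun k => fun τ : H.HSec α =>
    (H.invariant_iff _).1 (F.coact_coeff H.coact_mul H.inclTot_mem_hom0 τ.2 k)
  choose ψ hψ using hF
  let Ψ : ι → H.HSec α →ₗ[ℂ] H.base.carrier := fun k =>
    { toFun := ψ k
      map_add' := fun τ ρ => H.inclBase_injective (by
        rw [map_add, hψ, hψ, hψ, Submodule.coe_add, TensorProduct.map_add_left,
          LinearMap.add_apply, map_add])
      map_smul' := fun c τ => H.inclBase_injective (by
        rw [RingHom.id_apply, map_smul, hψ, hψ, Submodule.coe_smul, TensorProduct.map_smul_left,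
          LinearMap.smul_apply, map_smul]) }
  have hΨ : ∀ k τ, H.inclBase (Ψ k τ) = LinearMap.mul' ℂ _
      (TensorProduct.map τ.1 H.inclTot.toLinearMap (F.dual k)) := hψ
  -- The form-valued coefficient of `μ T` is `μ` times the `M`-valued coefficient of `T`. Moving
  -- that factor across the tensor sign turns the expansion into `μ ⊗ ∑ φ_k(T) T_k = μ ⊗ T`.
  have hmul : ∀ k μ T, Ψ k (H.leftForm α (BT.tmul M μ T)) = op (φ k T) • μ := by
    intro k μ T
    apply H.inclBase_injective
    rw [hΨ, DiffStarCalculus.op_smul_def, map_mul, H.inclBase_incl, hφ,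
      mul'_map_mulLeft (H.inclTot.toLinearMap ∘ₗ Sec.toLin P T) _ _ (H.inclBase μ)
        (fun v => by simp)]
    congr 1
    induction F.dual k with
    | zero => simp
    | add a b ha hb => simp only [map_add, ha, hb]
    | tmul v b => simp
  refine Function.bijective_iff_has_inverse.2
    ⟨fun τ => ∑ k, BT.tmul M (Ψ k τ) (F.sec k), fun t => ?_, fun τ => ?_⟩
  · change ∑ k, BT.tmul M (Ψ k (H.leftForm α t)) (F.sec k) = t
    induction t using BT.induction with
    | h0 => simp [BT.zero_tmul]
    | hadd x y hx hy => simp only [map_add, BT.add_tmul, Finset.sum_add_distrib, hx, hy]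
    | ht μ T =>
      simp only [hmul, BT.balanced]
      conv_rhs => rw [F.sum_coord hφ T]
      exact (map_sum (BT.mk M _ (P.Sec α) μ) _ _).symm
  · refine Subtype.ext (LinearMap.ext fun v => ?_)
    rw [map_sum, Submodule.coe_sum, LinearMap.sum_apply]
    simp only [leftForm_tmul, hΨ]
    exact F.expand H.inclTot τ.1 v

/-- The mirror image for right frames, with inverse `τ ↦ ∑ T_k ⊗ c_k(τ)`. -/
theorem bijective_rightForm (F : P.RightFrame α ι) : Function.Bijective (H.rightForm α) := by
  choose φ hφ using F.exists_coord
  have hF := fun k => fun τ : H.HSec α =>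
    (H.invariant_iff _).1 (F.coact_coeff H.coact_mul H.inclTot_mem_hom0 τ.2 k)
  choose ψ hψ using hF
  let Ψ : ι → H.HSec α →ₗ[ℂ] H.base.carrier := fun k =>
    { toFun := ψ k
      map_add' := fun τ ρ => H.inclBase_injective (by
        rw [map_add, hψ, hψ, hψ, Submodule.coe_add, TensorProduct.map_add_right,
          LinearMap.add_apply, map_add])
      map_smul' := fun c τ => H.inclBase_injective (by
        rw [RingHom.id_apply, map_smul, hψ, hψ, Submodule.coe_smul, TensorProduct.map_smul_right,
          LinearMap.smul_apply, map_smul]) }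
  have hΨ : ∀ k τ, H.inclBase (Ψ k τ) = LinearMap.mul' ℂ _
      (TensorProduct.map H.inclTot.toLinearMap τ.1 (F.dual k)) := hψ
  have hmul : ∀ k μ T, Ψ k (H.rightForm α (BT.tmul M T μ)) = (φ k T).unop • μ := by
    intro k μ T
    apply H.inclBase_injective
    rw [hΨ, DiffStarCalculus.smul_def, map_mul, H.inclBase_incl, hφ,
      mul'_map_mulRight (H.inclTot.toLinearMap ∘ₗ Sec.toLin P T) _ _ (H.inclBase μ)
        (fun v => by simp)]
    congr 1
    induction F.dual k with
    | zero => simp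
    | add a b ha hb => simp only [map_add, ha, hb]
    | tmul v b => simp
  refine Function.bijective_iff_has_inverse.2
    ⟨fun τ => ∑ k, BT.tmul M (F.sec k) (Ψ k τ), fun t => ?_, fun τ => ?_⟩
  · change ∑ k, BT.tmul M (F.sec k) (Ψ k (H.rightForm α t)) = t
    induction t using BT.induction with
    | h0 => simp [BT.tmul_zero]
    | hadd x y hx hy => simp only [map_add, BT.tmul_add, Finset.sum_add_distrib, hx, hy]
    | ht T μ =>
      simp only [hmul, ← BT.balanced, op_unop]
      conv_rhs => rw [F.sum_coord hφ T]
      exact (map_sum ((BT.mk M (P.Sec α) _).flip μ) _ _).symm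
  · refine Subtype.ext (LinearMap.ext fun v => ?_)
    rw [map_sum, Submodule.coe_sum, LinearMap.sum_apply]
    simp only [rightForm_tmul, hΨ]
    exact F.expand H.inclTot τ.1 v

/-- Frames on both sides make the associated bundle a quantum vector bundle. -/
theorem associable_of_frames {κ : Type*} [Fintype κ] (F : P.LeftFrame α ι)
    (F' : P.RightFrame α κ) : H.Associable α := by
  choose φ hφ using F.exists_coord
  choose ψ hψ using F'.exists_coord
  have hl := finite_projective_of_dual_basis F.sec φ (F.sum_coord hφ)
  have hr := finite_projective_of_dual_basis F'.sec ψ (F'.sum_coord hψ)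
  exact ⟨hl.1, hl.2, hr.1, hr.2, H.bijective_leftForm F, H.bijective_rightForm F'⟩

end HorizontalCalculus

end frames

/-! ### Products of sections over a tensor product -/

section tensor

variable {G : Type*} [Ring G] [HopfAlgebra ℂ G] [StarRing G] [StarModule ℂ G]
  {M : Type*} [Ring M] [Algebra ℂ M] [StarRing M] [StarModule ℂ M]

namespace QPBundle

variable {P : QPBundle G M} {V W : Type*} [AddCommGroup V] [Module ℂ V] [AddCommGroup W]
  [Module ℂ W] (α : Corep G V) (β : Corep G W)

variable (P) in
/-- The product of sections, `(T ⊗ S)(v ⊗ w) = T(v) S(w)`. -/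
def mulSec : BT M (P.Sec α) (P.Sec β) →ₗ[ℂ] P.Sec (α.tensor β) :=
  BT.lift (LinearMap.mk₂ ℂ (fun T S => Sec.mk P (α.tensor β)
      (LinearMap.mul' ℂ P.tot ∘ₗ TensorProduct.map (Sec.toLin P T) (Sec.toLin P S))
      (Corep.mul'_comp_map_mem_hom0 P.coact_mul T.2 S.2))
    (fun T T' S => Sec.ext fun v => by simp [TensorProduct.map_add_left])
    (fun c T S => Sec.ext fun v => by simp [TensorProduct.map_smul_left])
    (fun T S S' => Sec.ext fun v => by simp [TensorProduct.map_add_right])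
    (fun c T S => Sec.ext fun v => by simp [TensorProduct.map_smul_right]))
    (fun p T S => Sec.ext fun x => by
      simp only [LinearMap.mk₂_apply, Sec.toLin_mk, LinearMap.comp_apply]
      induction x with
      | zero => simp
      | add a b ha hb => simp only [map_add, ha, hb]
      | tmul v w => simp [mul_assoc])

@[simp] theorem mulSec_tmul (T : P.Sec α) (S : P.Sec β) (v : V) (w : W) :
    Sec.toLin P (mulSec P α β (BT.tmul M T S)) (v ⊗ₜ[ℂ] w) =
      Sec.toLin P T v * Sec.toLin P S w := by
  simp [mulSec]

variable {α β} in
theorem Sec.ext_tmul {T S : P.Sec (α.tensor β)}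
    (h : ∀ v w, Sec.toLin P T (v ⊗ₜ[ℂ] w) = Sec.toLin P S (v ⊗ₜ[ℂ] w)) : T = S :=
  Subtype.ext (TensorProduct.ext' h)

theorem mulSec_left (p : M) (t : BT M (P.Sec α) (P.Sec β)) :
    mulSec P α β (p • t) = p • mulSec P α β t := by
  induction t using BT.induction with
  | h0 => simp
  | hadd x y hx hy => simp only [smul_add, map_add, hx, hy]
  | ht T S => exact Sec.ext_tmul fun v w => by simp [BT.act_tmul, mul_assoc]

theorem mulSec_right (p : M) (t : BT M (P.Sec α) (P.Sec β)) :
    mulSec P α β (op p • t) = op p • mulSec P α β t := by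
  induction t using BT.induction with
  | h0 => simp
  | hadd x y hx hy => simp only [smul_add, map_add, hx, hy]
  | ht T S => exact Sec.ext_tmul fun v w => by simp [BT.op_act_tmul, mul_assoc]

variable {α β}

/-- The contraction `v ↦ τ(v ⊗ y⁽¹⁾) y⁽²⁾` of a section over `α ⊗ β` with an invariant element
`y` of `W ⊗ B`. -/
def contract (y : W ⊗[ℂ] P.tot) (hy : (β.tensor P.rep).coact y = y ⊗ₜ[ℂ] (1 : G)) :
    P.Sec (α.tensor β) →ₗ[ℂ] P.Sec α where
  toFun τ := Sec.mk P α ((LinearMap.mul' ℂ P.tot ∘ₗ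
      TensorProduct.map (Sec.toLin P τ) LinearMap.id) ∘ₗ
        (TensorProduct.assoc ℂ V W P.tot).symm.toLinearMap ∘ₗ (TensorProduct.mk ℂ V _).flip y)
    (Corep.comp_mem_hom0 (Corep.mul'_comp_map_mem_hom0 P.coact_mul τ.2 Corep.id_mem_hom0)
      (Corep.comp_mem_hom0 Corep.assoc_symm_mem_hom0 (Corep.flip_mk_mem_hom0 hy)))
  map_add' τ ρ := Sec.ext fun v => by simp [TensorProduct.map_add_left]
  map_smul' c τ := Sec.ext fun v => by simp [TensorProduct.map_smul_left]

/-- For fixed `v` the value of the contraction is the frame coefficient of the linear map `w ↦ τ(v ⊗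
w)`. That map need not be a morphism, but the expansion in a frame holds for all linear maps. -/
theorem contract_apply (y : W ⊗[ℂ] P.tot) (hy : (β.tensor P.rep).coact y = y ⊗ₜ[ℂ] (1 : G))
    (τ : P.Sec (α.tensor β)) (v : V) : Sec.toLin P (contract y hy τ) v =
      LinearMap.mul' ℂ P.tot (TensorProduct.map (Sec.toLin P τ ∘ₗ TensorProduct.mk ℂ V W v)
        (AlgHom.id ℂ P.tot).toLinearMap y) := by
  change LinearMap.mul' ℂ P.tot (TensorProduct.map (Sec.toLin P τ) LinearMap.id
    ((TensorProduct.assoc ℂ V W P.tot).symm (v ⊗ₜ y))) = _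
  -- The identity holds for every `y`, whereas invariance would not pass to the elementary tensors
  -- of the induction.
  clear hy
  induction y with
  | zero => simp
  | add a b ha hb => simp only [TensorProduct.tmul_add, map_add, ha, hb]
  | tmul w b => simp

variable (α) in
-- The inverse expands a section over `α ⊗ β` in the second argument: `τ ↦ ∑ τ_k ⊗ S_k`, where `S_k`
-- are the sections of the frame and `τ_k` is the contraction of `τ` with `y_k`. Only a left frame
-- of `β` is needed. The contraction of `T ⊗ S` is `T φ_k(S)`, so the expansion returns `T ⊗ ∑
-- φ_k(S) S_k = T ⊗ S`.
theorem bijective_mulSec {ι : Type*} [Fintype ι] (F : P.LeftFrame β ι) :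
    Function.Bijective (mulSec P α β) := by
  choose φ hφ using F.exists_coord
  have hmul : ∀ k T S, contract (F.dual k) (F.invariant k) (mulSec P α β (BT.tmul M T S)) =
      op (φ k S) • T := by
    intro k T S
    refine Sec.ext fun v => ?_
    rw [contract_apply, Sec.op_smul_apply, hφ]
    exact mul'_map_mulLeft _ _ _ _ (fun w => by simp) _
  refine Function.bijective_iff_has_inverse.2
    ⟨fun τ => ∑ k, BT.tmul M (contract (F.dual k) (F.invariant k) τ) (F.sec k),
      fun t => ?_, fun τ => ?_⟩
  · change ∑ k, BT.tmul M (contract (F.dual k) (F.invariant k) (mulSec P α β t)) (F.sec k) = t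
    induction t using BT.induction with
    | h0 => simp [BT.zero_tmul]
    | hadd x y hx hy => simp only [map_add, BT.add_tmul, Finset.sum_add_distrib, hx, hy]
    | ht T S =>
      simp only [hmul, BT.balanced]
      conv_rhs => rw [F.sum_coord hφ S]
      exact (map_sum (BT.mk M _ (P.Sec β) T) _ _).symm
  · refine Sec.ext_tmul fun v w => ?_
    rw [map_sum, map_sum, LinearMap.sum_apply]
    simp only [mulSec_tmul, contract_apply]
    exact F.expand (AlgHom.id ℂ P.tot) (Sec.toLin P τ ∘ₗ TensorProduct.mk ℂ V W v) w

variable {V' W' : Type*} [AddCommGroup V'] [Module ℂ V'] [AddCommGroup W']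
  [Module ℂ W'] {α' : Corep G V'} {β' : Corep G W'}

theorem pull_mulSec {f : V →ₗ[ℂ] V'} {g : W →ₗ[ℂ] W'} (hf : f ∈ Corep.Hom0 α α')
    (hg : g ∈ Corep.Hom0 β β') (t : BT M (P.Sec α') (P.Sec β')) :
    Sec.pull P (TensorProduct.map f g) (Corep.map_mem_hom0 hf hg) (mulSec P α' β' t) =
      mulSec P α β (BT.map (Sec.pull P f hf) (Sec.pull P g hg)
        (Sec.pull_right f hf) (Sec.pull_left g hg) t) := by
  induction t using BT.induction with
  | h0 => simp
  | hadd x y hx hy => simp only [map_add, hx, hy]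
  | ht T S => exact Sec.ext_tmul fun v w => by simp

/-- The involution reverses products, `(T(g w) S(f v))* = S(f v)* T(g w)*`, and this reversal
cancels the flip in the twisted tensor product. -/
theorem pullStar_mulSec {f : V →ₛₗ[starRingEnd ℂ] W'} {g : W →ₛₗ[starRingEnd ℂ] V'}
    (hf : f ∈ Corep.Hom1 α β') (hg : g ∈ Corep.Hom1 β α')
    (t : BT M (P.Sec α') (P.Sec β')) :
    Sec.pullStar P (Corep.twist f g) (Corep.twist_mem_hom1 hf hg) (mulSec P α' β' t) =
      mulSec P α β (BT.twist (Sec.pullStar P g hg) (Sec.pullStar P f hf)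
        (Sec.pullStar_right g hg) (Sec.pullStar_left f hf) t) := by
  induction t using BT.induction with
  | h0 => simp
  | hadd x y hx hy => simp only [map_add, hx, hy]
  | ht T S => exact Sec.ext_tmul fun v w => by simp

end QPBundle

end tensor

/-! ### Connections realized in an algebra with a derivation -/

namespace QVB

variable {M : Type*} [Ring M] [Algebra ℂ M] [StarRing M] [StarModule ℂ M]
  {C : DiffStarCalculus M} {X : Type*} [Ring X] [Algebra ℂ X]

theorem σId_tmul (E F : QVB C) (t : BT M C.carrier E.Γ) (y : F.Γ) :
    σId E F (BT.tmul M t y) = BT.tmul M (E.σ t) y := BT.congr_tmul _ _ _ _ _ _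

theorem idσ_tmul (E F : QVB C) (x : E.Γ) (t : BT M C.carrier F.Γ) :
    idσ E F (BT.tmul M x t) = BT.tmul M x (F.σ t) := BT.congr_tmul _ _ _ _ _ _

/-- A realization of a bundle with a connection by functions on `V` with values in an algebra `X`
with a derivation `D` that contains the forms on the base. -/
structure Realization (ι : C.carrier →ₗ[ℂ] X) (D : X →ₗ[ℂ] X) (E : QVB C)
    (V : Type*) [AddCommGroup V] [Module ℂ V] where
  ev : E.Γ →ₗ[ℂ] V →ₗ[ℂ] X
  formL : BT M C.carrier E.Γ →ₗ[ℂ] V →ₗ[ℂ] X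
  formR : BT M E.Γ C.carrier →ₗ[ℂ] V →ₗ[ℂ] X
  formL_tmul : ∀ μ T v, formL (BT.tmul M μ T) v = ι μ * ev T v
  formR_tmul : ∀ T μ v, formR (BT.tmul M T μ) v = ev T v * ι μ
  formL_injective : Function.Injective formL
  formR_injective : Function.Injective formR
  formR_σ : ∀ t, formR (E.σ t) = formL t
  formL_nabla : ∀ T v, formL (E.nabla T) v = D (ev T v)

namespace Realization

variable {ι : C.carrier →ₗ[ℂ] X} {D : X →ₗ[ℂ] X} {E F K : QVB C}
  {V W : Type*} [AddCommGroup V] [Module ℂ V] [AddCommGroup W] [Module ℂ W]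
  (RE : Realization ι D E V) (RF : Realization ι D F W) (RK : Realization ι D K (V ⊗[ℂ] W))
  {m : BT M E.Γ F.Γ →ₗ[ℂ] K.Γ} (hl : ∀ (p : M) t, m (p • t) = p • m t)
  (hr : ∀ (p : M) t, m (op p • t) = op p • m t)

/-- On elementary tensors both sides are the triple product `μ T(v) S(w)` with different
bracketings. -/
theorem formL_map_assoc
    (hm : ∀ T S v w, RK.ev (m (BT.tmul M T S)) (v ⊗ₜ[ℂ] w) = RE.ev T v * RF.ev S w)
    (t : BT M C.carrier E.Γ) (S : F.Γ) (v : V) (w : W) :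
    RK.formL (BT.map LinearMap.id m (fun _ _ => rfl) hl
      (BT.assoc M C.carrier E.Γ F.Γ (BT.tmul M t S))) (v ⊗ₜ[ℂ] w) =
      RE.formL t v * RF.ev S w := by
  induction t using BT.induction with
  | h0 => simp [BT.zero_tmul]
  | hadd x y hx hy => simp only [BT.add_tmul, map_add, LinearMap.add_apply, hx, hy, add_mul]
  | ht μ T => simp [RK.formL_tmul, RE.formL_tmul, hm, mul_assoc]

theorem formR_map_assoc_symm
    (hm : ∀ T S v w, RK.ev (m (BT.tmul M T S)) (v ⊗ₜ[ℂ] w) = RE.ev T v * RF.ev S w)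
    (T : E.Γ) (t : BT M F.Γ C.carrier) (v : V) (w : W) :
    RK.formR (BT.map m LinearMap.id hr (fun _ _ => rfl)
      ((BT.assoc M E.Γ F.Γ C.carrier).symm (BT.tmul M T t))) (v ⊗ₜ[ℂ] w) =
      RE.ev T v * RF.formR t w := by
  induction t using BT.induction with
  | h0 => simp [BT.tmul_zero]
  | hadd x y hx hy => simp only [BT.tmul_add, map_add, LinearMap.add_apply, hx, hy, mul_add]
  | ht S μ => simp [RK.formR_tmul, RF.formR_tmul, hm, mul_assoc]

/-- Moving a form to the left by `σ⁻¹` only rewrites `T μ` as a sum of products `μ' T'`, so the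
realized product does not change. -/
theorem formL_map_moveForm
    (hm : ∀ T S v w, RK.ev (m (BT.tmul M T S)) (v ⊗ₜ[ℂ] w) = RE.ev T v * RF.ev S w)
    (T : E.Γ) (t : BT M C.carrier F.Γ) (v : V) (w : W) :
    RK.formL (BT.map LinearMap.id m (fun _ _ => rfl) hl (moveForm E F (BT.tmul M T t)))
      (v ⊗ₜ[ℂ] w) = RE.ev T v * RF.formL t w := by
  induction t using BT.induction with
  | h0 => simp [BT.tmul_zero]
  | hadd x y hx hy => simp only [BT.tmul_add, map_add, LinearMap.add_apply, hx, hy, mul_add]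
  | ht μ S =>
    rw [moveForm_tmul, formL_map_assoc RE RF RK hl hm, ← RE.formR_σ, LinearEquiv.apply_symm_apply,
      RE.formR_tmul, RF.formL_tmul, mul_assoc]

/-- The counterpart for the second bundle: after a form has been moved past `T`, moving it past `S`
by `σ` preserves the realized product. -/
theorem formR_map_idσ
    (hm : ∀ T S v w, RK.ev (m (BT.tmul M T S)) (v ⊗ₜ[ℂ] w) = RE.ev T v * RF.ev S w)
    (s : BT M E.Γ C.carrier) (S : F.Γ) (v : V) (w : W) :
    RK.formR (BT.map m LinearMap.id hr (fun _ _ => rfl) ((BT.assoc M E.Γ F.Γ C.carrier).symm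
      (idσ E F (BT.assoc M E.Γ C.carrier F.Γ (BT.tmul M s S))))) (v ⊗ₜ[ℂ] w) =
      RE.formR s v * RF.ev S w := by
  induction s using BT.induction with
  | h0 => simp [BT.zero_tmul]
  | hadd x y hx hy => simp only [BT.add_tmul, map_add, LinearMap.add_apply, hx, hy, add_mul]
  | ht T μ =>
    rw [BT.assoc_tmul, idσ_tmul,
      formR_map_assoc_symm RE RF RK hr hm, RF.formR_σ, RF.formL_tmul, RE.formR_tmul, mul_assoc]

/-- Each of the two factors of `σTensor` leaves the triple product in `X` unchanged, and therefore
so does their composite. -/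
theorem formR_map_σTensor
    (hm : ∀ T S v w, RK.ev (m (BT.tmul M T S)) (v ⊗ₜ[ℂ] w) = RE.ev T v * RF.ev S w)
    (t : BT M C.carrier (BT M E.Γ F.Γ)) :
    RK.formR (BT.map m LinearMap.id hr (fun _ _ => rfl) (σTensor E F t)) =
      RK.formL (BT.map LinearMap.id m (fun _ _ => rfl) hl t) := by
  -- Rebracketing to `(Ω ⊗ E) ⊗ F` makes elementary tensors start with an element on which `E.σ`
  -- acts directly.
  obtain ⟨t, rfl⟩ := (BT.assoc M C.carrier E.Γ F.Γ).surjective t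
  induction t using BT.induction with
  | h0 => simp
  | hadd x y hx hy => simp only [map_add, hx, hy]
  | ht s S =>
    refine TensorProduct.ext' fun v w => ?_
    rw [formL_map_assoc RE RF RK hl hm, σTensor]
    simp only [LinearEquiv.trans_apply, LinearEquiv.symm_apply_apply]
    rw [σId_tmul, formR_map_idσ RE RF RK hr hm, RE.formR_σ]

/-- After realization this is the Leibniz rule `hD`; the second term of `nablaTensor` becomes `T(v)
D(S(w))` because `moveForm` preserves products. -/
theorem nabla_map
    (hm : ∀ T S v w, RK.ev (m (BT.tmul M T S)) (v ⊗ₜ[ℂ] w) = RE.ev T v * RF.ev S w)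
    (hD : ∀ T S v w, D (RE.ev T v * RF.ev S w) =
      D (RE.ev T v) * RF.ev S w + RE.ev T v * D (RF.ev S w)) (t : BT M E.Γ F.Γ) :
    K.nabla (m t) = BT.map LinearMap.id m (fun _ _ => rfl) hl (nablaTensor E F t) := by
  induction t using BT.induction with
  | h0 => simp
  | hadd x y hx hy => simp only [map_add, hx, hy]
  | ht T S =>
    refine RK.formL_injective (TensorProduct.ext' fun v w => ?_)
    rw [RK.formL_nabla, hm, hD, nablaTensor_tmul, map_add, map_add, LinearMap.add_apply,
      formL_map_assoc RE RF RK hl hm, formL_map_moveForm RE RF RK hl hm, RE.formL_nabla,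
      RF.formL_nabla]

end Realization

/-- An invertible bimodule map that is multiplicative in realizations is a parallel
isomorphism. -/
def Realization.parallelIso {ι : C.carrier →ₗ[ℂ] X} {D : X →ₗ[ℂ] X} {E F K : QVB C}
    {V W : Type*} [AddCommGroup V] [Module ℂ V] [AddCommGroup W] [Module ℂ W]
    (RE : Realization ι D E V) (RF : Realization ι D F W) (RK : Realization ι D K (V ⊗[ℂ] W))
    (m : BT M E.Γ F.Γ ≃ₗ[ℂ] K.Γ) (hl : ∀ (p : M) t, m (p • t) = p • m t)
    (hr : ∀ (p : M) t, m (op p • t) = op p • m t)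
    (hm : ∀ T S v w, RK.ev (m (BT.tmul M T S)) (v ⊗ₜ[ℂ] w) = RE.ev T v * RF.ev S w)
    (hD : ∀ T S v w, D (RE.ev T v * RF.ev S w) =
      D (RE.ev T v) * RF.ev S w + RE.ev T v * D (RF.ev S w)) :
    ParallelIso K (E.tensor F) :=
  have hl' : ∀ (p : M) x, m.symm (p • x) = p • m.symm x :=
    fun p x => m.injective (by simp [hl])
  have hr' : ∀ (p : M) x, m.symm (op p • x) = op p • m.symm x :=
    fun p x => m.injective (by simp [hr])
  -- The identities have been shown for `m`, but the isomorphism is `m.symm`. The maps induced on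
  -- tensors with forms are inverse to each other, which allows passing to `m.symm`.
  have hcl : ∀ t, BT.map LinearMap.id m.symm.toLinearMap (fun _ _ => rfl) hl'
      (BT.map LinearMap.id m.toLinearMap (fun _ _ => rfl) hl t) = (t : BT M C.carrier _) := by
    intro t
    induction t using BT.induction with
    | h0 => simp
    | hadd x y hx hy => simp only [map_add, hx, hy]
    | ht μ x => simp
  have hcl' : ∀ t, BT.map LinearMap.id m.toLinearMap (fun _ _ => rfl) hl
      (BT.map LinearMap.id m.symm.toLinearMap (fun _ _ => rfl) hl' t) = (t : BT M C.carrier _) := by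
    intro t
    induction t using BT.induction with
    | h0 => simp
    | hadd x y hx hy => simp only [map_add, hx, hy]
    | ht μ x => simp
  have hcr : ∀ t, BT.map m.symm.toLinearMap LinearMap.id hr' (fun _ _ => rfl)
      (BT.map m.toLinearMap LinearMap.id hr (fun _ _ => rfl) t) = (t : BT M _ C.carrier) := by
    intro t
    induction t using BT.induction with
    | h0 => simp
    | hadd x y hx hy => simp only [map_add, hx, hy]
    | ht x μ => simp
  have hpar : ∀ x, BT.map LinearMap.id m.symm.toLinearMap (fun _ _ => rfl) hl' (K.nabla x) =
      nablaTensor E F (m.symm x) := by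
    intro x
    obtain ⟨t, rfl⟩ := m.surjective x
    rw [m.symm_apply_apply, ← hcl (nablaTensor E F t)]
    exact congrArg _ (Realization.nabla_map RE RF RK hl hm hD t)
  have hint : ∀ t, BT.map m.symm.toLinearMap LinearMap.id hr' (fun _ _ => rfl) (K.σ t) =
      σTensor E F (BT.map LinearMap.id m.symm.toLinearMap (fun _ _ => rfl) hl' t) := by
    intro t
    rw [← hcr (σTensor E F _)]
    refine congrArg _ (RK.formR_injective ?_)
    rw [RK.formR_σ, Realization.formR_map_σTensor RE RF RK hl hr hm, hcl']
  { equiv := m.symm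
    left := hl'
    right := hr'
    parallel := hpar
    intertwines := hint }

end QVB

/-! ### The parallel isomorphism of associated bundles -/

section iso

variable {G : Type*} [Ring G] [HopfAlgebra ℂ G] [StarRing G] [StarModule ℂ G]
  {M : Type*} [Ring M] [Algebra ℂ M] [StarRing M] [StarModule ℂ M]

namespace HorizontalCalculus

open QPBundle

variable {P : QPBundle G M} {H : HorizontalCalculus P} {V W : Type*} [AddCommGroup V] [Module ℂ V]
  [AddCommGroup W] [Module ℂ W] {α : Corep G V} {β : Corep G W}

/-- Associated bundles are realized by horizontal forms. -/
def realization (Δ : H.CovDer) (h : H.Associable α) :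
    QVB.Realization H.inclBase.toLinearMap Δ.D (assocBundle Δ h) V where
  ev := (LinearMap.compRight ℂ H.inclTot.toLinearMap) ∘ₗ Sec.toLin P
  formL := (Corep.Hom0 α H.rep).subtype ∘ₗ H.leftForm α
  formR := (Corep.Hom0 α H.rep).subtype ∘ₗ H.rightForm α
  formL_tmul := H.leftForm_tmul α
  formR_tmul T μ v := H.rightForm_tmul α μ T v
  formL_injective := Subtype.val_injective.comp h.bijectiveL.1
  formR_injective := Subtype.val_injective.comp h.bijectiveR.1
  formR_σ t := congrArg Subtype.val (rightForm_assocσ h t)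
  formL_nabla T v := by
    change (H.leftForm α (upsL h (Δ.comp α T))).1 v = _
    rw [leftForm_upsL]
    rfl

/-- The product of sections as an isomorphism of the bundles with connections. -/
def mulSecIso (Δ : H.CovDer) (hα : H.Associable α) (hβ : H.Associable β)
    (h : H.Associable (α.tensor β)) (hb : Function.Bijective (mulSec P α β)) :
    QVB.ParallelIso (assocBundle Δ h) ((assocBundle Δ hα).tensor (assocBundle Δ hβ)) :=
  QVB.Realization.parallelIso (realization Δ hα) (realization Δ hβ) (realization Δ h)
    (LinearEquiv.ofBijective (mulSec P α β) hb) (mulSec_left α β) (mulSec_right α β)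
    (fun T S v w => (congrArg H.inclTot (mulSec_tmul α β T S v w)).trans (map_mul _ _ _))
    (fun T S v w => by
      -- Values of sections have degree `0`, so the graded Leibniz rule carries no sign.
      have := Δ.D_mul 0 _ (H.inclTot_mem (Sec.toLin P T v)) (H.inclTot (Sec.toLin P S w))
      rwa [pow_zero, one_smul] at this)

end HorizontalCalculus

end iso

/-! ### Matrix coefficients, the counit and the antipode -/

section coefficients

variable {G : Type*} [Ring G] [HopfAlgebra ℂ G]

/-- A square matrix over `G` with the comultiplication and counit of matrix coefficients. -/
structure IsMatrixCorep {n : ℕ} (u : Matrix (Fin n) (Fin n) G) : Prop where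
  comul : ∀ i j, Coalgebra.comul (R := ℂ) (u i j) = ∑ k, u i k ⊗ₜ[ℂ] u k j
  counit : ∀ i j, Coalgebra.counit (R := ℂ) (u i j) = if i = j then 1 else 0

/-- Uniqueness of the counit. As the comultiplication preserves `*`, the conjugated functional
`ε'(g) = conj ε(g*)` is a right counit, and evaluating `ε ⊗ ε'` on a comultiplication in two ways
identifies it with `ε`. -/
theorem counit_star [StarRing G] [StarModule ℂ G] [CQGAlgebra G] (a : G) :
    Coalgebra.counit (R := ℂ) (star a) = star (Coalgebra.counit (R := ℂ) a) := by
  let ε : G →ₗ[ℂ] ℂ := Coalgebra.counit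
  let ε' : G →ₗ[ℂ] ℂ :=
    { toFun := fun g => star (ε (star g))
      map_add' := fun x y => by simp
      map_smul' := fun c x => by simp }
  have h1 : ∀ x : G ⊗[ℂ] G, TensorProduct.rid ℂ G (LinearMap.lTensor G ε' x) =
      star (TensorProduct.rid ℂ G (LinearMap.lTensor G ε (star x))) := by
    intro x
    induction x with
    | zero => simp
    | add a b ha hb => simp only [map_add, star_add, ha, hb]
    | tmul a b => simp [ε']
  have h2 : ∀ x : G ⊗[ℂ] G, ε (TensorProduct.rid ℂ G (LinearMap.lTensor G ε' x)) =
      ε' (TensorProduct.lid ℂ G (LinearMap.rTensor G ε x)) := by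
    intro x
    induction x with
    | zero => simp
    | add a b ha hb => simp only [map_add, ha, hb]
    | tmul a b => simp [mul_comm]
  have h3 := h2 (Coalgebra.comul (R := ℂ) (star a))
  rw [h1, ← CQGAlgebra.comul_star, star_star] at h3
  simp only [ε, Coalgebra.lTensor_counit_comul, Coalgebra.rTensor_counit_comul] at h3
  simpa [ε', ε] using h3

namespace IsMatrixCorep

variable {n : ℕ} {u : Matrix (Fin n) (Fin n) G}

theorem mul_antipode (hu : IsMatrixCorep u) : u * u.map (HopfAlgebra.antipode ℂ) = 1 := by
  ext i j
  have h := HopfAlgebra.mul_antipode_lTensor_comul_apply (R := ℂ) (u i j)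
  rw [hu.comul, hu.counit] at h
  simp only [map_sum, LinearMap.lTensor_tmul, LinearMap.mul'_apply] at h
  rw [Matrix.mul_apply, Matrix.one_apply]
  refine h.trans ?_
  split_ifs <;> simp

/-- Over a noncommutative ring a left inverse of a square matrix need not be a right inverse. Here
the antipode gives a right inverse of `u`, which must coincide with `v`. -/
theorem mul_eq_one_comm {v : Matrix (Fin n) (Fin n) G} (hu : IsMatrixCorep u) (h : v * u = 1) :
    u * v = 1 := by
  rw [left_inv_eq_right_inv h hu.mul_antipode, hu.mul_antipode]

theorem map_star [StarRing G] [StarModule ℂ G] [CQGAlgebra G] (hu : IsMatrixCorep u) :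
    IsMatrixCorep (u.map star) where
  comul i j := by simp [CQGAlgebra.comul_star, hu.comul]
  counit i j := by
    rw [Matrix.map_apply, counit_star, hu.counit]
    split_ifs <;> simp

end IsMatrixCorep

namespace Corep

/-- If the `a_i` transform by `u` and the `b_i` by `c`, the coaction sends `∑ a_i ⊗ b_i` to `∑ (a_j
⊗ b_l) ⊗ (u cᵀ)_{jl}`. So for `u cᵀ = 1` the element is invariant, which is how the dual elements of
frames are obtained. -/
theorem sum_mulT_of_mul_transpose_eq_one {V W : Type*} [AddCommGroup V] [Module ℂ V]
    [AddCommGroup W] [Module ℂ W] {n : ℕ} (a : Fin n → V) (b : Fin n → W)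
    {u c : Matrix (Fin n) (Fin n) G} (h : u * c.transpose = 1) :
    ∑ i, mulT G V W ((∑ j, a j ⊗ₜ[ℂ] u j i) ⊗ₜ[ℂ] (∑ l, b l ⊗ₜ[ℂ] c l i)) =
      ∑ j, (a j ⊗ₜ[ℂ] b j) ⊗ₜ[ℂ] (1 : G) := by
  have h1 : ∀ i, mulT G V W ((∑ j, a j ⊗ₜ[ℂ] u j i) ⊗ₜ[ℂ] (∑ l, b l ⊗ₜ[ℂ] c l i)) =
      ∑ j, ∑ l, (a j ⊗ₜ[ℂ] b l) ⊗ₜ[ℂ] (u j i * c.transpose i l) := fun i => by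
    rw [TensorProduct.sum_tmul, map_sum]
    refine Finset.sum_congr rfl fun j _ => ?_
    rw [TensorProduct.tmul_sum, map_sum]
    exact Finset.sum_congr rfl fun l _ => mulT_tmul _ _ _ _ _ _ _
  simp only [h1]
  rw [Finset.sum_comm]
  refine Finset.sum_congr rfl fun j _ => ?_
  rw [Finset.sum_comm]
  have h2 : ∀ l, ∑ i, (a j ⊗ₜ[ℂ] b l) ⊗ₜ[ℂ] (u j i * c.transpose i l) =
      (a j ⊗ₜ[ℂ] b l) ⊗ₜ[ℂ] (1 : Matrix (Fin n) (Fin n) G) j l := fun l => by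
    rw [← TensorProduct.tmul_sum, ← h, Matrix.mul_apply]
  simp only [h2]
  rw [Finset.sum_eq_single j (fun l _ hl => by simp [hl.symm]) (by simp)]
  simp

variable {V : Type*} [AddCommGroup V] [Module ℂ V] (α : Corep G V)

/-- The matrix coefficient `v ↦ φ(v⁽⁰⁾) v⁽¹⁾` of a functional `φ`. -/
def coeff (φ : V →ₗ[ℂ] ℂ) : V →ₗ[ℂ] G :=
  (TensorProduct.lid ℂ G).toLinearMap ∘ₗ LinearMap.rTensor G φ ∘ₗ α.coact

theorem coeff_apply (φ : V →ₗ[ℂ] ℂ) (v : V) :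
    α.coeff φ v = TensorProduct.lid ℂ G (LinearMap.rTensor G φ (α.coact v)) := rfl

theorem counit_coeff (φ : V →ₗ[ℂ] ℂ) (v : V) :
    Coalgebra.counit (R := ℂ) (α.coeff φ v) = φ v := by
  conv_rhs => rw [← α.counit_coact v]
  rw [coeff_apply]
  generalize α.coact v = s
  induction s with
  | zero => simp
  | add a b ha hb => simp only [map_add, ha, hb]
  | tmul v g => simp [mul_comm]

/-- This is coassociativity with `φ` applied to the `V` leg. It makes coefficient maps morphisms
into the regular corepresentation. -/
theorem comul_coeff (φ : V →ₗ[ℂ] ℂ) (v : V) :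
    Coalgebra.comul (R := ℂ) (α.coeff φ v) =
      LinearMap.rTensor G (α.coeff φ) (α.coact v) := by
  have h := congrArg (fun z => TensorProduct.lid ℂ (G ⊗[ℂ] G) (LinearMap.rTensor (G ⊗[ℂ] G) φ z))
    (α.coassoc v)
  have h1 : ∀ s : V ⊗[ℂ] G, TensorProduct.lid ℂ (G ⊗[ℂ] G) (LinearMap.rTensor (G ⊗[ℂ] G) φ
      (LinearMap.lTensor V (Coalgebra.comul (R := ℂ) (A := G)) s)) =
      Coalgebra.comul (R := ℂ) (TensorProduct.lid ℂ G (LinearMap.rTensor G φ s)) := by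
    intro s
    induction s with
    | zero => simp
    | add a b ha hb => simp only [map_add, ha, hb]
    | tmul v g => simp
  have h2 : ∀ (s : V ⊗[ℂ] G) (g : G), TensorProduct.lid ℂ (G ⊗[ℂ] G)
      (LinearMap.rTensor (G ⊗[ℂ] G) φ (TensorProduct.assoc ℂ V G G (s ⊗ₜ g))) =
      TensorProduct.lid ℂ G (LinearMap.rTensor G φ s) ⊗ₜ g := by
    intro s g
    induction s with
    | zero => simp
    | add a b ha hb => simp only [TensorProduct.add_tmul, map_add, ha, hb]
    | tmul v g => simp [TensorProduct.smul_tmul']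
  have h3 : ∀ s : V ⊗[ℂ] G, TensorProduct.lid ℂ (G ⊗[ℂ] G) (LinearMap.rTensor (G ⊗[ℂ] G) φ
      (TensorProduct.assoc ℂ V G G (LinearMap.rTensor G α.coact s))) =
      LinearMap.rTensor G (α.coeff φ) s := by
    intro s
    induction s with
    | zero => simp
    | add a b ha hb => simp only [map_add, ha, hb]
    | tmul v g => rw [LinearMap.rTensor_tmul, h2, LinearMap.rTensor_tmul, coeff_apply]
  rw [h1, h3] at h
  exact h.symm

/-- The matrix of a corepresentation in a basis. -/
def matrix {n : ℕ} (e : Module.Basis (Fin n) ℂ V) : Matrix (Fin n) (Fin n) G :=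
  fun i j => α.coeff (e.coord i) (e j)

theorem coact_eq_sum_coeff {n : ℕ} (e : Module.Basis (Fin n) ℂ V) (v : V) :
    α.coact v = ∑ i, e i ⊗ₜ[ℂ] α.coeff (e.coord i) v := by
  simp only [coeff_apply]
  induction α.coact v with
  | zero => simp
  | add a b ha hb =>
    simp only [map_add, TensorProduct.tmul_add, Finset.sum_add_distrib]
    rw [← ha, ← hb]
  | tmul v g =>
    conv_lhs => rw [← e.sum_repr v, TensorProduct.sum_tmul]
    simp [TensorProduct.smul_tmul']

theorem coact_basis {n : ℕ} (e : Module.Basis (Fin n) ℂ V) (j : Fin n) :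
    α.coact (e j) = ∑ i, e i ⊗ₜ[ℂ] α.matrix e i j := α.coact_eq_sum_coeff e (e j)

theorem isMatrixCorep_matrix {n : ℕ} (e : Module.Basis (Fin n) ℂ V) :
    IsMatrixCorep (α.matrix e) where
  comul i j := by
    rw [matrix, comul_coeff, coact_basis, map_sum]
    rfl
  counit i j := by
    rw [matrix, counit_coeff]
    simp [Finsupp.single_apply, eq_comm]

end Corep

end coefficients

/-! ### Frames of direct sums and frames from generators -/

namespace QPBundle

variable {G : Type*} [Ring G] [HopfAlgebra ℂ G] [StarRing G] [StarModule ℂ G]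
  {M : Type*} [Ring M] [Algebra ℂ M] [StarRing M] [StarModule ℂ M]
  {P : QPBundle G M} {V : Type*} [AddCommGroup V] [Module ℂ V] {α : Corep G V}

section transport

variable {κ : Type*} [Fintype κ] {V' : κ → Type*} [∀ i, AddCommGroup (V' i)]
  [∀ i, Module ℂ (V' i)] {α' : ∀ i, Corep G (V' i)} {d : κ → Type*} [∀ i, Fintype (d i)]
  (ι : ∀ i, V' i →ₗ[ℂ] V) (π : ∀ i, V →ₗ[ℂ] V' i) (hι : ∀ i, ι i ∈ Corep.Hom0 (α' i) α)
  (hπ : ∀ i, π i ∈ Corep.Hom0 α (α' i)) (hsum : ∀ v, ∑ i, ι i (π i v) = v)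

/-- The left frame of a direct sum. -/
def LeftFrame.sum (F : ∀ i, P.LeftFrame (α' i) (d i)) : P.LeftFrame α (Σ i, d i) where
  sec k := Sec.pull P (π k.1) (hπ k.1) ((F k.1).sec k.2)
  dual k := TensorProduct.map (ι k.1) LinearMap.id ((F k.1).dual k.2)
  invariant k := Corep.coact_map_of_invariant (Corep.map_mem_hom0 (hι k.1) Corep.id_mem_hom0)
    ((F k.1).invariant k.2)
  sum_dual v := by
    -- The factor from the total space and `ι i` act on different legs, so the frame identities of
    -- the summands at `π i v` add up to `∑ ι_i π_i v ⊗ 1`.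
    have key : ∀ i (b : P.tot) (y : V' i ⊗[ℂ] P.tot),
        LinearMap.lTensor V (LinearMap.mulRight ℂ b) (TensorProduct.map (ι i) LinearMap.id y) =
        TensorProduct.map (ι i) LinearMap.id (LinearMap.lTensor _ (LinearMap.mulRight ℂ b) y) := by
      intro i b y
      induction y with
      | zero => simp
      | add a b ha hb => simp only [map_add, ha, hb]
      | tmul v x => simp
    rw [Fintype.sum_sigma]
    simp only [Sec.pull_apply, key, ← map_sum, (F _).sum_dual, TensorProduct.map_tmul,
      LinearMap.id_apply, ← TensorProduct.sum_tmul, hsum]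

/-- The right frame of a direct sum. -/
def RightFrame.sum (F : ∀ i, P.RightFrame (α' i) (d i)) : P.RightFrame α (Σ i, d i) where
  sec k := Sec.pull P (π k.1) (hπ k.1) ((F k.1).sec k.2)
  dual k := TensorProduct.map LinearMap.id (ι k.1) ((F k.1).dual k.2)
  invariant k := Corep.coact_map_of_invariant (Corep.map_mem_hom0 Corep.id_mem_hom0 (hι k.1))
    ((F k.1).invariant k.2)
  sum_dual v := by
    have key : ∀ i (b : P.tot) (y : P.tot ⊗[ℂ] V' i),
        LinearMap.rTensor V (LinearMap.mulLeft ℂ b) (TensorProduct.map LinearMap.id (ι i) y) =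
        TensorProduct.map LinearMap.id (ι i) (LinearMap.rTensor _ (LinearMap.mulLeft ℂ b) y) := by
      intro i b y
      induction y with
      | zero => simp
      | add a b ha hb => simp only [map_add, ha, hb]
      | tmul v x => simp
    rw [Fintype.sum_sigma]
    simp only [Sec.pull_apply, key, ← map_sum, (F _).sum_dual, TensorProduct.map_tmul,
      LinearMap.id_apply, ← TensorProduct.tmul_sum, hsum]

end transport

section generators

variable {n : ℕ} (e : Module.Basis (Fin n) ℂ V)

theorem coact_sec_basis (T : P.Sec α) (i : Fin n) : P.rep.coact (Sec.toLin P T (e i)) =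
    ∑ l, Sec.toLin P T (e l) ⊗ₜ[ℂ] α.matrix e l i := by
  rw [Sec.coact, α.coact_basis e, map_sum]
  rfl

theorem coact_star_sec_basis (T : P.Sec α) (i : Fin n) :
    P.rep.coact (star (Sec.toLin P T (e i))) =
      ∑ l, star (Sec.toLin P T (e l)) ⊗ₜ[ℂ] star (α.matrix e l i) := by
  rw [P.coact_star, coact_sec_basis, star_sum]
  simp

/-- Allows identities in `G` to be read off from identities in `B ⊗ G`; this is where the total
space must be nonzero. -/
theorem one_tmul_injective [Nontrivial P.tot] {g h : G}
    (hgh : (1 : P.tot) ⊗ₜ[ℂ] g = (1 : P.tot) ⊗ₜ[ℂ] h) : g = h :=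
  Algebra.TensorProduct.includeRight_injective (R := ℂ) (A := P.tot)
    (FaithfulSMul.algebraMap_injective ℂ P.tot) hgh

variable {e} {κ : Type*} [Fintype κ]

/-- Apply the coaction to `∑_k x_{ki}* x_{kj} = δ_{ij}`. On the left the relation can be used once
more in the first leg, leaving `1 ⊗ (u* u)_{ij}`. -/
theorem conjTranspose_mul_matrix [Nontrivial P.tot] (T : κ → P.Sec α)
    (hT : ∀ i j, ∑ k, star (Sec.toLin P (T k) (e i)) * Sec.toLin P (T k) (e j) =
      if i = j then 1 else 0) : (α.matrix e).conjTranspose * α.matrix e = 1 := by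
  ext i j
  apply one_tmul_injective (P := P)
  have h := congrArg P.rep.coact (hT i j)
  simp only [map_sum, P.coact_mul, coact_sec_basis e, coact_star_sec_basis e, Finset.sum_mul_sum,
    Algebra.TensorProduct.tmul_mul_tmul] at h
  rw [Finset.sum_comm] at h
  have h' : ∀ l, ∑ k, ∑ m, (star (Sec.toLin P (T k) (e l)) * Sec.toLin P (T k) (e m)) ⊗ₜ[ℂ]
      (star (α.matrix e l i) * α.matrix e m j) =
      (1 : P.tot) ⊗ₜ[ℂ] (star (α.matrix e l i) * α.matrix e l j) := by
    intro l
    rw [Finset.sum_comm]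
    simp only [← TensorProduct.sum_tmul, hT]
    rw [Finset.sum_eq_single l (fun m _ hm => by simp [hm.symm]) (by simp)]
    simp
  simp only [h', ← TensorProduct.tmul_sum] at h
  rw [Matrix.mul_apply, Matrix.one_apply]
  refine h.trans ?_
  split_ifs <;> simp [P.coact_one, Algebra.TensorProduct.one_def]

/-- The same computation with the adjoint on the second factor. The sections `S_k` and `T_k` have
the same transformation matrix, so they need not be equal. -/
theorem transpose_mul_map_star_matrix [Nontrivial P.tot] (T S : κ → P.Sec α)
    (hT : ∀ i j, ∑ k, Sec.toLin P (S k) (e i) * star (Sec.toLin P (T k) (e j)) =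
      if i = j then 1 else 0) : (α.matrix e).transpose * (α.matrix e).map star = 1 := by
  ext i j
  apply one_tmul_injective (P := P)
  have h := congrArg P.rep.coact (hT i j)
  simp only [map_sum, P.coact_mul, coact_sec_basis e, coact_star_sec_basis e, Finset.sum_mul_sum,
    Algebra.TensorProduct.tmul_mul_tmul] at h
  rw [Finset.sum_comm] at h
  have h' : ∀ l, ∑ k, ∑ m, (Sec.toLin P (S k) (e l) * star (Sec.toLin P (T k) (e m))) ⊗ₜ[ℂ]
      (α.matrix e l i * star (α.matrix e m j)) =
      (1 : P.tot) ⊗ₜ[ℂ] (α.matrix e l i * star (α.matrix e l j)) := by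
    intro l
    rw [Finset.sum_comm]
    simp only [← TensorProduct.sum_tmul, hT]
    rw [Finset.sum_eq_single l (fun m _ hm => by simp [hm.symm]) (by simp)]
    simp
  simp only [h', ← TensorProduct.tmul_sum] at h
  rw [Matrix.mul_apply, Matrix.one_apply]
  refine h.trans ?_
  split_ifs <;> simp [P.coact_one, Algebra.TensorProduct.one_def]

/-- The left frame of generators with `∑ T_k(e_i)* T_k(e_j) = δ_ij`. -/
def LeftFrame.ofGenerators [Nontrivial P.tot] (e : Module.Basis (Fin n) ℂ V) (T : κ → P.Sec α)
    (hT : ∀ i j, ∑ k, star (Sec.toLin P (T k) (e i)) * Sec.toLin P (T k) (e j) =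
      if i = j then 1 else 0) : P.LeftFrame α κ where
  sec := T
  dual k := ∑ i, e i ⊗ₜ[ℂ] star (Sec.toLin P (T k) (e i))
  invariant k := by
    -- Invariance of the dual elements requires `u u* = 1`, while orthogonality yields `u* u = 1`.
    have hu := (α.isMatrixCorep_matrix e).mul_eq_one_comm (conjTranspose_mul_matrix T hT)
    simp only [map_sum, Corep.tensor_coact_tmul, α.coact_basis e, coact_star_sec_basis e]
    rw [TensorProduct.sum_tmul]
    exact Corep.sum_mulT_of_mul_transpose_eq_one (c := (α.matrix e).map star) _ _ hu
  sum_dual v := by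
    have h : ∀ v ∈ Submodule.span ℂ (Set.range e), ∑ k, LinearMap.lTensor V
        (LinearMap.mulRight ℂ (Sec.toLin P (T k) v))
        (∑ i, e i ⊗ₜ[ℂ] star (Sec.toLin P (T k) (e i))) = v ⊗ₜ[ℂ] (1 : P.tot) := by
      intro v hv
      induction hv using Submodule.span_induction with
      | mem v hv =>
        obtain ⟨j, rfl⟩ := hv
        simp only [map_sum, LinearMap.lTensor_tmul, LinearMap.mulRight_apply]
        rw [Finset.sum_comm]
        simp only [← TensorProduct.tmul_sum, hT]
        rw [Finset.sum_eq_single j (fun l _ hl => by simp [hl]) (by simp)]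
        simp
      | zero => simp
      | add a b _ _ ha hb =>
        rw [TensorProduct.add_tmul, ← ha, ← hb, ← Finset.sum_add_distrib]
        simp [mul_add, TensorProduct.tmul_add, Finset.sum_add_distrib]
      | smul c a _ ha =>
        rw [← TensorProduct.smul_tmul', ← ha, Finset.smul_sum]
        simp [Finset.smul_sum]
    exact h v (by rw [e.span_eq]; trivial)

/-- The right frame of generators `T_k` and sections `S_k` with
`∑ S_k(e_i) T_k(e_j)* = δ_ij`. -/
def RightFrame.ofGenerators [CQGAlgebra G] [Nontrivial P.tot] (e : Module.Basis (Fin n) ℂ V)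
    (T S : κ → P.Sec α)
    (hS : ∀ i j, ∑ k, Sec.toLin P (S k) (e i) * star (Sec.toLin P (T k) (e j)) =
      if i = j then 1 else 0) : P.RightFrame α κ where
  sec := S
  dual k := ∑ i, star (Sec.toLin P (T k) (e i)) ⊗ₜ[ℂ] e i
  invariant k := by
    -- Here the first leg transforms by the entrywise adjoint of `u`, which is again a matrix
    -- corepresentation, so its left inverse `uᵀ` is also a right inverse.
    have hu := (α.isMatrixCorep_matrix e).map_star.mul_eq_one_comm
      (transpose_mul_map_star_matrix T S hS)
    simp only [map_sum, Corep.tensor_coact_tmul, α.coact_basis e, coact_star_sec_basis e]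
    rw [TensorProduct.sum_tmul]
    exact Corep.sum_mulT_of_mul_transpose_eq_one _ _ hu
  sum_dual v := by
    have h : ∀ v ∈ Submodule.span ℂ (Set.range e), ∑ k, LinearMap.rTensor V
        (LinearMap.mulLeft ℂ (Sec.toLin P (S k) v))
        (∑ i, star (Sec.toLin P (T k) (e i)) ⊗ₜ[ℂ] e i) = (1 : P.tot) ⊗ₜ[ℂ] v := by
      intro v hv
      induction hv using Submodule.span_induction with
      | mem v hv =>
        obtain ⟨j, rfl⟩ := hv
        simp only [map_sum, LinearMap.rTensor_tmul, LinearMap.mulLeft_apply]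
        rw [Finset.sum_comm]
        simp only [← TensorProduct.sum_tmul, hS]
        rw [Finset.sum_eq_single j (fun l _ hl => by simp [hl.symm]) (by simp)]
        simp
      | zero => simp
      | add a b _ _ ha hb =>
        rw [TensorProduct.tmul_add, ← ha, ← hb, ← Finset.sum_add_distrib]
        simp [add_mul, TensorProduct.add_tmul, Finset.sum_add_distrib]
      | smul c a _ ha =>
        rw [TensorProduct.tmul_smul, ← ha, Finset.smul_sum]
        simp [Finset.smul_sum, TensorProduct.smul_tmul']
    exact h v (by rw [e.span_eq]; trivial)

/-- The generators of the standing assumption form frames on both sides. -/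
theorem HasGenerators.exists_frames [CQGAlgebra G] [Nontrivial P.tot] (h : P.HasGenerators α) :
    ∃ d : ℕ, Nonempty (P.LeftFrame α (Fin d)) ∧ Nonempty (P.RightFrame α (Fin d)) := by
  obtain ⟨n, d, e, T, Z, -, hT, hZ⟩ := h
  refine ⟨d, ⟨LeftFrame.ofGenerators e T hT⟩,
    -- With `S_k = ∑_l Z_{kl} T_l`, the relation `(Z X)ᵀ X* = 1` becomes `∑ S_k(e_i) T_k(e_j)* =
    -- δ_{ij}`.
    ⟨RightFrame.ofGenerators e T (fun k => ∑ l, Z k l • (show P.Sec α from T l)) fun i j => ?_⟩⟩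
  rw [← hZ i j]
  refine Finset.sum_congr rfl fun k _ => congrArg (· * _) ?_
  rw [map_sum, LinearMap.sum_apply]
  rfl

end generators

end QPBundle

/-! ### Corepresentations as modules over the free algebra on the functionals on `G` -/

namespace Corep

variable {G : Type*} [Ring G] [HopfAlgebra ℂ G]
variable {V W : Type*} [AddCommGroup V] [Module ℂ V] [AddCommGroup W] [Module ℂ W]

/-- The operator `v ↦ v⁽⁰⁾ f(v⁽¹⁾)` of a functional `f` on `G`. -/
def act (α : Corep G V) (f : Module.Dual ℂ G) : V →ₗ[ℂ] V :=
  (TensorProduct.rid ℂ V).toLinearMap ∘ₗ LinearMap.lTensor V f ∘ₗ α.coact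

theorem act_apply (α : Corep G V) (f : Module.Dual ℂ G) (v : V) :
    α.act f v = TensorProduct.rid ℂ V (LinearMap.lTensor V f (α.coact v)) := rfl

theorem rid_lTensor_rTensor (φ : V →ₗ[ℂ] W) (f : Module.Dual ℂ G) (s : V ⊗[ℂ] G) :
    TensorProduct.rid ℂ W (LinearMap.lTensor W f (LinearMap.rTensor G φ s)) =
      φ (TensorProduct.rid ℂ V (LinearMap.lTensor V f s)) := by
  induction s with
  | zero => simp
  | add a b ha hb => simp only [map_add, ha, hb]
  | tmul v g => simp

/-- Elements of `V ⊗ G` are separated by the functionals on `G`. -/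
theorem eq_of_rid_lTensor {s t : V ⊗[ℂ] G} (h : ∀ f : Module.Dual ℂ G,
    TensorProduct.rid ℂ V (LinearMap.lTensor V f s) =
      TensorProduct.rid ℂ V (LinearMap.lTensor V f t)) : s = t := by
  classical
  apply (TensorProduct.equivFinsuppOfBasisRight (M := V) (Module.Basis.ofVectorSpace ℂ G)).injective
  ext i
  rw [TensorProduct.equivFinsuppOfBasisRight_apply, TensorProduct.equivFinsuppOfBasisRight_apply, h]

/-- The morphisms of degree `0` are the linear maps that commute with the functionals on `G`. -/
theorem mem_hom0_iff {α : Corep G V} {β : Corep G W} {φ : V →ₗ[ℂ] W} :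
    φ ∈ Hom0 α β ↔ ∀ f v, β.act f (φ v) = φ (α.act f v) := by
  refine ⟨fun h f v => ?_, fun h v => eq_of_rid_lTensor fun f => ?_⟩
  · rw [act_apply, h v, rid_lTensor_rTensor, act_apply]
  · rw [rid_lTensor_rTensor]
    exact h f v

/-- The space of a corepresentation as a module over the free algebra on the functionals
on `G`. -/
def Mod (_ : Corep G V) : Type _ := V

section module

variable (α : Corep G V)

instance : AddCommGroup α.Mod := inferInstanceAs (AddCommGroup V)

instance : Module ℂ α.Mod := inferInstanceAs (Module ℂ V)

instance [FiniteDimensional ℂ V] : FiniteDimensional ℂ α.Mod :=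
  inferInstanceAs (FiniteDimensional ℂ V)

instance : Module (FreeAlgebra ℂ (Module.Dual ℂ G)) α.Mod :=
  Module.compHom V (FreeAlgebra.lift ℂ α.act).toRingHom

/-- The identity from the space of a corepresentation to the module. -/
def toMod : V ≃ₗ[ℂ] α.Mod := LinearEquiv.refl ℂ V

theorem ι_smul (f : Module.Dual ℂ G) (v : V) :
    FreeAlgebra.ι ℂ f • α.toMod v = α.toMod (α.act f v) := by
  change FreeAlgebra.lift ℂ α.act (FreeAlgebra.ι ℂ f) _ = _
  rw [FreeAlgebra.lift_ι_apply]
  rfl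

instance : IsScalarTower ℂ (FreeAlgebra ℂ (Module.Dual ℂ G)) α.Mod where
  smul_assoc c r v := by
    change FreeAlgebra.lift ℂ α.act (c • r) (α.toMod.symm v) =
      c • FreeAlgebra.lift ℂ α.act r (α.toMod.symm v)
    rw [map_smul]
    rfl

variable {α} {β : Corep G W}

/-- A linear map that commutes with the functionals on `G` is linear over the free algebra. -/
theorem map_smul_of_ι {A B : Type*} [AddCommGroup A] [Module ℂ A]
    [Module (FreeAlgebra ℂ (Module.Dual ℂ G)) A]
    [IsScalarTower ℂ (FreeAlgebra ℂ (Module.Dual ℂ G)) A]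
    [AddCommGroup B] [Module ℂ B] [Module (FreeAlgebra ℂ (Module.Dual ℂ G)) B]
    [IsScalarTower ℂ (FreeAlgebra ℂ (Module.Dual ℂ G)) B] (φ : A →ₗ[ℂ] B)
    (h : ∀ (f : Module.Dual ℂ G) a, φ (FreeAlgebra.ι ℂ f • a) = FreeAlgebra.ι ℂ f • φ a)
    (r : FreeAlgebra ℂ (Module.Dual ℂ G)) (a : A) : φ (r • a) = r • φ a := by
  induction r using FreeAlgebra.induction generalizing a with
  | grade0 c => rw [algebraMap_smul, algebraMap_smul, map_smul]
  | grade1 f => exact h f a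
  | mul x y hx hy => rw [mul_smul, hx, hy, mul_smul]
  | add x y hx hy => rw [add_smul, map_add, hx, hy, add_smul]

/-- A subspace that is stable under the functionals on `G` as a submodule. -/
def stable (U : Submodule ℂ V) (hU : ∀ f, ∀ v ∈ U, α.act f v ∈ U) :
    Submodule (FreeAlgebra ℂ (Module.Dual ℂ G)) α.Mod where
  carrier := {v | α.toMod.symm v ∈ U}
  add_mem' := fun {x y} hx hy => by
    simp only [Set.mem_ofPred_eq] at *
    rw [map_add]
    exact add_mem hx hy
  zero_mem' := by simp
  smul_mem' r v hv := by
    simp only [Set.mem_ofPred_eq] at *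
    induction r using FreeAlgebra.induction generalizing v with
    | grade0 c =>
      rw [algebraMap_smul, map_smul]
      exact U.smul_mem c hv
    | grade1 f =>
      obtain ⟨v, rfl⟩ := α.toMod.surjective v
      rw [LinearEquiv.symm_apply_apply] at hv
      rw [ι_smul, LinearEquiv.symm_apply_apply]
      exact hU f v hv
    | mul a b ha hb =>
      rw [mul_smul]
      exact ha _ (hb _ hv)
    | add a b ha hb =>
      rw [add_smul, map_add]
      exact add_mem (ha _ hv) (hb _ hv)

/-- A morphism of degree `0` as a linear map of modules. -/
def modHom (φ : V →ₗ[ℂ] W) (hφ : φ ∈ Hom0 α β) :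
    α.Mod →ₗ[FreeAlgebra ℂ (Module.Dual ℂ G)] β.Mod where
  toFun v := β.toMod (φ (α.toMod.symm v))
  map_add' v w := by simp
  map_smul' := map_smul_of_ι (β.toMod.toLinearMap ∘ₗ φ ∘ₗ α.toMod.symm.toLinearMap) fun f v => by
    obtain ⟨v, rfl⟩ := α.toMod.surjective v
    simp [ι_smul, mem_hom0_iff.1 hφ]

theorem modHom_toMod (φ : V →ₗ[ℂ] W) (hφ : φ ∈ Hom0 α β) (v : V) :
    modHom φ hφ (α.toMod v) = β.toMod (φ v) := rfl

/-- A linear map of modules gives a morphism of degree `0`. -/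
theorem restrictScalars_mem_hom0 (φ : α.Mod →ₗ[FreeAlgebra ℂ (Module.Dual ℂ G)] β.Mod) :
    β.toMod.symm.toLinearMap ∘ₗ φ.restrictScalars ℂ ∘ₗ α.toMod.toLinearMap ∈ Hom0 α β :=
  mem_hom0_iff.2 fun f v => β.toMod.injective (by simp [← ι_smul])

/-- A subspace invariant under the coaction is stable under all slices by functionals, so it is a
submodule. -/
theorem isIrreducible_of_isSimpleModule
    (h : IsSimpleModule (FreeAlgebra ℂ (Module.Dual ℂ G)) α.Mod) : α.IsIrreducible := by
  refine ⟨IsSimpleModule.nontrivial (FreeAlgebra ℂ (Module.Dual ℂ G)) α.Mod, fun U hU => ?_⟩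
  have hs : ∀ f, ∀ v ∈ U, α.act f v ∈ U := by
    intro f v hv
    obtain ⟨s, hs⟩ := hU v hv
    rw [act_apply, ← hs, rid_lTensor_rTensor]
    exact Subtype.prop _
  refine (eq_bot_or_eq_top (stable U hs)).imp (fun h => ?_) fun h => ?_
  · refine (Submodule.eq_bot_iff _).2 fun v hv => ?_
    have : α.toMod v ∈ stable U hs := hv
    rw [h, Submodule.mem_bot] at this
    simpa using this
  · refine Submodule.eq_top_iff'.2 fun v => ?_
    have : α.toMod v ∈ stable U hs := h ▸ Submodule.mem_top
    exact this

end module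

/-! ### Semisimplicity of finite dimensional corepresentations -/

section semisimple

/-- A corepresentation on a Hilbert space whose operators `α.act f` have adjoints of the same form
is semisimple. -/
theorem isSemisimpleModule_of_adjoint {E : Type*} [NormedAddCommGroup E] [InnerProductSpace ℂ E]
    [FiniteDimensional ℂ E] (α : Corep G E)
    (h : ∀ f, ∃ f', α.act f = LinearMap.adjoint (α.act f')) :
    IsSemisimpleModule (FreeAlgebra ℂ (Module.Dual ℂ G)) α.Mod := by
  rw [isSemisimpleModule_iff]
  refine ⟨fun N => ?_⟩
  let U : Submodule ℂ E := (N.restrictScalars ℂ).comap α.toMod.toLinearMap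
  have hU : ∀ f, ∀ v ∈ U, α.act f v ∈ U := fun f v hv => by
    have := N.smul_mem (FreeAlgebra.ι ℂ f) hv
    exact α.ι_smul f v ▸ this
  -- The operator of `f` is the adjoint of one that preserves `U`, so it preserves the orthogonal
  -- complement.
  have hU' : ∀ f, ∀ v ∈ Uᗮ, α.act f v ∈ Uᗮ := fun f v hv => by
    obtain ⟨f', hf'⟩ := h f
    rw [Submodule.mem_orthogonal] at hv ⊢
    intro w hw
    rw [hf', LinearMap.adjoint_inner_right]
    exact hv _ (hU f' w hw)
  have hc : IsCompl U Uᗮ := Submodule.isCompl_orthogonal U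
  refine ⟨stable Uᗮ hU', Submodule.disjoint_def.2 fun v hv hv' => ?_,
    Submodule.codisjoint_iff_exists_add_eq.2 fun v => ?_⟩
  · obtain ⟨v, rfl⟩ := α.toMod.surjective v
    rw [Submodule.disjoint_def.1 hc.disjoint v hv hv', map_zero]
  · obtain ⟨v, rfl⟩ := α.toMod.surjective v
    obtain ⟨x, y, hx, hy, hxy⟩ := Submodule.codisjoint_iff_exists_add_eq.1 hc.codisjoint v
    exact ⟨α.toMod x, α.toMod y, hx, hy, by rw [← map_add, hxy]⟩

variable {n : ℕ} {u : Matrix (Fin n) (Fin n) G}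

/-- The corepresentation on a space with a basis given by a matrix. -/
def ofMatrix (e : Module.Basis (Fin n) ℂ V) (hu : IsMatrixCorep u) : Corep G V where
  coact := e.constr ℂ fun j => ∑ i, e i ⊗ₜ[ℂ] u i j
  counit_coact v := by
    refine LinearMap.congr_fun (f := (TensorProduct.rid ℂ V).toLinearMap ∘ₗ
      LinearMap.lTensor V (Coalgebra.counit (R := ℂ) (A := G)) ∘ₗ
        e.constr ℂ fun j => ∑ i, e i ⊗ₜ[ℂ] u i j) (g := LinearMap.id) (e.ext fun j => ?_) v
    simp [hu.counit]
  coassoc v := by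
    refine LinearMap.congr_fun (f := (TensorProduct.assoc ℂ V G G).toLinearMap ∘ₗ
      LinearMap.rTensor G (e.constr ℂ fun j => ∑ i, e i ⊗ₜ[ℂ] u i j) ∘ₗ
        e.constr ℂ fun j => ∑ i, e i ⊗ₜ[ℂ] u i j)
      (g := LinearMap.lTensor V (Coalgebra.comul (R := ℂ) (A := G)) ∘ₗ
        e.constr ℂ fun j => ∑ i, e i ⊗ₜ[ℂ] u i j) (e.ext fun j => ?_) v
    simp only [LinearMap.comp_apply, Module.Basis.constr_basis, map_sum, LinearMap.rTensor_tmul,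
      LinearMap.lTensor_tmul, hu.comul, TensorProduct.sum_tmul, TensorProduct.tmul_sum,
      LinearEquiv.coe_coe, TensorProduct.assoc_tmul]
    exact Finset.sum_comm

theorem ofMatrix_coact (e : Module.Basis (Fin n) ℂ V) (hu : IsMatrixCorep u) (j : Fin n) :
    (ofMatrix e hu).coact (e j) = ∑ i, e i ⊗ₜ[ℂ] u i j := e.constr_basis ℂ _ j

theorem ofMatrix_act (e : Module.Basis (Fin n) ℂ V) (hu : IsMatrixCorep u)
    (f : Module.Dual ℂ G) (j : Fin n) :
    (ofMatrix e hu).act f (e j) = ∑ i, f (u i j) • e i := by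
  rw [act_apply, ofMatrix_coact]
  simp

/-- The regular corepresentation. -/
def regular (G : Type*) [Ring G] [HopfAlgebra ℂ G] : Corep G G where
  coact := Coalgebra.comul
  counit_coact v := by simp
  coassoc v := Coalgebra.coassoc_apply v

theorem coeff_mem_hom0 (α : Corep G V) (φ : V →ₗ[ℂ] ℂ) : α.coeff φ ∈ Hom0 α (regular G) :=
  α.comul_coeff φ

variable [StarRing G] [StarModule ℂ G]

/-- Unitary corepresentations are semisimple. -/
theorem isSemisimpleModule_ofMatrix (hu : IsMatrixCorep u) (h : u.conjTranspose * u = 1) :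
    IsSemisimpleModule (FreeAlgebra ℂ (Module.Dual ℂ G))
      (ofMatrix (EuclideanSpace.basisFun (Fin n) ℂ).toBasis hu).Mod := by
  -- The left inverse `u*` and the right inverse given by the antipode coincide.
  have hS : ∀ i j, HopfAlgebra.antipode ℂ (u i j) = star (u j i) := fun i j =>
    (congrArg (fun A : Matrix _ _ G => A i j) (left_inv_eq_right_inv h hu.mul_antipode)).symm
  refine isSemisimpleModule_of_adjoint _ fun f => ?_
  -- This functional takes `u i j` to the conjugate of `f (u j i)`, so its operator has the
  -- conjugate transposed matrix in the orthonormal basis.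
  refine ⟨{ toFun := fun g => star (f (star (HopfAlgebra.antipode ℂ g)))
            map_add' := fun x y => by simp
            map_smul' := fun c x => by simp }, ?_⟩
  rw [LinearMap.eq_adjoint_iff_basis (EuclideanSpace.basisFun (Fin n) ℂ).toBasis
    (EuclideanSpace.basisFun (Fin n) ℂ).toBasis]
  intro j k
  rw [ofMatrix_act, ofMatrix_act, sum_inner, inner_sum]
  simp [inner_smul_left, inner_smul_right, hS, EuclideanSpace.inner_single_left]

/-- The regular corepresentation is semisimple. -/
theorem isSemisimpleModule_regular [CQGAlgebra G] :
    IsSemisimpleModule (FreeAlgebra ℂ (Module.Dual ℂ G)) (regular G).Mod := by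
  refine isSemisimpleModule_of_isSemisimpleModule_submodule
    (s := {N : Submodule (FreeAlgebra ℂ (Module.Dual ℂ G)) (regular G).Mod |
      IsSemisimpleModule (FreeAlgebra ℂ (Module.Dual ℂ G)) N}) (p := id) (fun N hN => hN) ?_
  -- `N` is the sum of all semisimple submodules. It is everything once it contains the coefficients
  -- of unitary corepresentations, since these span `G`.
  set N := ⨆ N ∈ {N : Submodule (FreeAlgebra ℂ (Module.Dual ℂ G)) (regular G).Mod |
    IsSemisimpleModule (FreeAlgebra ℂ (Module.Dual ℂ G)) N}, id N with hN
  refine Submodule.eq_top_iff'.2 fun g => ?_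
  obtain ⟨g, rfl⟩ := (regular G).toMod.surjective g
  suffices (⊤ : Submodule ℂ G) ≤ (N.restrictScalars ℂ).comap (regular G).toMod.toLinearMap from
    this (Submodule.mem_top (x := g))
  rw [← CQGAlgebra.span_coefficients, Submodule.span_le]
  rintro _ ⟨n, u, h1, h2, -, h3, i, j, rfl⟩
  have hu : IsMatrixCorep u := ⟨h1, h2⟩
  let e := (EuclideanSpace.basisFun (Fin n) ℂ).toBasis
  have := isSemisimpleModule_ofMatrix hu h3
  -- The range of this coefficient map is an image of a semisimple module, and it contains `u i j`
  -- as the image of `e j`.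
  let φ := modHom _ ((ofMatrix e hu).coeff_mem_hom0 (e.coord i))
  have hφ : IsSemisimpleModule (FreeAlgebra ℂ (Module.Dual ℂ G)) (LinearMap.range φ) :=
    IsSemisimpleModule.range φ
  have hle : LinearMap.range φ ≤ N := le_iSup₂_of_le (LinearMap.range φ) hφ le_rfl
  have hc : (ofMatrix e hu).coeff (e.coord i) (e j) = u i j := by
    rw [coeff_apply, ofMatrix_coact]
    simp [Finsupp.single_apply]
  exact hle ⟨(ofMatrix e hu).toMod (e j), congrArg (regular G).toMod hc⟩

/-- Finite dimensional corepresentations are semisimple. -/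
theorem isSemisimpleModule [CQGAlgebra G] [FiniteDimensional ℂ V] (α : Corep G V) :
    IsSemisimpleModule (FreeAlgebra ℂ (Module.Dual ℂ G)) α.Mod := by
  have := isSemisimpleModule_regular (G := G)
  let e := Module.finBasis ℂ V
  -- The coefficient maps of the coordinate functionals embed `V` in a power of the regular
  -- corepresentation; injectivity holds because the counit recovers each coordinate.
  refine IsSemisimpleModule.of_injective
    (LinearMap.pi fun i => modHom _ (α.coeff_mem_hom0 (e.coord i))) ?_
  rw [injective_iff_map_eq_zero]
  intro v hv
  obtain ⟨v, rfl⟩ := α.toMod.surjective v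
  suffices v = 0 by rw [this, map_zero]
  refine e.ext_elem_iff.2 fun i => ?_
  have h1 := congrFun hv i
  rw [LinearMap.pi_apply, modHom_toMod, Pi.zero_apply, LinearEquiv.map_eq_zero_iff] at h1
  have h2 := α.counit_coeff (e.coord i) v
  rw [h1, map_zero] at h2
  simpa using h2.symm

end semisimple

/-! ### Direct summands of corepresentations -/

section summand

variable (α : Corep G V) (ι : W →ₗ[ℂ] V) (π : V →ₗ[ℂ] W)

/-- The projection `ι π` commutes with the coaction and `π ι π = π`. This gives both coassociativity
of the compressed coaction and the fact that `π` is a morphism. -/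
theorem rTensor_coact_comp (h : ∀ w, π (ι w) = w) (hp : ι ∘ₗ π ∈ Hom0 α α) (v : V) :
    LinearMap.rTensor G π (α.coact (ι (π v))) = LinearMap.rTensor G π (α.coact v) := by
  have := hp v
  rw [LinearMap.comp_apply] at this
  rw [this, ← LinearMap.comp_apply, ← LinearMap.rTensor_comp, ← LinearMap.comp_assoc]
  congr 2
  ext v
  simp [h]

variable (h : ∀ w, π (ι w) = w) (hp : ι ∘ₗ π ∈ Hom0 α α)

/-- The restriction of a corepresentation to a direct summand. -/
def summand : Corep G W where
  coact := LinearMap.rTensor G π ∘ₗ α.coact ∘ₗ ι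
  counit_coact w := by
    rw [LinearMap.comp_apply, LinearMap.comp_apply, rid_lTensor_rTensor, α.counit_coact, h]
  coassoc w := by
    have h1 : LinearMap.rTensor G π ∘ₗ α.coact ∘ₗ ι ∘ₗ π = LinearMap.rTensor G π ∘ₗ α.coact :=
      LinearMap.ext (α.rTensor_coact_comp ι π h hp)
    have h2 : ∀ s : V ⊗[ℂ] G, TensorProduct.assoc ℂ W G G
        (LinearMap.rTensor G (LinearMap.rTensor G π) (LinearMap.rTensor G α.coact s)) =
        LinearMap.rTensor (G ⊗[ℂ] G) π (TensorProduct.assoc ℂ V G G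
          (LinearMap.rTensor G α.coact s)) := by
      intro s
      generalize LinearMap.rTensor G α.coact s = t
      induction t with
      | zero => simp
      | add a b ha hb => simp only [map_add, ha, hb]
      | tmul x g =>
        induction x with
        | zero => simp
        | add a b ha hb => simp only [TensorProduct.add_tmul, map_add, ha, hb]
        | tmul v k => simp
    rw [LinearMap.comp_apply, LinearMap.comp_apply, ← LinearMap.comp_apply (LinearMap.rTensor G _),
      ← LinearMap.rTensor_comp, LinearMap.comp_assoc, LinearMap.comp_assoc, h1,
      LinearMap.rTensor_comp, LinearMap.comp_apply, h2, α.coassoc, ← LinearMap.comp_apply,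
      LinearMap.rTensor_comp_lTensor, ← LinearMap.comp_apply (LinearMap.lTensor W _),
      LinearMap.lTensor_comp_rTensor]

theorem proj_mem_hom0 : π ∈ Hom0 α (α.summand ι π h hp) := α.rTensor_coact_comp ι π h hp

theorem incl_mem_hom0 : ι ∈ Hom0 (α.summand ι π h hp) α := fun w => by
  change _ = LinearMap.rTensor G ι (LinearMap.rTensor G π (α.coact (ι w)))
  have := hp (ι w)
  rwa [LinearMap.comp_apply, h, LinearMap.rTensor_comp, LinearMap.comp_apply] at this

end summand

end Corep

end

/-! ### Decomposition into irreducible corepresentations -/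

namespace Corep

variable {G : Type*} [Ring G] [HopfAlgebra ℂ G] [StarRing G] [StarModule ℂ G] [CQGAlgebra G]
  {V : Type*} [AddCommGroup V] [Module ℂ V] [FiniteDimensional ℂ V]

/-- A finite dimensional corepresentation is a finite direct sum of irreducible ones. -/
theorem exists_irreducible_decomposition (α : Corep G V) :
    ∃ (n : ℕ) (m : Fin n → ℕ) (β : ∀ i, Corep G (Fin (m i) → ℂ))
      (ι : ∀ i, (Fin (m i) → ℂ) →ₗ[ℂ] V) (π : ∀ i, V →ₗ[ℂ] (Fin (m i) → ℂ)),
      (∀ i, (β i).IsIrreducible) ∧ (∀ i, ι i ∈ Hom0 (β i) α) ∧ (∀ i, π i ∈ Hom0 α (β i)) ∧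
      ∀ v, ∑ i, ι i (π i v) = v := by
  have := α.isSemisimpleModule
  have : Module.Finite (FreeAlgebra ℂ (Module.Dual ℂ G)) α.Mod :=
    Module.Finite.of_restrictScalars_finite ℂ _ _
  obtain ⟨n, S, E, hS⟩ := IsSemisimpleModule.exists_linearEquiv_fin_dfinsupp
    (FreeAlgebra ℂ (Module.Dual ℂ G)) α.Mod
  have hf : ∀ i, FiniteDimensional ℂ (S i) := fun i =>
    inferInstanceAs (FiniteDimensional ℂ ((S i).restrictScalars ℂ))
  -- Coordinates move the simple submodules to spaces `Fin m → ℂ`, which live in `Type`, the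
  -- universe over which `HasAllGenerators` quantifies.
  let b := fun i => (Module.finBasis ℂ (S i)).equivFun
  let inc := fun i => E.symm.toLinearMap ∘ₗ DFinsupp.lsingle (M := fun i => S i) i
  let prj := fun i => DFinsupp.lapply (M := fun i => S i) i ∘ₗ E.toLinearMap
  let ι : ∀ i, (Fin (Module.finrank ℂ (S i)) → ℂ) →ₗ[ℂ] V := fun i =>
    α.toMod.symm.toLinearMap ∘ₗ (inc i).restrictScalars ℂ ∘ₗ (b i).symm.toLinearMap
  let π : ∀ i, V →ₗ[ℂ] (Fin (Module.finrank ℂ (S i)) → ℂ) := fun i =>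
    (b i).toLinearMap ∘ₗ (prj i).restrictScalars ℂ ∘ₗ α.toMod.toLinearMap
  have h1 : ∀ i w, π i (ι i w) = w := fun i w => by simp [ι, π, inc, prj]
  -- The coordinate changes cancel, leaving the projection to the `i`-th summand, which is linear
  -- over the free algebra.
  have h2 : ∀ i, ι i ∘ₗ π i ∈ Hom0 α α := fun i => by
    have : ι i ∘ₗ π i = α.toMod.symm.toLinearMap ∘ₗ
        (inc i ∘ₗ prj i).restrictScalars ℂ ∘ₗ α.toMod.toLinearMap := by
      ext v
      simp [ι, π]
    rw [this]
    exact restrictScalars_mem_hom0 _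
  refine ⟨n, _, fun i => α.summand (ι i) (π i) (h1 i) (h2 i), ι, π, fun i => ?_,
    fun i => α.incl_mem_hom0 _ _ _ _, fun i => α.proj_mem_hom0 _ _ _ _, fun v => ?_⟩
  -- As a map to `S i` this is the inverse of the coordinate map, so the module of the summand is
  -- isomorphic to a simple one.
  · let φ := prj i ∘ₗ modHom _ (α.incl_mem_hom0 (ι i) (π i) (h1 i) (h2 i))
    have hφ : ∀ w, φ (toMod _ w) = (b i).symm w := fun w => by
      change prj i (α.toMod (ι i w)) = _
      simp [prj, ι, inc]
    have hb : Function.Bijective φ := by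
      have : ⇑φ = (b i).symm ∘ (toMod _).symm := by
        funext w
        obtain ⟨w, rfl⟩ := (toMod _).surjective w
        rw [hφ, Function.comp_apply, LinearEquiv.symm_apply_apply]
      rw [this]
      exact (b i).symm.bijective.comp (toMod _).symm.bijective
    have := hS i
    exact isIrreducible_of_isSimpleModule (IsSimpleModule.congr (LinearEquiv.ofBijective φ hb))
  · apply α.toMod.injective
    apply E.injective
    ext i
    simp [ι, π, inc, prj, DFinsupp.single_apply]

end Corep

/-! ### Frames for all finite dimensional corepresentations -/

namespace QPBundle

variable {G : Type*} [Ring G] [HopfAlgebra ℂ G] [StarRing G] [StarModule ℂ G] [CQGAlgebra G]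
  {M : Type*} [Ring M] [Algebra ℂ M] [StarRing M] [StarModule ℂ M] {P : QPBundle G M}
  {V : Type*} [AddCommGroup V] [Module ℂ V] [FiniteDimensional ℂ V]

/-- Under the standing assumption all finite dimensional corepresentations have frames. -/
theorem HasAllGenerators.exists_frames (hP : P.HasAllGenerators) (α : Corep G V) :
    ∃ (κ : Type) (_ : Fintype κ), Nonempty (P.LeftFrame α κ) ∧ Nonempty (P.RightFrame α κ) := by
  -- If the total space is zero, then `v ⊗ 1 = 0` and the empty frame suffices. Otherwise identities
  -- in `G` can be read off in `B ⊗ G`, and the frames of the irreducible summands are added up.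
  cases subsingleton_or_nontrivial P.tot with
  | inl h =>
    refine ⟨Fin 0, inferInstance, ⟨⟨finZeroElim, finZeroElim, fun k => k.elim0, fun v => ?_⟩⟩,
      ⟨⟨finZeroElim, finZeroElim, fun k => k.elim0, fun v => ?_⟩⟩⟩
    · rw [Subsingleton.elim (1 : P.tot) 0]
      simp
    · rw [Subsingleton.elim (1 : P.tot) 0]
      simp
  | inr h =>
    obtain ⟨n, m, β, ι, π, hβ, hι, hπ, hsum⟩ := α.exists_irreducible_decomposition
    choose d F F' using fun i => (hP _ (β i) (hβ i)).exists_frames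
    exact ⟨Σ i, Fin (d i), inferInstance, ⟨LeftFrame.sum ι π hι hπ hsum fun i => (F i).some⟩,
      ⟨RightFrame.sum ι π hι hπ hsum fun i => (F' i).some⟩⟩

end QPBundle


/-- The quantum association functor is compatible with tensor products. All associated bundles
`qAss α` are quantum vector bundles with connection (`h`), and there are parallel isomorphisms of
degree `0` (`A`) from `qAss (α ⊗ β)` to `qAss α ⊗ qAss β`, with inverse
`T ⊗ S ↦ (v ⊗ w ↦ T v * S w)`, natural with respect to the morphisms of degree `0` (pairs
`f : α → α'`, `g : β → β'`, acting by `f ⊗ g`) and of degree `1` (pairs of antilinear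
`f : α → β'`, `g : β → α'`, acting by the twisted tensor product `v ⊗ w ↦ g w ⊗ f v`). -/
theorem proposition3
    {G : Type uG} [Ring G] [HopfAlgebra ℂ G] [StarRing G] [StarModule ℂ G] [CQGAlgebra G]
    {M : Type uM} [Ring M] [Algebra ℂ M] [StarRing M] [StarModule ℂ M]
    (P : QPBundle.{uG, uM, uP} G M) (hP : P.HasAllGenerators)
    (H : HorizontalCalculus.{uH, uB, uG, uM, uP} P) (Δ : H.CovDer) :
    ∃ h : ∀ α : QRep.{v} G, H.Associable α.rep,
    ∃ A : ∀ α β : QRep.{v} G, QVB.ParallelIso (HorizontalCalculus.qAss Δ h (α.tensor β))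
        ((HorizontalCalculus.qAss Δ h α).tensor (HorizontalCalculus.qAss Δ h β)),
      (∀ (α β : QRep.{v} G) (T : P.Sec α.rep) (S : P.Sec β.rep) (v : α.V) (w : β.V),
        QPBundle.Sec.toLin P ((HorizontalCalculus.tensorEquiv (A α β)).symm (BT.tmul M T S))
          (v ⊗ₜ[ℂ] w) = QPBundle.Sec.toLin P T v * QPBundle.Sec.toLin P S w) ∧
      (∀ (α β α' β' : QRep.{v} G) (f : α.V →ₗ[ℂ] α'.V) (g : β.V →ₗ[ℂ] β'.V)
        (hf : f ∈ Corep.Hom0 α.rep α'.rep) (hg : g ∈ Corep.Hom0 β.rep β'.rep)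
        (T : P.Sec (α'.rep.tensor β'.rep)),
        HorizontalCalculus.tensorEquiv (A α β)
            (QPBundle.Sec.pull P (TensorProduct.map f g) (Corep.map_mem_hom0 hf hg) T) =
          BT.map (QPBundle.Sec.pull P f hf) (QPBundle.Sec.pull P g hg)
            (QPBundle.Sec.pull_right f hf) (QPBundle.Sec.pull_left g hg)
            (HorizontalCalculus.tensorEquiv (A α' β') T)) ∧
      (∀ (α β α' β' : QRep.{v} G) (f : α.V →ₛₗ[starRingEnd ℂ] β'.V)
        (g : β.V →ₛₗ[starRingEnd ℂ] α'.V)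
        (hf : f ∈ Corep.Hom1 α.rep β'.rep) (hg : g ∈ Corep.Hom1 β.rep α'.rep)
        (T : P.Sec (α'.rep.tensor β'.rep)),
        HorizontalCalculus.tensorEquiv (A α β)
            (QPBundle.Sec.pullStar P (Corep.twist f g) (Corep.twist_mem_hom1 hf hg) T) =
          BT.twist (QPBundle.Sec.pullStar P g hg) (QPBundle.Sec.pullStar P f hf)
            (QPBundle.Sec.pullStar_right g hg) (QPBundle.Sec.pullStar_left f hf)
            (HorizontalCalculus.tensorEquiv (A α' β') T)) := by
  choose κ hκ F F' using fun α : QRep.{v} G => hP.exists_frames α.rep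
  have h : ∀ α : QRep.{v} G, H.Associable α.rep := fun α =>
    H.associable_of_frames (F α).some (F' α).some
  have hb : ∀ α β : QRep.{v} G, Function.Bijective (QPBundle.mulSec P α.rep β.rep) := fun α β =>
    QPBundle.bijective_mulSec α.rep (F β).some
  have happ : ∀ (α β : QRep.{v} G) t,
      (LinearEquiv.ofBijective _ (hb α β)).symm (QPBundle.mulSec P α.rep β.rep t) = t :=
    fun α β => (LinearEquiv.ofBijective _ (hb α β)).symm_apply_apply
  refine ⟨h, fun α β => HorizontalCalculus.mulSecIso Δ (h α) (h β) (h (α.tensor β)) (hb α β),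
    fun α β => QPBundle.mulSec_tmul α.rep β.rep, fun α β α' β' f g hf hg T => ?_,
    fun α β α' β' f g hf hg T => ?_⟩
  -- Every section over the tensor product is in the image of the product map, so naturality of that
  -- map transfers to its inverse.
  · obtain ⟨t, rfl⟩ := (hb α' β').2 T
    rw [QPBundle.pull_mulSec hf hg]
    exact (happ α β _).trans (congrArg _ (happ α' β' t).symm)
  · obtain ⟨t, rfl⟩ := (hb α' β').2 T
    rw [QPBundle.pullStar_mulSec hf hg]
    exact (happ α β _).trans (congrArg _ (happ α' β' t).symm)
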